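/- For $s\ge 1$, an \emph{$s$-plex} is a finite graph $G=(V,E)$ in which every vertex is adjacent to at least $|V|-s$ other vertices, and an \emph{$s$-plex cluster graph} is a graph all of whose connected components are $s$-plexes. An instance of \textsc{$s$-Plex Cluster Vertex Deletion} is a pair $(G,k)$ of a finite undirected simple graph $G=(V,E)$ and a natural number $k\ge 0$ (the parameter). It is a yes-instance if there is a set $S\subseteq V$ with $|S|\le k$ such that $G-S$ is an $s$-plex cluster graph. \textbf{Theorem.} \textsc{$s$-Plex Cluster Vertex Deletion} has a problem kernel with $O(k^2s^3)$ vertices, and it can be found in $O(ksn^2)$ time, where $n=|V|$. Precisely: there are an algorithm (a program for a uniform-cost random access machine with addition and subtraction, whose input is $s$, $k$ and the adjacency matrix of $G$) and an absolute constant $C$ such that, for all $s\ge 1$ and every instance $(G,k)$, where $G$ has $n$ vertices, the algorithm halts after at most $C\cdot\max(k,1)\cdot s\cdot\max(n,1)^2$ steps and outputs an instance $(G',k')$ such that \begin{itemize} \item $k'\le k$, \item $(G,k)$ is a yes-instance if and only if $(G',k')$ is a yes-instance, and \item $G'$ has at most $C\cdot\max(k,1)^2\cdot s^3$ vertices. \end{itemize}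 -/

import Mathlib

/-! ### The problem: s-Plex Cluster Vertex Deletion -/

/-- An `s`-plex: every vertex is adjacent to at least `|V| - s` other vertices. -/
def IsSPlex {V : Type*} (s : ℕ) (G : SimpleGraph V) : Prop :=
  ∀ v : V, Nat.card V ≤ (G.neighborSet v).ncard + s

/-- An `s`-plex cluster graph: every connected component is an `s`-plex. -/
def IsSPlexClusterGraph {V : Type*} (s : ℕ) (G : SimpleGraph V) : Prop :=
  ∀ c : G.ConnectedComponent, IsSPlex s (G.induce c.supp)

/-- `(G, k)` is a yes-instance of `s`-Plex Cluster Vertex Deletion: some set `S` of at most `k`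
vertices is such that `G - S` is an `s`-plex cluster graph. -/
def IsYesInstance {V : Type*} (s : ℕ) (G : SimpleGraph V) (k : ℕ) : Prop :=
  ∃ S : Finset V, S.card ≤ k ∧ IsSPlexClusterGraph s (G.induce (S : Set V)ᶜ)

/-! ### Machine model: a uniform-cost random access machine

Programs are finite pieces of structured code over registers and zero-based arrays of natural
numbers. The arithmetic is addition and truncated subtraction (there is no multiplication), arrays
can be addressed indirectly, and every elementary operation costs one time unit. A given program
mentions only finitely many registers and arrays. -/

namespace RAM

/-- A memory configuration: the contents of the registers and of the arrays. -/
structure State where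
  reg : ℕ → ℕ
  arr : ℕ → ℕ → ℕ

/-- Expressions; `read a e` is the entry of array `a` at the index given by the value of `e`. -/
inductive Expr where
  | const (c : ℕ)
  | reg (x : ℕ)
  | read (a : ℕ) (e : Expr)
  | add (e₁ e₂ : Expr)
  | sub (e₁ e₂ : Expr)

/-- The value of an expression (`sub` is truncated at `0`). -/
def Expr.eval (σ : State) : Expr → ℕ
  | .const c => c
  | .reg x => σ.reg x
  | .read a e => σ.arr a (e.eval σ)
  | .add e₁ e₂ => e₁.eval σ + e₂.eval σ
  | .sub e₁ e₂ => e₁.eval σ - e₂.eval σ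

/-- The cost of evaluating an expression: one unit for every operation, constant and register
access in it. -/
def Expr.cost : Expr → ℕ
  | .const _ => 1
  | .reg _ => 1
  | .read _ e => e.cost + 1
  | .add e₁ e₂ => e₁.cost + e₂.cost + 1
  | .sub e₁ e₂ => e₁.cost + e₂.cost + 1

/-- Programs. A condition is an expression; it holds when its value is nonzero. -/
inductive Program where
  | skip
  | assign (x : ℕ) (e : Expr)
  | write (a : ℕ) (i e : Expr)
  | seq (p q : Program)
  | cond (b : Expr) (p q : Program)
  | loop (b : Expr) (p : Program)

/-- Overwrite register `x`. -/
def State.setReg (σ : State) (x v : ℕ) : State :=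
  { σ with reg := Function.update σ.reg x v }

/-- Overwrite entry `i` of array `a`. -/
def State.setArr (σ : State) (a i v : ℕ) : State :=
  { σ with arr := Function.update σ.arr a (Function.update (σ.arr a) i v) }

/-- `Run p σ t τ`: started in `σ`, the program `p` halts in `τ` after exactly `t` time units. -/
inductive Run : Program → State → ℕ → State → Prop where
  | skip (σ : State) : Run .skip σ 1 σ
  | assign (x : ℕ) (e : Expr) (σ : State) :
      Run (.assign x e) σ (e.cost + 1) (σ.setReg x (e.eval σ))
  | write (a : ℕ) (i e : Expr) (σ : State) :
      Run (.write a i e) σ (i.cost + e.cost + 1) (σ.setArr a (i.eval σ) (e.eval σ))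
  | seq {p q : Program} {σ τ υ : State} {t u : ℕ} (hp : Run p σ t τ) (hq : Run q τ u υ) :
      Run (.seq p q) σ (t + u) υ
  | condTrue {b : Expr} {p q : Program} {σ τ : State} {t : ℕ} (hb : b.eval σ ≠ 0)
      (hp : Run p σ t τ) : Run (.cond b p q) σ (b.cost + 1 + t) τ
  | condFalse {b : Expr} {p q : Program} {σ τ : State} {t : ℕ} (hb : b.eval σ = 0)
      (hq : Run q σ t τ) : Run (.cond b p q) σ (b.cost + 1 + t) τ
  | loopTrue {b : Expr} {p : Program} {σ τ υ : State} {t u : ℕ} (hb : b.eval σ ≠ 0)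
      (hp : Run p σ t τ) (hl : Run (.loop b p) τ u υ) :
      Run (.loop b p) σ (b.cost + 1 + t + u) υ
  | loopFalse {b : Expr} {p : Program} {σ : State} (hb : b.eval σ = 0) :
      Run (.loop b p) σ (b.cost + 1) σ

open Classical in
/-- The start configuration on input `(s, k, G)`: registers `0`, `1`, `2` hold `s`, `k` and the
number `n` of vertices, array `0` holds the adjacency matrix of `G` row by row, and everything else
is `0`. -/
noncomputable def input (s k : ℕ) {n : ℕ} (G : SimpleGraph (Fin n)) : State where
  reg := fun x => if x = 0 then s else if x = 1 then k else if x = 2 then n else 0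
  arr := fun a p =>
    if a = 0 ∧ ∃ i j : Fin n, p = (i : ℕ) * n + (j : ℕ) ∧ G.Adj i j then 1 else 0

open Classical in
/-- The configuration `σ` presents the instance `(G, k)` as output: registers `1` and `2` hold `k`
and the number `n` of vertices, and array `1` holds the adjacency matrix of `G` row by row. -/
def Outputs (σ : State) {n : ℕ} (G : SimpleGraph (Fin n)) (k : ℕ) : Prop :=
  σ.reg 1 = k ∧ σ.reg 2 = n ∧
    ∀ i j : Fin n, σ.arr 1 ((i : ℕ) * n + (j : ℕ)) = if G.Adj i j then 1 else 0

end RAM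

/-! Call a vertex set bad if it induces a connected graph that is not an `s`-plex. Being an `s`-plex
cluster graph is hereditary, so every solution meets every bad set, and disjoint bad sets bound the
size of a solution from below.

Connected `s`-plexes are grown greedily, vertex by vertex. When a new vertex destroys the plex
property, the plex and this vertex contain a bad set of at most `3s + 5` vertices (`bad_of_insert`,
`Growing.extract`): `s` missed vertices witness the violation, and `2s + 2` further ones secure
connectivity, because an `s`-plex with more than `2s` vertices is connected (`Plex.reach`). If `k +
1` disjoint bad sets turn up, their union is itself a small no-instance (`kernel_of_packing`).
Otherwise their union `X` has `O(ks)` vertices, and the rest splits into plexes without edges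
between them, the clusters.

For `x ∈ X`, an edge `xy` into a cluster and `2s` cluster vertices adjacent to exactly one of `x`,
`y` form a bad set (`bad_of_edge`). Such petals, disjoint apart from `x`, are packed greedily around
each `x`. More than `k` petals force `x` into every solution (`Packing.core_mem`). All petals
together occupy a set `T` of `O(k²s²)` vertices. Outside `T`, an unforced `x` has almost the same
neighbors as each of its neighbors; hence it touches at most `2s` clusters and misses fewer than
`3s` vertices of each of them.

The heart is an exchange argument (`Yes.of_erase`). Let `C` be the part outside `T` of the cluster
of `w`, and let `N` be the set of its neighbors outside `C`, forced vertices aside. Suppose that `w`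
is unmarked and `|C| ≥ 4s|N|`. A solution that ignores `w` may delete fewer than `|N|` vertices of
`C`; then the rest of `C` is connected and `w` can join its component. Otherwise the solution may
delete `N` in place of its vertices in `C`, which isolates the plex `C`. So it suffices to keep `X`,
the marked vertices and `4s|N|` further vertices of each cluster (`IsKernel.yes_iff`). Each vertex
of `T` accounts for `O(s)` kept vertices and each vertex of `X` for `O(s²)`, which gives `O(k²s³)`
in total (`IsKernel.card_le_of_tidy`, `kernel_of_tidy`).

Forced vertices stay in the kernel together with their petals, so the parameter does not change. The
greedy packing takes `O(kn)` steps of cost `O(n)`, and the petals cost `O(n²)` for each of the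
`O(ks)` vertices of `X`, which dominates the running time. -/

namespace SPlexKernel

set_option linter.unusedSectionVars false

/-! ### Bad sets, packings, and the exchange argument for a redundant vertex. -/

section Graph

variable {V : Type*} [DecidableEq V]

/-- Reachability by a walk all of whose vertices lie in `U`. -/
def Reach (H : SimpleGraph V) (U : Finset V) : V → V → Prop :=
  Relation.ReflTransGen fun a b => H.Adj a b ∧ a ∈ U ∧ b ∈ U

noncomputable instance (H : SimpleGraph V) (U : Finset V) (v : V) : DecidablePred (Reach H U v) :=
  Classical.decPred _

open scoped Classical in
/-- The vertices of `K` other than `v` that are not adjacent to `v`. -/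
noncomputable def missed (H : SimpleGraph V) (K : Finset V) (v : V) : Finset V :=
  K.filter fun u => u ≠ v ∧ ¬ H.Adj v u

/-- `H[K]` is an `s`-plex, for `s ≥ 1`. -/
def Plex (s : ℕ) (H : SimpleGraph V) (K : Finset V) : Prop :=
  ∀ v ∈ K, (missed H K v).card < s

/-- `H[U]` is an `s`-plex cluster graph, for `s ≥ 1`. -/
def Good (s : ℕ) (H : SimpleGraph V) (U : Finset V) : Prop :=
  ∀ v ∈ U, ((missed H U v).filter (Reach H U v)).card < s

/-- `(H[U], k)` is a yes-instance. -/
def Yes (s : ℕ) (H : SimpleGraph V) (U : Finset V) (k : ℕ) : Prop :=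
  ∃ S ⊆ U, S.card ≤ k ∧ Good s H (U \ S)

/-- `H[F]` is connected and not an `s`-plex. -/
def Bad (s : ℕ) (H : SimpleGraph V) (F : Finset V) : Prop :=
  ∃ v ∈ F, s ≤ (missed H F v).card ∧ ∀ u ∈ F, Reach H F v u

variable {s k : ℕ} {H : SimpleGraph V} {U K : Finset V}

theorem mem_missed {v u : V} : u ∈ missed H K v ↔ u ∈ K ∧ u ≠ v ∧ ¬ H.Adj v u := by
  simp [missed]

theorem missed_mono {K L : Finset V} (h : K ⊆ L) (v : V) : missed H K v ⊆ missed H L v :=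
  fun u hu => by rw [mem_missed] at *; exact ⟨h hu.1, hu.2⟩

theorem Reach.mono {A B : Finset V} (h : A ⊆ B) {a b : V} (r : Reach H A a b) : Reach H B a b :=
  Relation.ReflTransGen.lift id (fun _ _ h' => ⟨h'.1, h h'.2.1, h h'.2.2⟩) _ _ r

theorem Reach.symm {a b : V} (r : Reach H U a b) : Reach H U b a := by
  induction r with
  | refl => exact Relation.ReflTransGen.refl
  | tail _ h ih => exact Relation.ReflTransGen.head ⟨h.1.symm, h.2.2, h.2.1⟩ ih

theorem Reach.trans {a b c : V} (r : Reach H U a b) (r' : Reach H U b c) : Reach H U a c :=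
  Relation.ReflTransGen.trans r r'

theorem Reach.refl (a : V) : Reach H U a a := Relation.ReflTransGen.refl

theorem Reach.single {a b : V} (h : H.Adj a b) (ha : a ∈ U) (hb : b ∈ U) : Reach H U a b :=
  Relation.ReflTransGen.single ⟨h, ha, hb⟩

/-- A walk in `U` from a set without edges to the rest of `U` stays in this set. -/
theorem Reach.restrict {A : Finset V} (hA : ∀ a ∈ A, ∀ b ∈ U, H.Adj a b → b ∈ A) {a b : V}
    (r : Reach H U a b) (ha : a ∈ A) : b ∈ A ∧ Reach H A a b := by
  induction r with
  | refl => exact ⟨ha, Reach.refl _⟩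
  | tail _ h ih =>
    have := hA _ ih.1 _ h.2.2 h.1
    exact ⟨this, ih.2.trans (Reach.single h.1 ih.1 this)⟩

theorem Plex.mono {A B : Finset V} (h : A ⊆ B) (hB : Plex s H B) : Plex s H A :=
  fun v hv => (Finset.card_le_card (missed_mono h v)).trans_lt (hB v (h hv))

theorem Plex.good (h : Plex s H U) : Good s H U :=
  fun v hv => (Finset.card_le_card (Finset.filter_subset _ _)).trans_lt (h v hv)

theorem Good.mono {A B : Finset V} (h : A ⊆ B) (hB : Good s H B) : Good s H A := by
  refine fun v hv => (Finset.card_le_card ?_).trans_lt (hB v (h hv))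
  intro u hu
  rw [Finset.mem_filter] at *
  exact ⟨missed_mono h v hu.1, hu.2.mono h⟩

/-- A graph is an `s`-plex cluster graph if every vertex lies in an `s`-plex without outside
neighbors. -/
theorem good_of_closed
    (h : ∀ v ∈ U, ∃ A ⊆ U, v ∈ A ∧ (∀ a ∈ A, ∀ b ∈ U, H.Adj a b → b ∈ A) ∧ Good s H A) :
    Good s H U := by
  intro v hv
  obtain ⟨A, hAU, hvA, hA, hg⟩ := h v hv
  refine (Finset.card_le_card ?_).trans_lt (hg v hvA)
  intro u hu
  rw [Finset.mem_filter, mem_missed] at *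
  have := hu.2.restrict hA hvA
  exact ⟨⟨this.1, hu.1.2⟩, this.2⟩

/-- Together with disjointness, `hAB` says that no edge joins the two sets. In this form it is
enough to show that a neighbor of one side belongs to that side. -/
theorem Good.union {A B : Finset V} (hA : Good s H A) (hB : Good s H B)
    (hAB : ∀ a ∈ A, ∀ b ∈ B, H.Adj a b → a ∈ B ∨ b ∈ A) (hd : Disjoint A B) :
    Good s H (A ∪ B) := by
  have hn : ∀ a ∈ A, ∀ b ∈ B, ¬ H.Adj a b := fun a ha b hb h => by
    rcases hAB a ha b hb h with h | h
    · exact Finset.disjoint_left.1 hd ha h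
    · exact Finset.disjoint_left.1 hd h hb
  apply good_of_closed
  intro v hv
  rcases Finset.mem_union.1 hv with h | h
  · refine ⟨A, Finset.subset_union_left, h, fun a ha b hb hab => ?_, hA⟩
    rcases Finset.mem_union.1 hb with h | h
    · exact h
    · exact absurd hab (hn a ha b h)
  · refine ⟨B, Finset.subset_union_right, h, fun a ha b hb hab => ?_, hB⟩
    rcases Finset.mem_union.1 hb with h | h
    · exact absurd hab.symm (hn b h a ha)
    · exact h

theorem Bad.not_good {F : Finset V} (hF : Bad s H F) (h : F ⊆ U) : ¬ Good s H U := by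
  obtain ⟨v, hv, hc, hr⟩ := hF
  intro hg
  have := hg.mono h v hv
  rw [Finset.filter_true_of_mem fun u hu => hr u (mem_missed.1 hu).1] at this
  omega

/-- Two vertices of an `s`-plex with more than `2s` vertices are adjacent or have a common
neighbor. -/
theorem Plex.reach (h : Plex s H K) (hc : 2 * s < K.card) {a b : V} (ha : a ∈ K) (hb : b ∈ K) :
    Reach H K a b := by
  by_cases hab : ∃ c ∈ K, H.Adj a c ∧ H.Adj c b
  · obtain ⟨c, hcK, h1, h2⟩ := hab
    exact (Reach.single h1 ha hcK).trans (Reach.single h2 hcK hb)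
  · exfalso
    -- Without a common neighbor, every vertex is equal to or missed by one of `a`, `b`; but two
    -- sets of at most `s` vertices do not cover `K`.
    have hsub : K ⊆ insert a (missed H K a) ∪ insert b (missed H K b) := by
      intro c hcK
      by_contra hcon
      simp only [Finset.mem_union, Finset.mem_insert, mem_missed, not_or, not_and, not_not] at hcon
      exact hab ⟨c, hcK, hcon.1.2 hcK hcon.1.1, (hcon.2.2 hcK hcon.2.1).symm⟩
    have h1 := (Finset.card_le_card hsub).trans (Finset.card_union_le _ _)
    have h2 := Finset.card_insert_le a (missed H K a)
    have h3 := Finset.card_insert_le b (missed H K b)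
    have h4 := h a ha
    have h5 := h b hb
    omega

theorem Yes.mono {A B : Finset V} (h : A ⊆ B) (hB : Yes s H B k) : Yes s H A k := by
  obtain ⟨S, -, hc, hg⟩ := hB
  refine ⟨S ∩ A, Finset.inter_subset_right, (Finset.card_le_card Finset.inter_subset_left).trans hc,
    hg.mono ?_⟩
  intro u hu
  simp only [Finset.mem_sdiff, Finset.mem_inter, not_and] at *
  exact ⟨h hu.1, fun hs => hu.2 hs hu.1⟩

/-- A set of vertices is a disjoint union of `m` sets with property `B`. -/
inductive Packing (B : Finset V → Prop) : ℕ → Finset V → Prop where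
  | zero : Packing B 0 ∅
  | succ {m : ℕ} {X F : Finset V} (hX : Packing B m X) (hF : B F) (hd : Disjoint F X) :
      Packing B (m + 1) (F ∪ X)

theorem Packing.card_le {B : Finset V → Prop} {c m : ℕ} {X : Finset V} (h : Packing B m X)
    (hB : ∀ F, B F → F.card ≤ c) : X.card ≤ m * c := by
  induction h with
  | zero => simp
  | succ hX hF hd ih =>
    have := Finset.card_union_le _ _ |>.trans (Nat.add_le_add (hB _ hF) ih)
    rw [Nat.succ_mul]; omega

theorem Packing.le_card {B : Finset V → Prop} {m : ℕ} {X S : Finset V} (h : Packing B m X)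
    (hB : ∀ F ⊆ X, B F → (S ∩ F).Nonempty) : m ≤ (S ∩ X).card := by
  induction h with
  | zero => simp
  | @succ m X F hX hF hd ih =>
    have h1 := ih fun F' hF' => hB F' (hF'.trans Finset.subset_union_right)
    have h2 := (hB F Finset.subset_union_left hF).card_pos
    rw [Finset.inter_union_distrib_left, Finset.card_union_of_disjoint]
    · omega
    · exact hd.mono Finset.inter_subset_right Finset.inter_subset_right

theorem Packing.not_yes {B : Finset V → Prop} {m : ℕ} {X : Finset V} (h : Packing B m X)
    (hB : ∀ F, B F → Bad s H F) (hX : X ⊆ U) (hk : k < m) : ¬ Yes s H U k := by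
  rintro ⟨S, -, hc, hg⟩
  have := h.le_card (S := S) fun F hF hBF => by
    by_contra hne
    rw [Finset.not_nonempty_iff_eq_empty, ← Finset.disjoint_iff_inter_eq_empty] at hne
    refine (hB F hBF).not_good ?_ hg
    exact Finset.subset_sdiff.2 ⟨hF.trans hX, hne.symm⟩
  have := Finset.card_le_card (Finset.inter_subset_left (s₁ := S) (s₂ := X))
  omega

/-- The core of a sunflower of more than `k` bad sets lies in every solution. -/
theorem Packing.core_mem {B : Finset V → Prop} {m : ℕ} {X S : Finset V} {x : V}
    (h : Packing B m X) (hB : ∀ F, B F → Bad s H (insert x F)) (hX : X ⊆ U) (hx : x ∈ U)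
    (hk : k < m) (hc : S.card ≤ k) (hg : Good s H (U \ S)) : x ∈ S := by
  by_contra hxS
  have := h.le_card (S := S) fun F hF hBF => by
    by_contra hne
    rw [Finset.not_nonempty_iff_eq_empty, ← Finset.disjoint_iff_inter_eq_empty] at hne
    refine (hB F hBF).not_good ?_ hg
    refine Finset.subset_sdiff.2 ⟨Finset.insert_subset hx (hF.trans hX), ?_⟩
    exact Finset.disjoint_insert_left.2 ⟨hxS, hne.symm⟩
  have := Finset.card_le_card (Finset.inter_subset_left (s₁ := S) (s₂ := X))
  omega

/-- A vertex `w` of a large plex `C` with few outside neighbors is redundant if `w` and the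
vertices of `C` not adjacent to `w` miss few vertices altogether. -/
theorem Yes.of_erase {C N : Finset V} {w : V} (hs : 1 ≤ s) (hCU : C ⊆ U) (hNU : N ⊆ U)
    (hclosed : ∀ a ∈ C, ∀ b ∈ U, H.Adj a b → b ∈ C ∪ N) (hC : Plex s H C) (hw : w ∈ C)
    (hwN : ∀ y ∈ N, H.Adj w y)
    (hmiss : ∀ u ∈ C, ¬ H.Adj u w → (missed H (C ∪ N) u).card < s)
    (hN : ∀ y ∈ N, (missed H C y).card < 3 * s) (hcard : 4 * s * N.card ≤ C.card)
    (hdisj : Disjoint C N) (h : Yes s H (U.erase w) k) : Yes s H U k := by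
  obtain ⟨S, hSU, hSk, hg⟩ := h
  have hwS : w ∉ S := fun h => (Finset.mem_erase.1 (hSU h)).1 rfl
  -- Either `S` leaves most of `C`, which then stays connected and can absorb `w`, or replacing `S ∩
  -- C` by `N` costs nothing and cuts the plex `C` off from the rest.
  rcases Nat.lt_or_ge (S ∩ C).card N.card with hlt | hge
  · -- the rest of `C` is connected
    refine ⟨S, hSU.trans (Finset.erase_subset _ _), hSk, ?_⟩
    set Z := U.erase w \ S with hZ
    set C₀ := (C \ S).erase w with hC₀
    have hC₀C : C₀ ⊆ C := (Finset.erase_subset _ _).trans Finset.sdiff_subset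
    -- At most `|N| - 1` of at least `4s|N|` vertices are deleted, and `w` is left out, so at least
    -- `4s - 1` remain. The bound `2s` makes `C₀` connected; the bound `3s` gives every vertex that
    -- misses fewer than `3s` of them a neighbor there.
    have hcard₀ : 3 * s ≤ C₀.card ∧ 2 * s < C₀.card := by
      have h1 : C₀.card = (C \ S).card - 1 :=
        Finset.card_erase_of_mem (Finset.mem_sdiff.2 ⟨hw, hwS⟩)
      have h2 := Finset.card_sdiff_add_card_inter C S
      rw [Finset.inter_comm] at h2
      have h3 : 4 * s * N.card = 4 * s * (N.card - 1) + 4 * s := by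
        obtain ⟨m, hm⟩ : ∃ m, N.card = m + 1 := ⟨N.card - 1, by omega⟩
        rw [hm]; simp [Nat.mul_succ]
      have h4 : N.card - 1 ≤ 4 * s * (N.card - 1) := Nat.le_mul_of_pos_left _ (by omega)
      omega
    have hC₀Z : C₀ ⊆ Z := by
      intro c hc
      simp only [hC₀, hZ, Finset.mem_erase, Finset.mem_sdiff] at hc ⊢
      exact ⟨⟨hc.1, hCU hc.2.1⟩, hc.2.2⟩
    have hCZ : ∀ c ∈ C, c ∈ Z → c ∈ C₀ := by
      intro c hc hcZ
      simp only [hC₀, hZ, Finset.mem_erase, Finset.mem_sdiff] at hcZ ⊢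
      exact ⟨hcZ.1.1, hc, hcZ.2⟩
    have hconn := fun a ha b hb => (hC.mono hC₀C).reach (a := a) (b := b) hcard₀.2 ha hb
    obtain ⟨c₀, hc₀⟩ : C₀.Nonempty := Finset.card_pos.1 (by omega)
    classical
    -- `D` is the component that contains `C₀`. It turns out to be exactly what survives of `C ∪ N`
    -- apart from `w`, so putting `w` back affects no other component.
    set D := Z.filter (Reach H Z c₀) with hD
    have hDr : ∀ u ∈ D, missed H D u ⊆ (missed H Z u).filter (Reach H Z u) := by
      intro u hu v hv
      simp only [hD, Finset.mem_filter, mem_missed] at hu hv ⊢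
      exact ⟨⟨hv.1.1, hv.2⟩, hu.2.symm.trans hv.1.2⟩
    have hDplex : Plex s H D := fun u hu =>
      (Finset.card_le_card (hDr u hu)).trans_lt (hg u (Finset.mem_filter.1 hu).1)
    have hC₀D : C₀ ⊆ D := fun c hc =>
      Finset.mem_filter.2 ⟨hC₀Z hc, (hconn c₀ hc₀ c hc).mono hC₀Z⟩
    -- a vertex that misses few vertices of `C₀` is in `C₀` or adjacent to a vertex of it
    have hadj : ∀ u, (missed H C₀ u).card < 3 * s → u ∉ C₀ → ∃ c ∈ C₀, H.Adj u c := by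
      intro u hu huC
      by_contra hcon
      push Not at hcon
      have : C₀ ⊆ missed H C₀ u := fun c hc =>
        mem_missed.2 ⟨hc, fun h => huC (h ▸ hc), hcon c hc⟩
      have := Finset.card_le_card this
      omega
    have hZU : Z ⊆ U := Finset.sdiff_subset.trans (Finset.erase_subset _ _)
    have hDsub : D ⊆ C ∪ N := by
      intro u hu
      by_cases huC : u ∈ C₀
      · exact Finset.mem_union_left _ (hC₀C huC)
      · have h1 := Finset.card_le_card (missed_mono (H := H) hC₀D u)
        have h2 := hDplex u hu
        obtain ⟨c, hc, hcu⟩ := hadj u (by omega) huC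
        exact hclosed c (hC₀C hc) u (hZU (Finset.mem_filter.1 hu).1) hcu.symm
    have hND : ∀ u ∈ Z, u ∈ C ∪ N → u ∈ D := by
      intro u huZ hu
      rcases Finset.mem_union.1 hu with h | h
      · exact hC₀D (hCZ u h huZ)
      · have h1 := Finset.card_le_card (missed_mono (H := H) hC₀C u)
        have h2 := hN u h
        obtain ⟨c, hc, hcu⟩ := hadj u (by omega) fun hc =>
          Finset.disjoint_left.1 hdisj (hC₀C hc) h
        exact Finset.mem_filter.2 ⟨huZ, ((hconn c₀ hc₀ c hc).mono hC₀Z).trans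
          (Reach.single hcu.symm (hC₀Z hc) huZ)⟩
    have hwZ : w ∉ Z := by simp [hZ]
    have hsplit : U \ S = insert w D ∪ (Z \ D) := by
      have : insert w D ∪ (Z \ D) = insert w Z := by
        rw [Finset.insert_union, Finset.union_sdiff_of_subset (Finset.filter_subset _ _)]
      rw [this, hZ]
      ext u
      simp only [Finset.mem_sdiff, Finset.mem_insert, Finset.mem_erase]
      by_cases huw : u = w
      · subst huw; simp [hwS, hCU hw]
      · simp [huw]
    have hAsub : insert w D ⊆ C ∪ N :=
      Finset.insert_subset (Finset.mem_union_left _ hw) hDsub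
    rw [hsplit]
    refine Good.union (Plex.good ?_) (hg.mono Finset.sdiff_subset) ?_ ?_
    · intro u hu
      -- A neighbor of `w` misses the same vertices as before. A vertex not adjacent to `w` lies in
      -- `C`, because `w` sees all of `N`, and there `hmiss` applies.
      by_cases huw : H.Adj u w
      · have huD : u ∈ D := (Finset.mem_insert.1 hu).resolve_left fun h => by
          subst h; exact huw.ne rfl
        refine (Finset.card_le_card ?_).trans_lt (hDplex u huD)
        intro v hv
        rw [mem_missed, Finset.mem_insert] at *
        refine ⟨hv.1.resolve_left fun h => hv.2.2 (h ▸ huw), hv.2⟩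
      · have huC : u ∈ C := by
          rcases Finset.mem_union.1 (hAsub hu) with h | h
          · exact h
          · exact absurd (hwN u h).symm huw
        exact (Finset.card_le_card (missed_mono hAsub u)).trans_lt (hmiss u huC huw)
    · intro a ha b hb hab
      refine Or.inr (Finset.mem_insert_of_mem ?_)
      have hbZ := (Finset.mem_sdiff.1 hb).1
      rcases Finset.mem_insert.1 ha with rfl | haD
      · exact hND b hbZ (hclosed a hw b (hZU hbZ) hab)
      · have := Finset.mem_filter.1 haD
        exact Finset.mem_filter.2 ⟨hbZ, this.2.trans (Reach.single hab this.1 hbZ)⟩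
    · rw [Finset.disjoint_insert_left]
      exact ⟨fun h => hwZ (Finset.mem_sdiff.1 h).1, Finset.disjoint_sdiff⟩
  · refine ⟨(S \ C) ∪ N, Finset.union_subset
      (Finset.sdiff_subset.trans (hSU.trans (Finset.erase_subset _ _))) hNU, ?_, ?_⟩
    · have h1 := Finset.card_union_le (S \ C) N
      have h2 := Finset.card_sdiff_add_card_inter S C
      omega
    · have hsplit : U \ ((S \ C) ∪ N) = C ∪ (((U \ S) \ C) \ N) := by
        ext u
        have h1 := @hCU u
        have h2 : u ∈ C → u ∉ N := fun h => Finset.disjoint_left.1 hdisj h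
        simp only [Finset.mem_sdiff, Finset.mem_union]
        tauto
      rw [hsplit]
      refine Good.union hC.good (hg.mono ?_) ?_ ?_
      · intro u hu
        simp only [Finset.mem_sdiff, Finset.mem_erase] at hu ⊢
        exact ⟨⟨fun h => hu.1.2 (h ▸ hw), hu.1.1.1⟩, hu.1.1.2⟩
      · intro a ha b hb hab
        simp only [Finset.mem_sdiff] at hb
        have := hclosed a ha b hb.1.1.1 hab
        rw [Finset.mem_union] at this
        tauto
      · rw [Finset.disjoint_left]
        intro u hu hu'
        simp only [Finset.mem_sdiff] at hu'
        exact hu'.1.2 hu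

/-- Vertices that lie in every solution may be taken out of the instance. -/
theorem yes_sdiff_iff {A : Finset V} (hA : A ⊆ U)
    (h : ∀ S : Finset V, S.card ≤ k → Good s H (U \ S) → A ⊆ S) :
    Yes s H U k ↔ A.card ≤ k ∧ Yes s H (U \ A) (k - A.card) := by
  constructor
  · rintro ⟨S, hSU, hc, hg⟩
    have hAS := h S hc hg
    have := Finset.card_sdiff_add_card_eq_card hAS
    refine ⟨(Finset.card_le_card hAS).trans hc, S \ A, Finset.sdiff_subset_sdiff hSU le_rfl,
      by omega, hg.mono ?_⟩
    intro u hu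
    simp only [Finset.mem_sdiff] at *
    tauto
  · rintro ⟨hc, S, hSU, hSc, hg⟩
    refine ⟨S ∪ A, Finset.union_subset (hSU.trans Finset.sdiff_subset) hA, ?_, hg.mono ?_⟩
    · have := Finset.card_union_le S A
      omega
    · intro u hu
      simp only [Finset.mem_sdiff, Finset.mem_union] at *
      tauto

/-- An edge `xy` and `2s` further vertices that are adjacent to exactly one of `x`, `y` form a
bad set. -/
theorem bad_of_edge {x y : V} {W : Finset V} (hxy : H.Adj x y) (hW : 2 * s ≤ W.card)
    (h : ∀ u ∈ W, u ≠ x ∧ u ≠ y ∧ (H.Adj x u ↔ ¬ H.Adj y u)) :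
    Bad s H (insert x (insert y W)) := by
  classical
  set F := insert x (insert y W) with hF
  have hx : x ∈ F := by simp [hF]
  have hy : y ∈ F := by simp [hF]
  have hWF : ∀ u ∈ W, u ∈ F := fun u hu => by simp [hF, hu]
  have hxr : ∀ u ∈ F, Reach H F x u := by
    intro u hu
    rcases Finset.mem_insert.1 hu with rfl | hu'
    · exact Reach.refl _
    rcases Finset.mem_insert.1 hu' with rfl | hu'
    · exact Reach.single hxy hx hy
    · by_cases hxu : H.Adj x u
      · exact Reach.single hxu hx hu
      · have : H.Adj y u := by_contra fun hyu => hxu ((h u hu').2.2.2 hyu)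
        exact (Reach.single hxy hx hy).trans (Reach.single this hy hu)
  have hcard := Finset.card_filter_add_card_filter_not (s := W) (fun u => H.Adj x u)
  -- Each vertex of `W` is missed by exactly one of `x`, `y`, so one of the two misses at least `s`
  -- of them.
  rcases Nat.lt_or_ge (W.filter fun u => H.Adj x u).card s with hlt | hge
  · refine ⟨x, hx, le_trans (b := (W.filter fun u => ¬ H.Adj x u).card) (by omega)
      (Finset.card_le_card ?_), hxr⟩
    intro u hu
    rw [Finset.mem_filter] at hu
    exact mem_missed.2 ⟨hWF u hu.1, (h u hu.1).1, hu.2⟩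
  · refine ⟨y, hy, hge.trans (Finset.card_le_card ?_), fun u hu => (hxr y hy).symm.trans (hxr u hu)⟩
    intro u hu
    rw [Finset.mem_filter] at hu
    exact mem_missed.2 ⟨hWF u hu.1, (h u hu.1).2.1, (h u hu.1).2.2.1 hu.2⟩

/-- A bad extension of a connected plex `L` by a vertex contains a small bad set. -/
theorem bad_of_insert {L F : Finset V} {x u : V} (hL : Plex s H L)
    (hconn : ∀ a ∈ L, ∀ b ∈ L, Reach H L a b) (hFL : F ⊆ insert x L)
    (hxF : x ∈ F) (huF : u ∈ F) (hp : ∃ p ∈ F, H.Adj x p) (hu : s ≤ (missed H F u).card)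
    (hF : F = insert x L ∨ 2 * s + 2 ≤ F.card) : Bad s H F := by
  obtain ⟨p, hpF, hxp⟩ := hp
  have herase : F.erase x ⊆ L := fun v hv =>
    (Finset.mem_insert.1 (hFL (Finset.mem_of_mem_erase hv))).resolve_left
      (Finset.ne_of_mem_erase hv)
  have hpx : p ∈ F.erase x := Finset.mem_erase.2 ⟨hxp.ne', hpF⟩
  have hr : ∀ v ∈ F.erase x, Reach H F p v := by
    intro v hv
    -- Either all of the connected set `L` is available inside `F`, or `F` without `x` has more than
    -- `2s` vertices of a plex and is connected by itself.
    rcases hF with hF | hF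
    · exact (hconn p (herase hpx) v (herase hv)).mono (by rw [hF]; exact Finset.subset_insert _ _)
    · refine ((hL.mono herase).reach ?_ hpx hv).mono (Finset.erase_subset _ _)
      rw [Finset.card_erase_of_mem hxF]
      omega
  have hr' : ∀ v ∈ F, Reach H F p v := by
    intro v hv
    by_cases hvx : v = x
    · subst hvx; exact Reach.single hxp.symm hpF hxF
    · exact hr v (Finset.mem_erase.2 ⟨hvx, hv⟩)
  exact ⟨u, huF, hu, fun v hv => (hr' u huF).symm.trans (hr' v hv)⟩

end Graph

/-! ### Translation between induced subgraphs and vertex sets of one ambient graph. -/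

section Instance

variable {V W : Type*} [DecidableEq V] {s k : ℕ} {H : SimpleGraph V}

theorem reachable_induce_comap_iff (f : W ↪ V) (P : Set W) (U : Finset V)
    (hU : ∀ v, v ∈ U ↔ ∃ w ∈ P, f w = v) (a b : P) :
    ((H.comap f).induce P).Reachable a b ↔ Reach H U (f a) (f b) := by
  constructor
  · rintro ⟨p⟩
    induction p with
    | nil => exact Reach.refl _
    | @cons a b c h p ih =>
      refine Reach.trans (Reach.single ?_ ?_ ?_) ih
      · simpa using h
      · exact (hU _).2 ⟨a, a.2, rfl⟩
      · exact (hU _).2 ⟨b, b.2, rfl⟩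
  · intro r
    generalize hv : f b = v at r
    induction r generalizing b with
    | refl =>
      have : a = b := Subtype.ext (f.injective hv.symm)
      rw [this]
    | @tail v w _ h ih =>
      obtain ⟨c, hc, rfl⟩ := (hU _).1 h.2.1
      refine (ih ⟨c, hc⟩ rfl).trans (SimpleGraph.Adj.reachable ?_)
      subst hv
      simpa using h.1

/-- A component consists of a vertex `a`, its neighbors and the reachable vertices that `a` misses.
So the size of the component is the degree plus one plus the number of missed vertices, and the
`s`-plex condition says that this last number is less than `s`. -/
theorem isSPlexClusterGraph_induce_comap_iff [Finite W] (f : W ↪ V) (P : Set W)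
    (U : Finset V) (hU : ∀ v, v ∈ U ↔ ∃ w ∈ P, f w = v) :
    IsSPlexClusterGraph s ((H.comap f).induce P) ↔ Good s H U := by
  classical
  set Γ := (H.comap f).induce P with hΓ
  have key : ∀ a : P, ∀ ha : a ∈ (Γ.connectedComponentMk a).supp,
      Nat.card (Γ.connectedComponentMk a).supp =
      ((Γ.induce (Γ.connectedComponentMk a).supp).neighborSet ⟨a, ha⟩).ncard + 1 +
        ((missed H U (f a)).filter (Reach H U (f a))).card := by
    intro a ha
    have hreach : ∀ b : P, b ∈ (Γ.connectedComponentMk a).supp ↔ Reach H U (f a) (f b) := by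
      intro b
      rw [SimpleGraph.ConnectedComponent.mem_supp_iff, SimpleGraph.ConnectedComponent.eq,
        ← reachable_induce_comap_iff f P U hU]
      exact ⟨fun h => h.symm, fun h => h.symm⟩
    let g : (Γ.connectedComponentMk a).supp → V := fun b => f b.1
    have hg : Function.Injective g := fun b c h => Subtype.ext (Subtype.ext (f.injective h))
    rw [Nat.card_coe_set_eq]
    have h1 : (Γ.connectedComponentMk a).supp.ncard = (Set.range g).ncard := by
      rw [← Set.image_univ, Set.ncard_image_of_injective _ hg, Set.ncard_univ,
        Nat.card_coe_set_eq]
    have h2 : ((Γ.induce (Γ.connectedComponentMk a).supp).neighborSet ⟨a, ha⟩).ncard =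
        (g '' ((Γ.induce (Γ.connectedComponentMk a).supp).neighborSet ⟨a, ha⟩)).ncard :=
      (Set.ncard_image_of_injective _ hg).symm
    have h3 : Set.range g = insert (f a)
        (g '' ((Γ.induce (Γ.connectedComponentMk a).supp).neighborSet ⟨a, ha⟩)) ∪
        ((missed H U (f a)).filter (Reach H U (f a)) : Finset V) := by
      ext v
      simp only [Set.mem_range, Set.mem_union, Set.mem_insert_iff, Set.mem_image,
        SimpleGraph.mem_neighborSet, Finset.coe_filter, Set.mem_ofPred_eq, mem_missed]
      constructor
      · rintro ⟨b, rfl⟩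
        by_cases hba : g b = f a
        · exact Or.inl (Or.inl hba)
        by_cases hab : H.Adj (f a) (g b)
        · refine Or.inl (Or.inr ⟨b, ?_, rfl⟩)
          simpa [hΓ] using hab
        · exact Or.inr ⟨⟨(hU _).2 ⟨b.1, b.1.2, rfl⟩, hba, hab⟩, (hreach b.1).1 b.2⟩
      · rintro ((rfl | ⟨b, -, rfl⟩) | ⟨⟨hv, -⟩, hr⟩)
        · exact ⟨⟨a, ha⟩, rfl⟩
        · exact ⟨b, rfl⟩
        · obtain ⟨w, hw, rfl⟩ := (hU _).1 hv
          exact ⟨⟨⟨w, hw⟩, (hreach ⟨w, hw⟩).2 hr⟩, rfl⟩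
    have hfin : (g '' ((Γ.induce (Γ.connectedComponentMk a).supp).neighborSet ⟨a, ha⟩)).Finite :=
      Set.toFinite _
    rw [h1, h2, h3, Set.ncard_union_eq _ (hfin.insert _) (Set.toFinite _), Set.ncard_coe_finset,
      Set.ncard_insert_of_notMem _ hfin]
    · rintro ⟨b, hb, hba⟩
      rw [SimpleGraph.mem_neighborSet] at hb
      have : (⟨a, ha⟩ : (Γ.connectedComponentMk a).supp) = b := hg hba.symm
      exact hb.ne this
    · rw [Set.disjoint_left]
      rintro v (rfl | ⟨b, hb, rfl⟩) hv
      · simp [mem_missed] at hv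
      · simp only [Finset.coe_filter, Set.mem_ofPred_eq, mem_missed] at hv
        refine hv.1.2.2 ?_
        simpa [hΓ] using hb
  constructor
  · intro h v hv
    obtain ⟨w, hw, rfl⟩ := (hU _).1 hv
    have ha : (⟨w, hw⟩ : P) ∈ (Γ.connectedComponentMk ⟨w, hw⟩).supp := rfl
    have h1 := key ⟨w, hw⟩ ha
    have h2 := h (Γ.connectedComponentMk ⟨w, hw⟩) ⟨⟨w, hw⟩, ha⟩
    change (Finset.filter (Reach H U (f w)) (missed H U (f w))).card < s
    change _ = _ + 1 + (Finset.filter (Reach H U (f w)) (missed H U (f w))).card at h1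
    omega
  · rintro h c ⟨a, ha⟩
    obtain rfl : Γ.connectedComponentMk a = c := ha
    have h1 := key a rfl
    have h2 := h (f a) ((hU _).2 ⟨a, a.2, rfl⟩)
    omega

/-- This serves the input, embedded into `ℕ` by its vertex numbers, as well as the output, embedded
by the list of kept vertices; in between, everything happens in one graph on `ℕ`. -/
theorem isYesInstance_comap_iff [Fintype W] (f : W ↪ V) :
    IsYesInstance s (H.comap f) k ↔ Yes s H (Finset.univ.map f) k := by
  constructor
  · rintro ⟨S, hS, h⟩
    refine ⟨S.map f, Finset.map_subset_map.2 (Finset.subset_univ _), by simpa using hS, ?_⟩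
    refine (isSPlexClusterGraph_induce_comap_iff f _ _ ?_).1 h
    intro v
    simp only [Finset.mem_sdiff, Finset.mem_map, Finset.mem_univ, true_and, Set.mem_compl_iff,
      Finset.mem_coe]
    constructor
    · rintro ⟨⟨w, rfl⟩, h⟩
      exact ⟨w, fun hw => h ⟨w, hw, rfl⟩, rfl⟩
    · rintro ⟨w, hw, rfl⟩
      refine ⟨⟨w, rfl⟩, ?_⟩
      rintro ⟨w', hw', h⟩
      exact hw (f.injective h ▸ hw')
  · rintro ⟨S, hSU, hS, h⟩
    refine ⟨S.preimage f f.injective.injOn, ?_, ?_⟩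
    · rw [Finset.card_preimage]
      exact (Finset.card_filter_le _ _).trans hS
    · refine (isSPlexClusterGraph_induce_comap_iff f _ _ ?_).2 h
      intro v
      simp only [Finset.mem_sdiff, Finset.mem_map, Finset.mem_univ, true_and, Set.mem_compl_iff,
        Finset.mem_coe, Finset.mem_preimage]
      constructor
      · rintro ⟨⟨w, rfl⟩, h⟩
        exact ⟨w, h, rfl⟩
      · rintro ⟨w, hw, rfl⟩
        exact ⟨⟨w, rfl⟩, hw⟩

end Instance

/-! ### Correctness and size of the kernel. -/

section Tidy

variable {V : Type*} [DecidableEq V]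

/-- `X` is a set of vertices of `U` such that `H[U \ X]` consists of `s`-plexes (the fibers of
`lab`), the vertices in `Fo` are forced into every solution by bad sets within `T`, and every vertex
in `X \ Fo` has nearly the same neighbors in `U \ X \ T` as each of its neighbors there. -/
structure Tidy (s k : ℕ) (H : SimpleGraph V) (U X T Fo : Finset V) (lab : V → ℕ) : Prop where
  one_le : 1 ≤ s
  subset_X : X ⊆ U
  subset_T : T ⊆ U \ X
  subset_Fo : Fo ⊆ X
  closed : ∀ u ∈ U \ X, ∀ v ∈ U \ X, H.Adj u v → lab u = lab v
  plex : ∀ c, Plex s H ((U \ X).filter (lab · = c))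
  forced : ∀ x ∈ Fo, ∃ P ⊆ T, ∃ m > k, Packing (fun F => Bad s H (insert x F)) m P
  free : ∀ x ∈ X \ Fo, ∀ y ∈ (U \ X) \ T, H.Adj x y → ∀ W ⊆ (U \ X) \ T,
    (∀ u ∈ W, u ≠ y ∧ (H.Adj x u ↔ ¬ H.Adj y u)) → W.card < 2 * s

/-- The vertex `x` has a neighbor in `A` with label `c`. -/
def Touches (H : SimpleGraph V) (A : Finset V) (lab : V → ℕ) (x : V) (c : ℕ) : Prop :=
  ∃ y ∈ A, lab y = c ∧ H.Adj x y

/-- The vertex `u` is missed by a vertex of `Y` that touches its cluster. -/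
def Spoiled (H : SimpleGraph V) (Y A : Finset V) (lab : V → ℕ) (u : V) : Prop :=
  u ∈ A ∧ ∃ x ∈ Y, ¬ H.Adj x u ∧ Touches H A lab x (lab u)

open scoped Classical in
/-- The vertices of `A` that miss a vertex of `T` or a spoiled vertex in their cluster. -/
noncomputable def marked (H : SimpleGraph V) (Y A T : Finset V) (lab : V → ℕ) : Finset V :=
  A.filter fun w => ∃ b, (b ∈ T ∨ Spoiled H Y (A \ T) lab b) ∧ lab b = lab w ∧ ¬ H.Adj b w

open scoped Classical in
/-- The number of unmarked vertices of cluster `c` to be kept. -/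
noncomputable def quota (s : ℕ) (H : SimpleGraph V) (Y A T : Finset V) (lab : V → ℕ) (c : ℕ) : ℕ :=
  4 * s * ((T.filter (lab · = c)).card + (Y.filter (Touches H (A \ T) lab · c)).card)

/-- The set `K` consists of `X`, the marked vertices, and as many further vertices of each cluster
as its quota allows. -/
structure IsKernel (s : ℕ) (H : SimpleGraph V) (U X T Fo : Finset V) (lab : V → ℕ)
    (K : Finset V) : Prop where
  subset : K ⊆ U
  subset_X : X ⊆ K
  subset_marked : marked H (X \ Fo) (U \ X) T lab ⊆ K
  card_le : ∀ c, ((K \ (X ∪ marked H (X \ Fo) (U \ X) T lab)).filter (lab · = c)).card ≤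
    quota s H (X \ Fo) (U \ X) T lab c
  le_card : ∀ u ∈ U \ K, quota s H (X \ Fo) (U \ X) T lab (lab u) ≤
    ((K \ (X ∪ marked H (X \ Fo) (U \ X) T lab)).filter (lab · = lab u)).card

variable {s k : ℕ} {H : SimpleGraph V} {U X T Fo K : Finset V} {lab : V → ℕ}

theorem mem_marked {Y A : Finset V} {w : V} : w ∈ marked H Y A T lab ↔
    w ∈ A ∧ ∃ b, (b ∈ T ∨ Spoiled H Y (A \ T) lab b) ∧ lab b = lab w ∧ ¬ H.Adj b w := by
  simp [marked]

theorem subset_marked_of_subset {Y A : Finset V} (h : T ⊆ A) : T ⊆ marked H Y A T lab :=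
  fun t ht => mem_marked.2 ⟨h ht, t, Or.inl ht, rfl, H.irrefl⟩

/-- A vertex that touches a cluster misses few of its vertices. -/
theorem Tidy.card_missed_lt (h : Tidy s k H U X T Fo lab) {x : V} (hx : x ∈ X \ Fo) {c : ℕ}
    (hc : Touches H ((U \ X) \ T) lab x c) {A : Finset V}
    (hA : A ⊆ ((U \ X) \ T).filter (lab · = c)) (hAx : ∀ u ∈ A, ¬ H.Adj x u) :
    A.card < 3 * s := by
  obtain ⟨y, hy, rfl, hxy⟩ := hc
  classical
  -- Of the vertices missed by `x`, those adjacent to `y` distinguish `x` from `y`, so there are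
  -- fewer than `2s`; those missed by `y` too number fewer than `s`, since `y` lies in the same
  -- plex.
  have h1 := h.free x hx y hy hxy (A.filter (H.Adj y))
    ((Finset.filter_subset _ _).trans (hA.trans (Finset.filter_subset _ _))) (by
      intro u hu
      rw [Finset.mem_filter] at hu
      exact ⟨hu.2.ne', fun hn => absurd hn (hAx u hu.1), fun hn => absurd hu.2 hn⟩)
  have hy' : y ∈ (U \ X).filter (lab · = lab y) :=
    Finset.mem_filter.2 ⟨(Finset.mem_sdiff.1 hy).1, rfl⟩
  have h2 := h.plex (lab y) y hy'
  have h3 : (A.filter fun u => ¬ H.Adj y u) ⊆ missed H ((U \ X).filter (lab · = lab y)) y := by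
    intro u hu
    rw [Finset.mem_filter] at hu
    have := hA hu.1
    simp only [Finset.mem_filter, Finset.mem_sdiff] at this
    rw [mem_missed, Finset.mem_filter, Finset.mem_sdiff]
    refine ⟨⟨this.1.1, this.2⟩, ?_, hu.2⟩
    rintro rfl
    exact hAx u hu.1 hxy
  have h4 := Finset.card_le_card h3
  have h5 := Finset.card_filter_add_card_filter_not (s := A) (H.Adj y)
  omega

/-- Vertices outside a kernel may be deleted. -/
theorem IsKernel.yes_of_sdiff (hK : IsKernel s H U X T Fo lab K) (h : Tidy s k H U X T Fo lab)
    (R : Finset V) (hR : R ⊆ U \ K) (hy : Yes s H (U \ R) k) : Yes s H U k := by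
  classical
  -- The vertices return one at a time, so that each return is a single exchange in a graph that
  -- still contains all of `K`.
  induction R using Finset.induction_on with
  | empty => simpa using hy
  | @insert w R hwR ih =>
    refine ih ((Finset.subset_insert _ _).trans hR) ?_
    obtain ⟨hwU, hwK⟩ := Finset.mem_sdiff.1 (hR (Finset.mem_insert_self w R))
    have hRU : R ⊆ U \ K := (Finset.subset_insert _ _).trans hR
    have hKR : ∀ v ∈ K, v ∈ U \ R := fun v hv =>
      Finset.mem_sdiff.2 ⟨hK.subset hv, fun hvR => (Finset.mem_sdiff.1 (hRU hvR)).2 hv⟩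
    have hKw : ∀ v ∈ K, v ∈ (U \ R).erase w := fun v hv =>
      Finset.mem_erase.2 ⟨fun hvw => hwK (hvw ▸ hv), hKR v hv⟩
    have hTM : T ⊆ marked H (X \ Fo) (U \ X) T lab := subset_marked_of_subset h.subset_T
    have hTK : T ⊆ K := hTM.trans hK.subset_marked
    -- All petals lie in `T ⊆ K`, so `Fo` belongs to every solution of every graph that contains
    -- `K`. It can be taken out on both sides, at the same price.
    have hforce : ∀ U' : Finset V, K ⊆ U' → ∀ S : Finset V, S.card ≤ k → Good s H (U' \ S) →
        Fo ⊆ S := by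
      intro U' hU' S hS hg x hx
      obtain ⟨P, hPT, m, hm, hP⟩ := h.forced x hx
      exact hP.core_mem (fun _ hF => hF) (hPT.trans (hTK.trans hU'))
        (hU' (hK.subset_X (h.subset_Fo hx))) hm hS hg
    have hwX : w ∉ X := fun hw => hwK (hK.subset_X hw)
    have hwM : w ∉ marked H (X \ Fo) (U \ X) T lab := fun hw => hwK (hK.subset_marked hw)
    have hwT : w ∉ T := fun hw => hwK (hTK hw)
    have hwA : w ∈ U \ X := Finset.mem_sdiff.2 ⟨hwU, hwX⟩
    have hFoK : Fo ⊆ K := h.subset_Fo.trans hK.subset_X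
    rw [show U \ insert w R = (U \ R).erase w from by
      ext v; simp only [Finset.mem_sdiff, Finset.mem_insert, Finset.mem_erase]; tauto,
      yes_sdiff_iff (fun v hv => hKw v (hFoK hv)) (hforce _ hKw)] at hy
    rw [yes_sdiff_iff (fun v hv => hKR v (hFoK hv)) (hforce _ hKR)]
    refine ⟨hy.1, ?_⟩
    have hy2 := hy.2
    rw [show (U \ R).erase w \ Fo = ((U \ R) \ Fo).erase w from by
      ext v; simp only [Finset.mem_sdiff, Finset.mem_erase]; tauto] at hy2
    -- `Q` is the whole cluster of `w`, and `C` is its part outside `T` that is still present. The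
    -- neighbors of `C` outside of it, apart from `Fo`, lie in `N`: vertices of `T` in the cluster,
    -- and unforced vertices of `X` that touch it.
    set Q := (U \ X).filter (lab · = lab w) with hQ
    set C := (((U \ X) \ T) \ R).filter (lab · = lab w) with hC
    set N := T.filter (lab · = lab w) ∪
      (X \ Fo).filter (Touches H ((U \ X) \ T) lab · (lab w)) with hN
    have hCQ : C ⊆ Q := by
      intro v hv
      simp only [hC, hQ, Finset.mem_filter, Finset.mem_sdiff] at hv ⊢
      tauto
    have hCT : ∀ v ∈ C, v ∈ (U \ X) \ T ∧ lab v = lab w := by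
      intro v hv
      simp only [hC, Finset.mem_filter, Finset.mem_sdiff] at hv ⊢
      tauto
    have hTQ : T.filter (lab · = lab w) ⊆ Q := Finset.filter_subset_filter _ h.subset_T
    have hQplex : Plex s H Q := h.plex _
    have hspoil : ∀ u ∈ C, ¬ H.Adj u w → ¬ Spoiled H (X \ Fo) ((U \ X) \ T) lab u :=
      fun u hu huw hsp => hwM (mem_marked.2 ⟨hwA, u, Or.inr hsp, (hCT u hu).2, huw⟩)
    have hwC : w ∈ C := Finset.mem_filter.2
      ⟨Finset.mem_sdiff.2 ⟨Finset.mem_sdiff.2 ⟨hwA, hwT⟩, hwR⟩, rfl⟩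
    refine Yes.of_erase (C := C) (N := N) h.one_le ?_ ?_ ?_ (hQplex.mono hCQ) hwC ?_ ?_ ?_ ?_ ?_ hy2
    · intro v hv
      have h1 := hCT v hv
      have h2 := Finset.mem_filter.1 hv
      simp only [Finset.mem_sdiff] at h1 h2 ⊢
      exact ⟨⟨h1.1.1.1, h2.1.2⟩, fun hf => h1.1.1.2 (h.subset_Fo hf)⟩
    · intro v hv
      have hvK : v ∈ K ∧ v ∉ Fo := by
        rcases Finset.mem_union.1 hv with hv | hv
        · have := (Finset.mem_filter.1 hv).1
          exact ⟨hTK this, fun hf => (Finset.mem_sdiff.1 (h.subset_T this)).2 (h.subset_Fo hf)⟩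
        · have := Finset.mem_sdiff.1 (Finset.mem_filter.1 hv).1
          exact ⟨hK.subset_X this.1, this.2⟩
      exact Finset.mem_sdiff.2 ⟨hKR v hvK.1, hvK.2⟩
    · intro a ha b hb hab
      obtain ⟨hb1, hb2⟩ := Finset.mem_sdiff.1 hb
      obtain ⟨hb1, hb3⟩ := Finset.mem_sdiff.1 hb1
      by_cases hbX : b ∈ X
      · refine Finset.mem_union_right _ (Finset.mem_union_right _ (Finset.mem_filter.2
          ⟨Finset.mem_sdiff.2 ⟨hbX, hb2⟩, a, (hCT a ha).1, (hCT a ha).2, hab.symm⟩))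
      · have hbA := Finset.mem_sdiff.2 ⟨hb1, hbX⟩
        have hlab : lab b = lab w := by
          rw [← (hCT a ha).2]
          exact (h.closed a (Finset.mem_sdiff.1 (hCT a ha).1).1 b hbA hab).symm
        by_cases hbT : b ∈ T
        · exact Finset.mem_union_right _ (Finset.mem_union_left _
            (Finset.mem_filter.2 ⟨hbT, hlab⟩))
        · exact Finset.mem_union_left _ (Finset.mem_filter.2
            ⟨Finset.mem_sdiff.2 ⟨Finset.mem_sdiff.2 ⟨hbA, hbT⟩, hb3⟩, hlab⟩)
    · intro y hy
      by_contra hwy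
      rcases Finset.mem_union.1 hy with hy | hy
      · have := Finset.mem_filter.1 hy
        exact hwM (mem_marked.2 ⟨hwA, y, Or.inl this.1, this.2, fun hn => hwy hn.symm⟩)
      · have := Finset.mem_filter.1 hy
        -- A vertex of `X` that touches the cluster and misses `w` makes `w` spoiled; and a spoiled
        -- vertex marks itself, since it is not adjacent to itself.
        exact hspoil w hwC H.irrefl ⟨(hCT w hwC).1, y, this.1, fun hn => hwy hn.symm, this.2⟩
    -- Were `u` spoiled, then `w` would be marked. So `u` sees all vertices of `X` in `N`, and
    -- whatever it misses lies in the plex `Q`.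
    · intro u hu huw
      refine (Finset.card_le_card ?_).trans_lt (hQplex u (hCQ hu))
      intro v hv
      rw [mem_missed] at hv ⊢
      refine ⟨?_, hv.2⟩
      rcases Finset.mem_union.1 hv.1 with hvC | hvN
      · exact hCQ hvC
      rcases Finset.mem_union.1 hvN with hvT | hvX
      · exact hTQ hvT
      · exfalso
        have := Finset.mem_filter.1 hvX
        refine hspoil u hu huw ⟨(hCT u hu).1, v, this.1, fun hn => hv.2.2 hn.symm, ?_⟩
        rw [(hCT u hu).2]; exact this.2
    · intro y hy
      rcases Finset.mem_union.1 hy with hy | hy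
      · have h1 := Finset.card_le_card (missed_mono (H := H) hCQ y)
        have h2 := hQplex y (hTQ hy)
        omega
      · have := Finset.mem_filter.1 hy
        refine h.card_missed_lt this.1 this.2 ?_ fun u hu => (mem_missed.1 hu).2.2
        intro u hu
        exact Finset.mem_filter.2 (hCT u (mem_missed.1 hu).1)
    -- Since `w` was left out, the quota of its cluster is filled, and the vertices that fill it lie
    -- in `C`: they are neither in `T`, which is marked entirely, nor in `R`.
    · have h1 := hK.le_card w (Finset.mem_sdiff.2 ⟨hwU, hwK⟩)
      have h2 : N.card ≤ (T.filter (lab · = lab w)).card +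
        ((X \ Fo).filter (Touches H ((U \ X) \ T) lab · (lab w))).card := Finset.card_union_le _ _
      refine (Nat.mul_le_mul_left _ h2).trans (h1.trans (Finset.card_le_card ?_))
      intro v hv
      simp only [Finset.mem_filter, Finset.mem_sdiff, Finset.mem_union, not_or] at hv
      have hvR := Finset.mem_sdiff.1 (hKR v hv.1.1)
      simp only [hC, Finset.mem_filter, Finset.mem_sdiff]
      exact ⟨⟨⟨⟨hvR.1, hv.1.2.1⟩, fun hvT => hv.1.2.2 (hTM hvT)⟩, hvR.2⟩, hv.2⟩
    · rw [Finset.disjoint_left]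
      intro v hv hvN
      have := (hCT v hv).1
      simp only [hN, Finset.mem_union, Finset.mem_filter, Finset.mem_sdiff] at hvN this
      tauto

theorem IsKernel.yes_iff (hK : IsKernel s H U X T Fo lab K) (h : Tidy s k H U X T Fo lab) :
    Yes s H U k ↔ Yes s H K k := by
  refine ⟨Yes.mono hK.subset, fun hy => hK.yes_of_sdiff h (U \ K) le_rfl ?_⟩
  rwa [Finset.sdiff_sdiff_eq_self hK.subset]

/-- A vertex touches few clusters. -/
theorem Tidy.card_touched_le (h : Tidy s k H U X T Fo lab) {x : V} (hx : x ∈ X \ Fo) {L : Finset ℕ}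
    (hL : ∀ c ∈ L, Touches H ((U \ X) \ T) lab x c) : L.card ≤ 2 * s := by
  rcases L.eq_empty_or_nonempty with rfl | ⟨c₀, hc₀⟩
  · simp
  obtain ⟨y, hy, rfl, hxy⟩ := hL c₀ hc₀
  have : Nonempty V := ⟨y⟩
  choose! g hg using hL
  -- One neighbor of `x` from each other touched cluster is adjacent to `x` but not to `y`, so there
  -- are at most `2s - 1` other clusters.
  have hsub := h.free x hx y hy hxy ((L.erase (lab y)).image g) ?_ ?_
  · rw [Finset.card_image_of_injOn, Finset.card_erase_of_mem hc₀] at hsub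
    · omega
    · intro a ha b hb hab
      rw [Finset.mem_coe, Finset.mem_erase] at ha hb
      rw [← (hg a ha.2).2.1, ← (hg b hb.2).2.1, hab]
  · intro u hu
    obtain ⟨c, hc, rfl⟩ := Finset.mem_image.1 hu
    exact (hg c (Finset.mem_of_mem_erase hc)).1
  · intro u hu
    obtain ⟨c, hc, rfl⟩ := Finset.mem_image.1 hu
    rw [Finset.mem_erase] at hc
    have h1 := hg c hc.2
    have h2 : lab y ≠ lab (g c) := by rw [h1.2.1]; exact hc.1.symm
    refine ⟨fun he => h2 (by rw [he]), fun _ hn => h2 ?_, fun _ => h1.2.2⟩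
    exact h.closed y (Finset.mem_sdiff.1 hy).1 _ (Finset.mem_sdiff.1 h1.1).1 hn

theorem Tidy.card_insert_missed_le (h : Tidy s k H U X T Fo lab) {b : V} (hb : b ∈ U \ X) :
    (insert b (missed H ((U \ X).filter (lab · = lab b)) b)).card ≤ s :=
  (Finset.card_insert_le _ _).trans (h.plex _ b (Finset.mem_filter.2 ⟨hb, rfl⟩))

/-- A vertex `x` outside `Fo` causes few marked vertices. -/
theorem Tidy.card_marked_by_le (h : Tidy s k H U X T Fo lab) {x : V} (hx : x ∈ X \ Fo)
    {R : Finset V} (hR : ∀ w ∈ R, w ∈ (U \ X) \ T ∧ ∃ b ∈ (U \ X) \ T, ¬ H.Adj x b ∧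
      Touches H ((U \ X) \ T) lab x (lab b) ∧ lab b = lab w ∧ ¬ H.Adj b w) :
    R.card ≤ 10 * s * s := by
  classical
  -- If `x` touches at most one cluster, it spoils at most `3s` vertices, each of which marks at
  -- most `s`. If it touches two or more, every touched cluster is small outside `T`: fewer than
  -- `3s` vertices are missed by `x`, and fewer than `2s` are adjacent to `x`, since these are not
  -- adjacent to a neighbor `z` of `x` in another cluster. At most `2s` clusters of at most `5s`
  -- vertices give `10s²`.
  by_cases hone : ∃ c, ∀ c', Touches H ((U \ X) \ T) lab x c' → c' = c
  · obtain ⟨c, hc⟩ := hone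
    set B := ((U \ X) \ T).filter fun b => ¬ H.Adj x b ∧ Touches H ((U \ X) \ T) lab x (lab b)
      with hB
    have hBcard : B.card ≤ 3 * s := by
      rcases B.eq_empty_or_nonempty with he | ⟨b, hb⟩
      · simp [he]
      · have hb' := Finset.mem_filter.1 hb
        refine (h.card_missed_lt hx (c := c) ?_ (A := B) ?_ ?_).le
        · rw [← hc _ hb'.2.2]; exact hb'.2.2
        · intro u hu
          have hu' := Finset.mem_filter.1 hu
          exact Finset.mem_filter.2 ⟨hu'.1, hc _ hu'.2.2⟩
        · intro u hu
          exact (Finset.mem_filter.1 hu).2.1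
    have hsub : R ⊆ B.biUnion fun b => insert b (missed H ((U \ X).filter (lab · = lab b)) b) := by
      intro w hw
      obtain ⟨hwA, b, hb, hxb, htb, hlab, hbw⟩ := hR w hw
      refine Finset.mem_biUnion.2 ⟨b, Finset.mem_filter.2 ⟨hb, hxb, htb⟩, ?_⟩
      rw [Finset.mem_insert, mem_missed, Finset.mem_filter]
      by_cases hwb : w = b
      · exact Or.inl hwb
      · exact Or.inr ⟨⟨(Finset.mem_sdiff.1 hwA).1, hlab.symm⟩, hwb, hbw⟩
    have h1 := (Finset.card_le_card hsub).trans (Finset.card_biUnion_le_card_mul _ _ s fun b hb =>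
      h.card_insert_missed_le (Finset.mem_sdiff.1 (Finset.mem_filter.1 hb).1).1)
    nlinarith [Nat.mul_le_mul_right s hBcard]
  · push Not at hone
    set L := (((U \ X) \ T).filter (H.Adj x)).image lab with hL
    have hLt : ∀ c ∈ L, Touches H ((U \ X) \ T) lab x c := by
      intro c hc
      obtain ⟨y, hy, rfl⟩ := Finset.mem_image.1 hc
      have := Finset.mem_filter.1 hy
      exact ⟨y, this.1, rfl, this.2⟩
    have hLcard := h.card_touched_le hx hLt
    have hsub : R ⊆ L.biUnion fun c => ((U \ X) \ T).filter (lab · = c) := by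
      intro w hw
      obtain ⟨hwA, b, hb, hxb, ⟨y, hy, hyb, hxy⟩, hlab, hbw⟩ := hR w hw
      refine Finset.mem_biUnion.2 ⟨lab w, ?_, Finset.mem_filter.2 ⟨hwA, rfl⟩⟩
      exact Finset.mem_image.2 ⟨y, Finset.mem_filter.2 ⟨hy, hxy⟩, hyb.trans hlab⟩
    have hcl : ∀ c ∈ L, (((U \ X) \ T).filter (lab · = c)).card ≤ 5 * s := by
      intro c hc
      obtain ⟨c', ⟨z, hz, rfl, hxz⟩, hne⟩ := hone c
      have h1 := h.card_missed_lt hx (hLt c hc)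
        (A := (((U \ X) \ T).filter (lab · = c)).filter fun u => ¬ H.Adj x u)
        (Finset.filter_subset _ _) (fun u hu => (Finset.mem_filter.1 hu).2)
      have h2 := h.free x hx z hz hxz ((((U \ X) \ T).filter (lab · = c)).filter (H.Adj x))
        ((Finset.filter_subset _ _).trans (Finset.filter_subset _ _)) (by
          intro u hu
          rw [Finset.mem_filter, Finset.mem_filter] at hu
          refine ⟨?_, fun _ hzu => ?_, fun _ => hu.2⟩
          · rintro rfl; exact hne hu.1.2
          · refine hne ?_
            rw [← hu.1.2]
            exact h.closed z (Finset.mem_sdiff.1 hz).1 u (Finset.mem_sdiff.1 hu.1.1).1 hzu)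
      have h3 := Finset.card_filter_add_card_filter_not
        (s := ((U \ X) \ T).filter (lab · = c)) (H.Adj x)
      omega
    have h1 := (Finset.card_le_card hsub).trans (Finset.card_biUnion_le_card_mul _ _ _ hcl)
    nlinarith [Nat.mul_le_mul_right (5 * s) hLcard]

/-- A vertex of `T` marks itself and what it misses in its cluster, at most `s` vertices. Every
other marking is charged to a vertex of `X` that spoils the marking vertex. -/
theorem Tidy.card_marked_le (h : Tidy s k H U X T Fo lab) :
    (marked H (X \ Fo) (U \ X) T lab).card ≤ T.card * s + X.card * (10 * s * s) := by
  classical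
  have hsub : marked H (X \ Fo) (U \ X) T lab ⊆
      (T.biUnion fun b => insert b (missed H ((U \ X).filter (lab · = lab b)) b)) ∪
      (X \ Fo).biUnion fun x => ((U \ X) \ T).filter fun w => ∃ b ∈ (U \ X) \ T, ¬ H.Adj x b ∧
        Touches H ((U \ X) \ T) lab x (lab b) ∧ lab b = lab w ∧ ¬ H.Adj b w := by
    intro w hw
    have key : ∀ b ∈ T, lab b = lab w → ¬ H.Adj b w →
        w ∈ T.biUnion fun b => insert b (missed H ((U \ X).filter (lab · = lab b)) b) := by
      intro b hb hlab hbw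
      refine Finset.mem_biUnion.2 ⟨b, hb, ?_⟩
      rw [Finset.mem_insert, mem_missed, Finset.mem_filter]
      by_cases hwb : w = b
      · exact Or.inl hwb
      · exact Or.inr ⟨⟨(mem_marked.1 hw).1, hlab.symm⟩, hwb, hbw⟩
    obtain ⟨hwA, b, hb, hlab, hbw⟩ := mem_marked.1 hw
    by_cases hwT : w ∈ T
    · exact Finset.mem_union_left _ (key w hwT rfl H.irrefl)
    rcases hb with hb | ⟨hbA, x, hx, hxb, htb⟩
    · exact Finset.mem_union_left _ (key b hb hlab hbw)
    · exact Finset.mem_union_right _ (Finset.mem_biUnion.2 ⟨x, hx, Finset.mem_filter.2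
        ⟨Finset.mem_sdiff.2 ⟨hwA, hwT⟩, b, hbA, hxb, htb, hlab, hbw⟩⟩)
  refine (Finset.card_le_card hsub).trans ((Finset.card_union_le _ _).trans (Nat.add_le_add ?_ ?_))
  · exact Finset.card_biUnion_le_card_mul _ _ _ fun b hb =>
      h.card_insert_missed_le (h.subset_T hb)
  · refine (Finset.card_biUnion_le_card_mul _ _ _ fun x hx => ?_).trans
      (Nat.mul_le_mul_right _ (Finset.card_le_card Finset.sdiff_subset))
    exact h.card_marked_by_le hx fun w hw => Finset.mem_filter.1 hw

/-- Double counting: a vertex of `T` contributes to one cluster, a vertex of `X` to at most `2s`.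
Hence the bound does not depend on the number of clusters. -/
theorem Tidy.sum_quota_le (h : Tidy s k H U X T Fo lab) (L : Finset ℕ) :
    ∑ c ∈ L, quota s H (X \ Fo) (U \ X) T lab c ≤ 4 * s * (T.card + X.card * (2 * s)) := by
  classical
  unfold quota
  rw [← Finset.mul_sum, Finset.sum_add_distrib]
  refine Nat.mul_le_mul_left _ (Nat.add_le_add ?_ ?_)
  · rw [← Finset.card_biUnion fun a _ b _ hab => Finset.disjoint_left.2 fun t ha hb =>
      hab ((Finset.mem_filter.1 ha).2.symm.trans (Finset.mem_filter.1 hb).2)]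
    exact Finset.card_le_card (Finset.biUnion_subset.2 fun c _ => Finset.filter_subset _ _)
  · have : ∑ c ∈ L, ((X \ Fo).filter (Touches H ((U \ X) \ T) lab · c)).card =
        ∑ x ∈ X \ Fo, (L.filter (Touches H ((U \ X) \ T) lab x ·)).card := by
      simp only [Finset.card_filter]
      exact Finset.sum_comm
    rw [this]
    refine (Finset.sum_le_card_nsmul _ _ (2 * s) fun x hx => ?_).trans ?_
    · exact h.card_touched_le hx fun c hc => (Finset.mem_filter.1 hc).2
    · rw [smul_eq_mul]
      exact Nat.mul_le_mul_right _ (Finset.card_le_card Finset.sdiff_subset)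

theorem IsKernel.card_le_of_tidy (hK : IsKernel s H U X T Fo lab K)
    (h : Tidy s k H U X T Fo lab) :
    K.card ≤ X.card + (T.card * s + X.card * (10 * s * s)) +
      4 * s * (T.card + X.card * (2 * s)) := by
  classical
  set M := marked H (X \ Fo) (U \ X) T lab with hM
  have h1 : (K \ (X ∪ M)).card ≤ 4 * s * (T.card + X.card * (2 * s)) := by
    rw [Finset.card_eq_sum_card_image lab]
    exact (Finset.sum_le_sum fun c _ => hK.card_le c).trans (h.sum_quota_le _)
  have h2 := Finset.card_le_card_sdiff_add_card (s := K) (t := X ∪ M)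
  have h3 := Finset.card_union_le X M
  have h4 := h.card_marked_le
  rw [← hM] at h4
  omega

end Tidy

open RAM

/-! ### A Hoare logic with running times and frame conditions. -/

section Logic

/-- The registers that a program may overwrite. -/
def regs : Program → List ℕ
  | .skip => []
  | .assign x _ => [x]
  | .write _ _ _ => []
  | .seq p q => regs p ++ regs q
  | .cond _ p q => regs p ++ regs q
  | .loop _ p => regs p

/-- The arrays that a program may overwrite. -/
def arrs : Program → List ℕ
  | .skip => []
  | .assign _ _ => []
  | .write a _ _ => [a]
  | .seq p q => arrs p ++ arrs q
  | .cond _ p q => arrs p ++ arrs q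
  | .loop _ p => arrs p

/-- The configurations `σ` and `τ` agree outside of the registers `R` and the arrays `A`. -/
structure Frame (R A : List ℕ) (σ τ : State) : Prop where
  reg : ∀ x, x ∉ R → τ.reg x = σ.reg x
  arr : ∀ a, a ∉ A → τ.arr a = σ.arr a

theorem Frame.mono {R A R' A' : List ℕ} {σ τ : State} (h : Frame R A σ τ) (hR : R ⊆ R')
    (hA : A ⊆ A') : Frame R' A' σ τ :=
  ⟨fun x hx => h.reg x fun h => hx (hR h), fun x hx => h.arr x fun h => hx (hA h)⟩

theorem Frame.refl (R A : List ℕ) (σ : State) : Frame R A σ σ := ⟨fun _ _ => rfl, fun _ _ => rfl⟩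

theorem Frame.trans {R A : List ℕ} {σ τ υ : State} (h : Frame R A σ τ) (h' : Frame R A τ υ) :
    Frame R A σ υ :=
  ⟨fun x hx => (h'.reg x hx).trans (h.reg x hx), fun x hx => (h'.arr x hx).trans (h.arr x hx)⟩

theorem Frame.setReg {R A : List ℕ} {σ τ : State} {x v : ℕ} (h : Frame R A σ τ) (hx : x ∈ R) :
    Frame R A σ (τ.setReg x v) :=
  ⟨fun y hy => (Function.update_of_ne (fun e : y = x => hy (e.symm ▸ hx)) _ _).trans (h.reg y hy), h.arr⟩

/-- What a run cannot change is read off from the program text, so specifications and invariants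
need to speak only of what does change. -/
theorem frame_of_run {p : Program} {σ τ : State} {t : ℕ} (h : Run p σ t τ) :
    Frame (regs p) (arrs p) σ τ := by
  induction h with
  | skip σ => exact Frame.refl _ _ _
  | assign x e σ =>
    exact ⟨fun y hy => Function.update_of_ne (by simpa [regs] using hy) _ _, fun _ _ => rfl⟩
  | write a i e σ =>
    exact ⟨fun _ _ => rfl, fun b hb => Function.update_of_ne (by simpa [arrs] using hb) _ _⟩
  | seq _ _ ih₁ ih₂ =>
    exact (ih₁.mono (by simp [regs]) (by simp [arrs])).trans
      (ih₂.mono (by simp [regs]) (by simp [arrs]))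
  | condTrue _ _ ih => exact ih.mono (by simp [regs]) (by simp [arrs])
  | condFalse _ _ ih => exact ih.mono (by simp [regs]) (by simp [arrs])
  | loopTrue _ _ _ ih₁ ih₂ =>
    exact Frame.trans (ih₁.mono (by simp [regs]) (by simp [arrs])) ih₂
  | loopFalse _ => exact Frame.refl _ _ _

/-- Total correctness: started in `σ`, the program `p` halts after at most `T` time units in a
configuration with property `Q`. -/
def Tr (p : Program) (σ : State) (T : ℕ) (Q : State → Prop) : Prop :=
  ∃ t τ, Run p σ t τ ∧ t ≤ T ∧ Q τ

variable {p q : Program} {σ : State} {T T₁ T₂ : ℕ} {Q Q' : State → Prop}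

theorem Tr.mono (h : Tr p σ T₁ Q) (hT : T₁ ≤ T) (hQ : ∀ τ, Q τ → Q' τ) : Tr p σ T Q' := by
  obtain ⟨t, τ, hr, ht, hq⟩ := h
  exact ⟨t, τ, hr, ht.trans hT, hQ τ hq⟩

theorem Tr.frame (h : Tr p σ T Q) : Tr p σ T fun τ => Frame (regs p) (arrs p) σ τ ∧ Q τ := by
  obtain ⟨t, τ, hr, ht, hq⟩ := h
  exact ⟨t, τ, hr, ht, frame_of_run hr, hq⟩

theorem Tr.seq (h : Tr p σ T₁ fun τ => Tr q τ T₂ Q) : Tr (p.seq q) σ (T₁ + T₂) Q := by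
  obtain ⟨t, τ, hr, ht, u, υ, hr', hu, hq⟩ := h
  exact ⟨t + u, υ, .seq hr hr', Nat.add_le_add ht hu, hq⟩

theorem Tr.seq' (h : Tr p σ T₁ Q') (h' : ∀ τ, Q' τ → Tr q τ T₂ Q) :
    Tr (p.seq q) σ (T₁ + T₂) Q :=
  Tr.seq (h.mono le_rfl h')

theorem Tr.skip (h : Q σ) : Tr .skip σ 1 Q := ⟨_, _, .skip σ, le_rfl, h⟩

theorem Tr.assign {x : ℕ} {e : Expr} (h : Q (σ.setReg x (e.eval σ))) :
    Tr (.assign x e) σ (e.cost + 1) Q := ⟨_, _, .assign x e σ, le_rfl, h⟩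

theorem Tr.write {a : ℕ} {i e : Expr} (h : Q (σ.setArr a (i.eval σ) (e.eval σ))) :
    Tr (.write a i e) σ (i.cost + e.cost + 1) Q := ⟨_, _, .write a i e σ, le_rfl, h⟩

theorem Tr.cond {b : Expr} (hp : b.eval σ ≠ 0 → Tr p σ T Q) (hq : b.eval σ = 0 → Tr q σ T Q) :
    Tr (.cond b p q) σ (b.cost + 1 + T) Q := by
  by_cases hb : b.eval σ = 0
  · obtain ⟨t, τ, hr, ht, h⟩ := hq hb
    exact ⟨_, τ, .condFalse hb hr, Nat.add_le_add_left ht _, h⟩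
  · obtain ⟨t, τ, hr, ht, h⟩ := hp hb
    exact ⟨_, τ, .condTrue hb hr, Nat.add_le_add_left ht _, h⟩

/-- A loop with a measure that decreases in every iteration. -/
theorem Tr.loop {b : Expr} (I : State → Prop) (μ : State → ℕ) (c : ℕ) (h₀ : I σ)
    (hs : ∀ τ, I τ → b.eval τ ≠ 0 → Tr p τ c fun τ' => I τ' ∧ μ τ' < μ τ) :
    Tr (.loop b p) σ (μ σ * (b.cost + 1 + c) + (b.cost + 1)) fun τ => I τ ∧ b.eval τ = 0 := by
  induction hm : μ σ using Nat.strong_induction_on generalizing σ with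
  | _ m ih =>
    by_cases hb : b.eval σ = 0
    · exact ⟨_, σ, .loopFalse hb, by omega, h₀, hb⟩
    · obtain ⟨t, τ, hr, ht, hI, hμ⟩ := hs σ h₀ hb
      obtain ⟨u, υ, hr', hu, hq⟩ := ih (μ τ) (hm ▸ hμ) hI rfl
      refine ⟨_, υ, .loopTrue hb hr hr', ?_, hq⟩
      have : (μ τ + 1) * (b.cost + 1 + c) ≤ m * (b.cost + 1 + c) := Nat.mul_le_mul_right _ (by omega)
      rw [Nat.succ_mul] at this
      omega

/-- `for i < b do p`. -/
def forN (i b : ℕ) (p : Program) : Program :=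
  .seq (.assign i (.const 0))
    (.loop (.sub (.reg b) (.reg i)) (.seq p (.assign i (.add (.reg i) (.const 1)))))

/-- The cost may vary with the index, because in `tidyP` only the indices in `X` are expensive. Each
round adds `8` for the test and the increment; the initialization and the last test add `6`. -/
theorem Tr.forN {i b : ℕ} (n : ℕ) (I : ℕ → State → Prop) (c : ℕ → ℕ) (hn : σ.reg b = n)
    (hib : b ≠ i) (hi : i ∉ regs p) (hb : b ∉ regs p)
    (hI : ∀ j τ v, I j τ → I j (τ.setReg i v)) (h₀ : I 0 σ)
    (hs : ∀ j < n, ∀ τ, Frame (i :: regs p) (arrs p) σ τ → τ.reg i = j → I j τ →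
      Tr p τ (c j) (I (j + 1))) :
    Tr (forN i b p) σ (∑ j ∈ Finset.range n, c j + 8 * n + 6)
      fun τ => Frame (i :: regs p) (arrs p) σ τ ∧ I n τ := by
  have key : ∀ m j τ, j + m = n → Frame (i :: regs p) (arrs p) σ τ → τ.reg i = j → I j τ →
      Tr (.loop (.sub (.reg b) (.reg i)) (.seq p (.assign i (.add (.reg i) (.const 1))))) τ
        (∑ l ∈ Finset.Ico j n, c l + 8 * m + 4)
        fun τ => Frame (i :: regs p) (arrs p) σ τ ∧ I n τ := by
    intro m
    induction m with
    | zero =>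
      intro j τ hj hf hi' hIj
      have hbn : τ.reg b = n := (hf.reg b (by simp [hb, hib])).trans hn
      refine ⟨_, τ, .loopFalse ?_, ?_, hf, ?_⟩
      · simp [Expr.eval, hbn, hi']; omega
      · simp [Expr.cost]
      · rwa [← hj]
    | succ m ih =>
      intro j τ hj hf hi' hIj
      have hbn : τ.reg b = n := (hf.reg b (by simp [hb, hib])).trans hn
      obtain ⟨t, υ, hr, ht, hI'⟩ := hs j (by omega) τ hf hi' hIj
      have hf' := frame_of_run hr
      have hυi : υ.reg i = j := (hf'.reg i hi).trans hi'
      obtain ⟨u, ω, hr', hu, hq⟩ := ih (j + 1) (υ.setReg i (j + 1)) (by omega)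
        (Frame.setReg (hf.trans (hf'.mono (by simp) (by simp))) (by simp))
        (by simp [State.setReg]) (hI _ _ _ hI')
      refine ⟨_, ω, .loopTrue (u := u) ?_ (.seq hr (.assign _ _ _)) ?_, ?_, hq⟩
      · simp [Expr.eval, hbn, hi']; omega
      · rw [show (Expr.add (.reg i) (.const 1)).eval υ = j + 1 by simp [Expr.eval, hυi]]
        exact hr'
      · rw [Finset.sum_eq_sum_Ico_succ_bot (by omega)]
        simp only [Expr.cost]
        omega
  obtain ⟨t, τ, hr, ht, hq⟩ := key n 0 (σ.setReg i 0) (by omega)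
    (Frame.setReg (Frame.refl _ _ _) (by simp)) (by simp [State.setReg]) (hI _ _ _ h₀)
  refine ⟨_, τ, .seq (.assign _ _ _) hr, ?_, hq⟩
  rw [← Finset.range_eq_Ico] at ht
  simp only [Expr.cost]
  omega

/-- `for i < b do p` when every execution of the body takes at most `c` time units. -/
theorem Tr.forN_const {i b : ℕ} (n : ℕ) (I : ℕ → State → Prop) (c : ℕ) (hn : σ.reg b = n)
    (hib : b ≠ i) (hi : i ∉ regs p) (hb : b ∉ regs p)
    (hI : ∀ j τ v, I j τ → I j (τ.setReg i v)) (h₀ : I 0 σ)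
    (hs : ∀ j < n, ∀ τ, Frame (i :: regs p) (arrs p) σ τ → τ.reg i = j → I j τ →
      Tr p τ c (I (j + 1))) :
    Tr (SPlexKernel.forN i b p) σ ((c + 8) * (n + 1))
      fun τ => Frame (i :: regs p) (arrs p) σ τ ∧ I n τ := by
  refine (Tr.forN n I (fun _ => c) hn hib hi hb hI h₀ hs).mono ?_ fun _ h => h
  simp only [Finset.sum_const, Finset.card_range, smul_eq_mul]
  nlinarith

end Logic

/-! ### Boolean tests expressed by truncated subtraction. -/

section Expressions

/-- Conjunction. -/
def andE (a b : Expr) : Expr := .sub (.const 1) (.add (.sub (.const 1) a) (.sub (.const 1) b))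

/-- Negation. -/
def notE (a : Expr) : Expr := .sub (.const 1) a

/-- Equality. -/
def eqE (a b : Expr) : Expr := .sub (.const 1) (.add (.sub a b) (.sub b a))

/-- The entry of the array `a` at the index in register `i`. -/
def rd (a i : ℕ) : Expr := .read a (.reg i)

/-- The entry of the adjacency matrix for the vertices in the registers `i` and `j`; array `2` holds
the offsets of the rows. -/
def adjE (i j : ℕ) : Expr := .read 0 (.add (.read 2 (.reg i)) (.reg j))

variable {σ : State}

@[simp] theorem eval_andE {a b : Expr} :
    (andE a b).eval σ = 0 ↔ ¬ (a.eval σ ≠ 0 ∧ b.eval σ ≠ 0) := by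
  simp [andE, Expr.eval]; omega

@[simp] theorem eval_notE {a : Expr} : (notE a).eval σ = 0 ↔ a.eval σ ≠ 0 := by
  simp [notE, Expr.eval]; omega

@[simp] theorem eval_eqE {a b : Expr} : (eqE a b).eval σ = 0 ↔ a.eval σ ≠ b.eval σ := by
  simp [eqE, Expr.eval]; omega

@[simp] theorem eval_rd {a i : ℕ} : (rd a i).eval σ = σ.arr a (σ.reg i) := rfl

@[simp] theorem eval_adjE {i j : ℕ} :
    (adjE i j).eval σ = σ.arr 0 (σ.arr 2 (σ.reg i) + σ.reg j) := rfl

@[simp] theorem eval_const {c : ℕ} : (Expr.const c).eval σ = c := rfl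

@[simp] theorem eval_reg {c : ℕ} : (Expr.reg c).eval σ = σ.reg c := rfl

@[simp] theorem eval_read {a : ℕ} {e : Expr} : (Expr.read a e).eval σ = σ.arr a (e.eval σ) := rfl

@[simp] theorem eval_add {a b : Expr} : (Expr.add a b).eval σ = a.eval σ + b.eval σ := rfl

@[simp] theorem eval_sub {a b : Expr} : (Expr.sub a b).eval σ = a.eval σ - b.eval σ := rfl

@[simp] theorem setReg_reg {x y v : ℕ} :
    (σ.setReg x v).reg y = if y = x then v else σ.reg y := by
  simp [State.setReg, Function.update_apply]

@[simp] theorem setReg_arr {x v : ℕ} : (σ.setReg x v).arr = σ.arr := rfl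

@[simp] theorem setArr_reg {a i v : ℕ} : (σ.setArr a i v).reg = σ.reg := rfl

@[simp] theorem setArr_arr {a b i v : ℕ} :
    (σ.setArr a i v).arr b = if b = a then Function.update (σ.arr a) i v else σ.arr b := by
  simp only [State.setArr, Function.update_apply]

end Expressions

/-! ### Bounded selection and search over all vertices in linear time. -/

section Take

/-- Perform `a[i] := v` for the first `m` indices `i < n` that satisfy `e`; count them in `c`. -/
def take (i c m a : ℕ) (e v : Expr) : Program :=
  .seq (.assign c (.const 0)) (forN i 2
    (.cond e (.cond (.sub (.reg m) (.reg c))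
      (.seq (.write a (.reg i) v) (.assign c (.add (.reg c) (.const 1)))) .skip) .skip))

/-- The entries from the current index on are still the old ones; thus the test and the value may
read the very array being written, at the current index. -/
theorem take_spec {i c m a : ℕ} {e v : Expr} {σ : State} {n M : ℕ} (P : ℕ → Prop)
    [DecidablePred P] (val : ℕ → ℕ) (hn : σ.reg 2 = n) (hm : σ.reg m = M)
    (hi : i ≠ 2 ∧ c ≠ 2 ∧ i ≠ c ∧ m ≠ i ∧ m ≠ c) (hcost : e.cost + v.cost ≤ 60)
    (he : ∀ j < n, ∀ τ, Frame [c, i] [a] σ τ → τ.reg i = j → (∀ l ≥ j, τ.arr a l = σ.arr a l) →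
      (e.eval τ ≠ 0 ↔ P j) ∧ (P j → v.eval τ = val j)) :
    Tr (take i c m a e v) σ (100 * (n + 1)) fun τ => Frame [c, i] [a] σ τ ∧
      ∃ W ⊆ (Finset.range n).filter P, W.card = min M ((Finset.range n).filter P).card ∧
        τ.reg c = W.card ∧ τ.arr a = fun j => if j ∈ W then val j else σ.arr a j := by
  obtain ⟨hi2, hc2, hic, hmi, hmc⟩ := hi
  let I : ℕ → State → Prop := fun j τ => ∃ W ⊆ (Finset.range j).filter P,
    W.card = min M ((Finset.range j).filter P).card ∧ τ.reg c = W.card ∧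
      τ.arr a = fun l => if l ∈ W then val l else σ.arr a l
  have hreg : regs (Program.cond e (.cond (.sub (.reg m) (.reg c))
      (.seq (.write a (.reg i) v) (.assign c (.add (.reg c) (.const 1)))) .skip) .skip) = [c] := rfl
  have harr : arrs (Program.cond e (.cond (.sub (.reg m) (.reg c))
      (.seq (.write a (.reg i) v) (.assign c (.add (.reg c) (.const 1)))) .skip) .skip) = [a] := rfl
  refine Tr.mono (Tr.seq' (T₁ := 2) (T₂ := (80 + 8) * (n + 1))
    (Q' := fun τ => τ = σ.setReg c 0) (Tr.assign (by simp)) ?_) (by omega) (fun _ h => h)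
  rintro _ rfl
  refine (Tr.forN_const n I 80 (by simpa [hc2.symm] using hn) hi2.symm (by simp [hreg, hic])
    (by simp [hreg, hc2.symm]) ?_ ?_ ?_).mono le_rfl ?_
  · rintro j τ v' ⟨W, h1, h2, h3, h4⟩
    exact ⟨W, h1, h2, by simp [hic.symm, h3], h4⟩
  · exact ⟨∅, by simp, by simp, by simp, by simp⟩
  · rintro j hj τ hf hji ⟨W, h1, h2, h3, h4⟩
    rw [hreg, harr] at hf
    have hf' : Frame [c, i] [a] σ τ := by
      refine Frame.trans (τ := σ.setReg c 0) ?_ (hf.mono (by simp) (by simp))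
      exact Frame.setReg (Frame.refl _ _ _) (by simp)
    have hlt : ∀ l ∈ W, l < j := fun l hl => Finset.mem_range.1 (Finset.mem_filter.1 (h1 hl)).1
    obtain ⟨he1, he2⟩ := he j hj τ hf' hji (fun l hl => by
      rw [h4]; simp only [if_neg (fun h => absurd (hlt l h) (by omega))])
    have hmM : τ.reg m = M := by rw [hf'.reg m (by simp [hmi, hmc]), hm]
    have hfilt : ¬ P j → (Finset.range (j + 1)).filter P = (Finset.range j).filter P := by
      intro h; rw [Finset.range_add_one, Finset.filter_insert, if_neg h]
    have hfilt' : P j → (Finset.range (j + 1)).filter P =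
        insert j ((Finset.range j).filter P) := by
      intro h; rw [Finset.range_add_one, Finset.filter_insert, if_pos h]
    have hcardP : P j → ((Finset.range (j + 1)).filter P).card =
        ((Finset.range j).filter P).card + 1 := fun h => by
      rw [hfilt' h, Finset.card_insert_of_notMem (by simp)]
    refine Tr.mono (T₁ := e.cost + 1 + (3 + 1 + ((1 + v.cost + 1) + (3 + 1))))
      (Tr.cond (fun hb => Tr.cond (fun hb' => Tr.seq (Tr.write (Tr.assign ?_))) fun hb' => ?_)
        fun hb => ?_) (by omega) (fun _ h => h)
    · have hP := he1.1 hb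
      refine ⟨insert j W, ?_, ?_, ?_, ?_⟩
      · rw [hfilt' hP]; exact Finset.insert_subset_insert _ h1
      · rw [Finset.card_insert_of_notMem fun h => absurd (hlt j h) (by omega), hcardP hP]
        simp only [eval_sub, eval_reg, hmM] at hb'
        omega
      · simp [h3, Finset.card_insert_of_notMem fun h => absurd (hlt j h) (lt_irrefl j)]
      · funext l
        by_cases hl : l = j
        · subst hl
          simp [hji, he2 hP]
        · simp [hji, hl, h4]
    · refine (Tr.skip (Q := I (j + 1)) ⟨W, ?_, ?_, h3, h4⟩).mono (by omega) (fun _ h => h)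
      · rw [hfilt' (he1.1 hb)]; exact h1.trans (Finset.subset_insert _ _)
      · rw [hcardP (he1.1 hb)]
        simp only [eval_sub, eval_reg, hmM] at hb'
        omega
    · have hP : ¬ P j := fun h => he1.2 h hb
      exact (Tr.skip (Q := I (j + 1)) ⟨W, by rwa [hfilt hP], by rwa [hfilt hP], h3, h4⟩).mono
        (by omega) (fun _ h => h)
  · rintro τ ⟨hf, W, h1, h2, h3, h4⟩
    rw [hreg, harr] at hf
    refine ⟨?_, W, h1, h2, h3, h4⟩
    refine Frame.trans (τ := σ.setReg c 0) ?_ (hf.mono (by simp) (by simp))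
    exact Frame.setReg (Frame.refl _ _ _) (by simp)

/-- Perform `a[i] := v` for all indices `i < n` that satisfy `e`; count them in `c`. -/
theorem take_all_spec {i c a : ℕ} {e v : Expr} {σ : State} {n : ℕ} (P : ℕ → Prop)
    [DecidablePred P] (val : ℕ → ℕ) (hn : σ.reg 2 = n)
    (hi : i ≠ 2 ∧ c ≠ 2 ∧ i ≠ c) (hcost : e.cost + v.cost ≤ 60)
    (he : ∀ j < n, ∀ τ, Frame [c, i] [a] σ τ → τ.reg i = j → (∀ l ≥ j, τ.arr a l = σ.arr a l) →
      (e.eval τ ≠ 0 ↔ P j) ∧ (P j → v.eval τ = val j)) :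
    Tr (take i c 2 a e v) σ (100 * (n + 1)) fun τ => Frame [c, i] [a] σ τ ∧
      τ.reg c = ((Finset.range n).filter P).card ∧
      τ.arr a = fun j => if j < n ∧ P j then val j else σ.arr a j := by
  refine (take_spec P val hn hn ⟨hi.1, hi.2.1, hi.2.2, hi.1.symm, hi.2.1.symm⟩ hcost he).mono le_rfl
    ?_
  rintro τ ⟨hf, W, h1, h2, h3, h4⟩
  -- Register `2` holds `n`, a limit that never cuts the selection short.
  have hW : W = (Finset.range n).filter P := by
    refine Finset.eq_of_subset_of_card_le h1 ?_
    have := Finset.card_le_card (Finset.filter_subset P (Finset.range n))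
    rw [Finset.card_range] at this
    omega
  subst hW
  exact ⟨hf, h3, by simpa [Finset.mem_filter] using h4⟩

/-- Find an index `i < n` that satisfies `e`: set `x := i` and `f := 1`. -/
def find (i x f : ℕ) (e : Expr) : Program :=
  .seq (.assign f (.const 0)) (forN i 2
    (.cond e (.seq (.assign x (.reg i)) (.assign f (.const 1))) .skip))

theorem find_spec {i x f : ℕ} {e : Expr} {σ : State} {n : ℕ} (P : ℕ → Prop) (hn : σ.reg 2 = n)
    (hi : i ≠ 2 ∧ x ≠ 2 ∧ f ≠ 2 ∧ i ≠ x ∧ i ≠ f ∧ x ≠ f) (hcost : e.cost ≤ 60)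
    (he : ∀ j < n, ∀ τ, Frame [x, f, i] [] σ τ → τ.reg i = j → (e.eval τ ≠ 0 ↔ P j)) :
    Tr (find i x f e) σ (100 * (n + 1)) fun τ => Frame [x, f, i] [] σ τ ∧
      (τ.reg f = 1 ∧ τ.reg x < n ∧ P (τ.reg x) ∨ τ.reg f = 0 ∧ ∀ j < n, ¬ P j) := by
  obtain ⟨hi2, hx2, hf2, hix, hif, hxf⟩ := hi
  let I : ℕ → State → Prop := fun j τ =>
    (τ.reg f = 1 ∧ τ.reg x < n ∧ P (τ.reg x) ∨ τ.reg f = 0 ∧ ∀ l < j, ¬ P l)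
  refine Tr.mono (Tr.seq' (T₁ := 2) (T₂ := (80 + 8) * (n + 1))
    (Q' := fun τ => τ = σ.setReg f 0) (Tr.assign (by simp)) ?_) (by omega) (fun _ h => h)
  rintro _ rfl
  have hfr : ∀ τ, Frame [i, x, f] [] (σ.setReg f 0) τ → Frame [x, f, i] [] σ τ := fun τ hf => by
    refine Frame.trans (τ := σ.setReg f 0) ?_ (hf.mono (by simp) (by simp))
    exact Frame.setReg (Frame.refl _ _ _) (by simp)
  refine (Tr.forN_const n I 80 (by simpa [hf2.symm] using hn) hi2.symm (by simp [regs, hix, hif])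
    (by simp [regs, hx2.symm, hf2.symm]) ?_ ?_ ?_).mono le_rfl ?_
  · rintro j τ v' h
    simpa [I, hif.symm, hix.symm] using h
  · exact Or.inr ⟨by simp, by simp⟩
  · rintro j hj τ hf hji h
    have he' := he j hj τ (hfr τ hf) hji
    refine Tr.mono (T₁ := e.cost + 1 + (2 + 2))
      (Tr.cond (fun hb => Tr.seq (Tr.assign (Tr.assign ?_))) fun hb => ?_) (by omega) (fun _ h => h)
    · refine Or.inl ⟨by simp, ?_, ?_⟩
      · simp [hxf, hji, hj]
      · simpa [hxf, hji] using he'.1 hb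
    · refine (Tr.skip (Q := I (j + 1)) ?_).mono (by omega) (fun _ h => h)
      rcases h with h | ⟨h1, h2⟩
      · exact Or.inl h
      · refine Or.inr ⟨h1, fun l hl => ?_⟩
        rcases Nat.lt_succ_iff_lt_or_eq.1 hl with hl | rfl
        · exact h2 l hl
        · exact fun hP => he'.2 hP hb
  · rintro τ ⟨hf, h⟩
    exact ⟨hfr τ hf, h⟩

end Take

/-! ### The part of the memory that stays fixed. -/

section Base

open scoped Classical in
/-- Registers `0`, `1`, `2` hold `s`, `k`, `n`, and the adjacency matrix of `H` on the vertices
below `n` is accessible. -/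
structure Base (s k n : ℕ) (H : SimpleGraph ℕ) (σ : State) : Prop where
  reg_zero : σ.reg 0 = s
  reg_one : σ.reg 1 = k
  reg_two : σ.reg 2 = n
  adj : ∀ i < n, ∀ j < n, σ.arr 0 (σ.arr 2 i + j) = if H.Adj i j then 1 else 0

variable {s k n : ℕ} {H : SimpleGraph ℕ} {σ τ : State}

theorem Base.adj_zero (h : Base s k n H σ) {i j : ℕ} (hi : i < n) (hj : j < n) :
    σ.arr 0 (σ.arr 2 i + j) = 0 ↔ ¬ H.Adj i j := by
  rw [h.adj i hi j hj]; simp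

theorem Base.frame (h : Base s k n H σ) {R A : List ℕ} (hf : Frame R A σ τ)
    (hR : ∀ x ∈ R, 3 ≤ x) (hA : 0 ∉ A ∧ 2 ∉ A) : Base s k n H τ := by
  refine ⟨?_, ?_, ?_, ?_⟩
  · rw [hf.reg 0 fun h => absurd (hR _ h) (by omega), h.reg_zero]
  · rw [hf.reg 1 fun h => absurd (hR _ h) (by omega), h.reg_one]
  · rw [hf.reg 2 fun h => absurd (hR _ h) (by omega), h.reg_two]
  · rw [hf.arr 0 hA.1, hf.arr 2 hA.2]; exact h.adj

end Base

/-! ### How the greedy packing evolves, independently of the machine. -/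

section Growing

/-- The vertices below `n` with label `c`. -/
def cls (n : ℕ) (lab : ℕ → ℕ) (c : ℕ) : Finset ℕ := (Finset.range n).filter (lab · = c)

/-- The vertices below `n` at which `f` is nonzero. -/
def supp (n : ℕ) (f : ℕ → ℕ) : Finset ℕ := (Finset.range n).filter (f · ≠ 0)

theorem mem_cls {n : ℕ} {lab : ℕ → ℕ} {c j : ℕ} : j ∈ cls n lab c ↔ j < n ∧ lab j = c := by
  simp [cls]

theorem mem_supp {n : ℕ} {f : ℕ → ℕ} {j : ℕ} : j ∈ supp n f ↔ j < n ∧ f j ≠ 0 := by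
  simp [supp]

/-- The bad sets that the greedy packing consists of. -/
def SmallBad (s : ℕ) (H : SimpleGraph ℕ) (F : Finset ℕ) : Prop := Bad s H F ∧ F.card ≤ 3 * s + 5

/-- The invariant of the greedy packing: `viol` small bad sets have been moved to the support of
`inX`; the labels other than `0` and `cur` mark finished clusters; label `cur` marks a connected
`s`-plex, `tou` its neighbors, and `miss` counts the vertices of it that a vertex misses. -/
structure Growing (s n : ℕ) (H : SimpleGraph ℕ) (viol cur : ℕ) (inX lab tou miss : ℕ → ℕ) :
    Prop where
  packing : Packing (SmallBad s H) viol (supp n inX)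
  lab_eq_zero : ∀ j < n, inX j ≠ 0 → lab j = 0
  closed : ∀ u < n, ∀ v < n, inX u = 0 → inX v = 0 → H.Adj u v → lab u ≠ 0 → lab u ≠ cur →
    lab v = lab u
  plex : ∀ c ≠ 0, Plex s H (cls n lab c)
  conn : ∀ a ∈ cls n lab cur, ∀ b ∈ cls n lab cur, Reach H (cls n lab cur) a b
  cur_pos : cur ≠ 0
  lab_le : ∀ j < n, lab j ≤ cur
  tou_le : ∀ j < n, tou j ≤ cur
  tou_iff : ∀ j < n, tou j = cur ↔ ∃ p ∈ cls n lab cur, H.Adj p j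
  miss_eq : ∀ j ∈ cls n lab cur, miss j = (missed H (cls n lab cur) j).card

/-- All vertices outside the support of `inX` have a label, and adjacent ones have the same. -/
structure Finished (n : ℕ) (H : SimpleGraph ℕ) (inX lab : ℕ → ℕ) : Prop where
  lab_ne_zero : ∀ j < n, inX j = 0 → lab j ≠ 0
  closed : ∀ u < n, ∀ v < n, inX u = 0 → inX v = 0 → H.Adj u v → lab u = lab v

variable {s n viol cur : ℕ} {H : SimpleGraph ℕ} {inX lab tou miss : ℕ → ℕ}

/-- If no unlabelled vertex outside `X` is touched, nothing more can join the current plex, and it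
is a finished cluster. The stamps in `tou` are at most `cur`, so increasing `cur` invalidates all of
them without a reset. -/
theorem Growing.next (h : Growing s n H viol cur inX lab tou miss)
    (hno : ∀ j < n, ¬ (inX j = 0 ∧ lab j = 0 ∧ tou j = cur)) :
    Growing s n H viol (cur + 1) inX lab tou miss ∧ cls n lab (cur + 1) = ∅ := by
  have hempty : cls n lab (cur + 1) = ∅ := by
    refine Finset.eq_empty_of_forall_notMem fun j hj => ?_
    have := mem_cls.1 hj
    have := h.lab_le j this.1
    omega
  refine ⟨⟨h.packing, h.lab_eq_zero, ?_, h.plex, ?_, by omega, ?_, ?_, ?_, ?_⟩, hempty⟩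
  · intro u hu v hv hxu hxv huv hu0 _
    by_cases huc : lab u = cur
    · have ht : tou v = cur := (h.tou_iff v hv).2 ⟨u, mem_cls.2 ⟨hu, huc⟩, huv⟩
      have hv0 : lab v ≠ 0 := fun h0 => hno v hv ⟨hxv, h0, ht⟩
      by_cases hvc : lab v = cur
      · rw [hvc, huc]
      · exact (h.closed v hv u hu hxv hxu huv.symm hv0 hvc).symm
    · exact h.closed u hu v hv hxu hxv huv hu0 huc
  · simp [hempty]
  · exact fun j hj => (h.lab_le j hj).trans (by omega)
  · exact fun j hj => (h.tou_le j hj).trans (by omega)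
  · intro j hj
    have := h.tou_le j hj
    simp [hempty]
    omega
  · simp [hempty]

open scoped Classical in
/-- The miss counts after `x` has joined the vertices with label `cur`. -/
noncomputable def missAdd (n : ℕ) (H : SimpleGraph ℕ) (cur x : ℕ) (lab miss : ℕ → ℕ) : ℕ → ℕ :=
  Function.update (fun j => if j < n ∧ lab j = cur ∧ ¬ H.Adj x j then miss j + 1 else miss j) x
    ((Finset.range n).filter fun j => lab j = cur ∧ ¬ H.Adj x j).card

open scoped Classical in
/-- The touched vertices after `x` has joined the vertices with label `cur`. -/
noncomputable def touAdd (n : ℕ) (H : SimpleGraph ℕ) (cur x : ℕ) (tou : ℕ → ℕ) : ℕ → ℕ :=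
  fun j => if j < n ∧ H.Adj x j then cur else tou j

theorem Growing.cls_update {x : ℕ} (hx : x < n) :
    cls n (Function.update lab x cur) cur = insert x (cls n lab cur) := by
  ext j
  rw [Finset.mem_insert, mem_cls, mem_cls, Function.update_apply]
  by_cases hj : j = x
  · simp [hj, hx]
  · simp [hj]

/-- One pass over the vertices keeps the miss counts current: a member not adjacent to `x` misses
one vertex more, and `x` starts with the number of members that it misses. -/
theorem Growing.missAdd_eq (h : Growing s n H viol cur inX lab tou miss) {x : ℕ}
    (hxl : lab x = 0) {j : ℕ} (hj : j ∈ insert x (cls n lab cur)) :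
    missAdd n H cur x lab miss j = (missed H (insert x (cls n lab cur)) j).card := by
  classical
  have hxc : x ∉ cls n lab cur := fun hc => h.cur_pos ((mem_cls.1 hc).2.symm.trans hxl)
  by_cases hjx : j = x
  · subst hjx
    rw [missAdd, Function.update_self]
    congr 1
    ext l
    rw [mem_missed, Finset.mem_filter, Finset.mem_range, Finset.mem_insert, mem_cls]
    constructor
    · rintro ⟨h1, h2, h3⟩
      exact ⟨Or.inr ⟨h1, h2⟩, fun e => hxc (mem_cls.2 ⟨e ▸ h1, e ▸ h2⟩), h3⟩
    · rintro ⟨h1, h2, h3⟩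
      have := h1.resolve_left h2
      exact ⟨this.1, this.2, h3⟩
  · have hjc : j ∈ cls n lab cur := (Finset.mem_insert.1 hj).resolve_left hjx
    have hjc' := mem_cls.1 hjc
    rw [missAdd, Function.update_of_ne hjx, h.miss_eq j hjc]
    by_cases hadj : H.Adj x j
    · rw [if_neg (fun hc => hc.2.2 hadj)]
      congr 1
      ext l
      rw [mem_missed, mem_missed, Finset.mem_insert]
      constructor
      · rintro ⟨h1, h2⟩; exact ⟨Or.inr h1, h2⟩
      · rintro ⟨h1, h2, h3⟩
        exact ⟨h1.resolve_left fun e => h3 (e ▸ hadj.symm), h2, h3⟩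
    · rw [if_pos ⟨hjc'.1, hjc'.2, hadj⟩]
      have : missed H (insert x (cls n lab cur)) j = insert x (missed H (cls n lab cur) j) := by
        ext l
        rw [Finset.mem_insert, mem_missed, mem_missed, Finset.mem_insert]
        constructor
        · rintro ⟨h1 | h1, h2⟩
          · exact Or.inl h1
          · exact Or.inr ⟨h1, h2⟩
        · rintro (rfl | ⟨h1, h2⟩)
          · exact ⟨Or.inl rfl, Ne.symm hjx, fun hc => hadj hc.symm⟩
          · exact ⟨Or.inr h1, h2⟩
      rw [this, Finset.card_insert_of_notMem fun hc => hxc (mem_missed.1 hc).1]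

/-- The new vertex has a neighbor in the plex or is its first vertex, so connectivity persists.
Finished clusters stay closed, as a vertex adjacent to one would already carry its label. -/
theorem Growing.add (h : Growing s n H viol cur inX lab tou miss) {x : ℕ} (hx : x < n)
    (hxX : inX x = 0) (hxl : lab x = 0) (hxt : tou x = cur ∨ cls n lab cur = ∅)
    (hmiss : ∀ j < n, Function.update lab x cur j = cur → missAdd n H cur x lab miss j < s) :
    Growing s n H viol cur inX (Function.update lab x cur) (touAdd n H cur x tou)
      (missAdd n H cur x lab miss) := by
  have hcls := Growing.cls_update (lab := lab) (cur := cur) hx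
  have hxc : x ∈ insert x (cls n lab cur) := Finset.mem_insert_self _ _
  refine ⟨h.packing, ?_, ?_, ?_, ?_, h.cur_pos, ?_, ?_, ?_, ?_⟩
  · intro j hj hjX
    rw [Function.update_of_ne (fun e => hjX (by rw [e]; exact hxX))]
    exact h.lab_eq_zero j hj hjX
  · intro u hu v hv huX hvX huv hu0 huc
    have hux : u ≠ x := fun e => huc (by rw [e, Function.update_self])
    rw [Function.update_of_ne hux] at *
    have := h.closed u hu v hv huX hvX huv hu0 huc
    rw [Function.update_of_ne (fun e => hu0 (by rw [← this, e, hxl]))]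
    exact this
  · intro c hc
    by_cases hcc : c = cur
    · subst hcc
      intro v hv
      have h1 := hmiss v (mem_cls.1 hv).1 (mem_cls.1 hv).2
      rw [hcls] at hv ⊢
      rwa [h.missAdd_eq hxl hv] at h1
    · refine (h.plex c hc).mono fun j hj => ?_
      rw [mem_cls, Function.update_apply] at hj
      split_ifs at hj with hjx
      · exact absurd hj.2.symm hcc
      · exact mem_cls.2 hj
  · rw [hcls]
    have hp : ∀ a ∈ cls n lab cur, Reach H (insert x (cls n lab cur)) a x := by
      intro a ha
      rcases hxt with ht | he
      · obtain ⟨p, hp, hpx⟩ := (h.tou_iff x hx).1 ht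
        exact ((h.conn a ha p hp).mono (Finset.subset_insert _ _)).trans
          (Reach.single hpx (Finset.mem_insert_of_mem hp) hxc)
      · rw [he] at ha; exact absurd ha (Finset.notMem_empty _)
    have hp' : ∀ a ∈ insert x (cls n lab cur), Reach H (insert x (cls n lab cur)) a x := by
      intro a ha
      rcases Finset.mem_insert.1 ha with rfl | ha
      · exact Reach.refl _
      · exact hp a ha
    exact fun a ha b hb => (hp' a ha).trans (hp' b hb).symm
  · intro j hj
    rw [Function.update_apply]
    split_ifs
    · exact le_rfl
    · exact h.lab_le j hj
  · intro j hj
    unfold touAdd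
    split_ifs
    · exact le_rfl
    · exact h.tou_le j hj
  · intro j hj
    rw [hcls]
    unfold touAdd
    split_ifs with hc
    · exact ⟨fun _ => ⟨x, hxc, hc.2⟩, fun _ => rfl⟩
    · rw [h.tou_iff j hj]
      constructor
      · rintro ⟨p, hp, hpj⟩; exact ⟨p, Finset.mem_insert_of_mem hp, hpj⟩
      · rintro ⟨p, hp, hpj⟩
        exact ⟨p, (Finset.mem_insert.1 hp).resolve_left fun e => hc ⟨hj, e ▸ hpj⟩, hpj⟩
  · intro j hj
    rw [hcls] at hj ⊢
    exact h.missAdd_eq hxl hj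

/-- The rest of the plex may fall apart once `F` is gone, so all its labels are reset and growth
restarts with a fresh label. The conditions on `F` provide a neighbor of `x`, enough vertices missed
by `u`, and connectivity. -/
theorem Growing.extract (h : Growing s n H viol cur inX lab tou miss) (hs : 1 ≤ s) {x u : ℕ}
    (hx : x < n) (hxX : inX x = 0) (hxl : lab x = 0) (hxt : tou x = cur ∨ cls n lab cur = ∅)
    (hu : u ∈ insert x (cls n lab cur))
    (hmiss : s ≤ missAdd n H cur x lab miss u) {F : Finset ℕ} {inX' lab' : ℕ → ℕ}
    (hF : F ⊆ insert x (cls n lab cur)) (hxF : x ∈ F) (huF : u ∈ F)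
    (hpF : (∃ p ∈ cls n lab cur, H.Adj x p) → ∃ p ∈ F, H.Adj x p)
    (hmF : min s (missed H (insert x (cls n lab cur)) u).card ≤ (missed H F u).card)
    (hcF : F = insert x (cls n lab cur) ∨ 2 * s + 2 ≤ F.card) (hFc : F.card ≤ 3 * s + 5)
    (hinX' : ∀ j < n, inX' j ≠ 0 ↔ inX j ≠ 0 ∨ j ∈ F)
    (hlab' : ∀ j < n, lab' j = if Function.update lab x cur j = cur then 0
      else Function.update lab x cur j) :
    Growing s n H (viol + 1) (cur + 1) inX' lab' (touAdd n H cur x tou)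
      (missAdd n H cur x lab miss) := by
  have hL : ∀ j ∈ insert x (cls n lab cur), j < n ∧ inX j = 0 := by
    intro j hj
    rcases Finset.mem_insert.1 hj with rfl | hj
    · exact ⟨hx, hxX⟩
    · have hj' := mem_cls.1 hj
      refine ⟨hj'.1, by_contra fun hc => h.cur_pos ?_⟩
      rw [← hj'.2, h.lab_eq_zero j hj'.1 hc]
  have hlab : ∀ j < n, lab' j ≠ 0 → lab' j = lab j ∧ lab j ≠ cur ∧ j ≠ x := by
    intro j hj hj0
    rw [hlab' j hj, Function.update_apply] at *
    split_ifs at * with h1 h2 h3 <;> simp_all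
  have hlab0 : ∀ j < n, lab j ≠ cur → lab' j = lab j := by
    intro j hj hjc
    rw [hlab' j hj, Function.update_apply]
    split_ifs with h1 h2 <;> simp_all
  have hX : ∀ j < n, inX' j = 0 → inX j = 0 := fun j hj h0 => by
    by_contra hc
    exact (hinX' j hj).2 (Or.inl hc) h0
  have hcls : ∀ c ≠ 0, cls n lab' c ⊆ cls n lab c := by
    intro c hc j hj
    have hj' := mem_cls.1 hj
    have := hlab j hj'.1 (by rw [hj'.2]; exact hc)
    exact mem_cls.2 ⟨hj'.1, by rw [← this.1, hj'.2]⟩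
  have hlab_le : ∀ j < n, lab' j ≤ cur := by
    intro j hj
    by_cases h0 : lab' j = 0
    · omega
    · rw [(hlab j hj h0).1]; exact h.lab_le j hj
  have hempty : cls n lab' (cur + 1) = ∅ := by
    refine Finset.eq_empty_of_forall_notMem fun j hj => ?_
    have := mem_cls.1 hj
    have := hlab_le j this.1
    omega
  have htou : ∀ j < n, touAdd n H cur x tou j ≤ cur := by
    intro j hj
    unfold touAdd
    split_ifs
    · exact le_rfl
    · exact h.tou_le j hj
  rw [h.missAdd_eq hxl hu] at hmiss
  refine ⟨?_, ?_, ?_, ?_, ?_, by omega, ?_, ?_, ?_, ?_⟩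
  · have hsupp : supp n inX' = F ∪ supp n inX := by
      ext j
      rw [Finset.mem_union, mem_supp, mem_supp]
      constructor
      · rintro ⟨h1, h2⟩
        rcases (hinX' j h1).1 h2 with h | h
        · exact Or.inr ⟨h1, h⟩
        · exact Or.inl h
      · rintro (h1 | h1)
        · have := (hL j (hF h1)).1
          exact ⟨this, (hinX' j this).2 (Or.inr h1)⟩
        · exact ⟨h1.1, (hinX' j h1.1).2 (Or.inl h1.2)⟩
    rw [hsupp]
    refine Packing.succ h.packing ⟨?_, hFc⟩ ?_
    · refine bad_of_insert (h.plex cur h.cur_pos) h.conn hF hxF huF (hpF ?_) (by omega) hcF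
      rcases hxt with ht | he
      · obtain ⟨p, hp, hpx⟩ := (h.tou_iff x hx).1 ht
        exact ⟨p, hp, hpx.symm⟩
      -- A single vertex misses nothing; as `1 ≤ s`, a violation needs a nonempty plex to join.
      · exfalso
        have : missed H (insert x (cls n lab cur)) u = ∅ := by
          rw [he] at hu ⊢
          refine Finset.eq_empty_of_forall_notMem fun j hj => ?_
          rw [mem_missed] at hj
          simp only [Finset.mem_insert, Finset.notMem_empty, or_false] at hu hj
          exact hj.2.1 (hj.1.trans hu.symm)
        rw [this, Finset.card_empty] at hmiss
        omega
    · rw [Finset.disjoint_left]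
      exact fun j hj hj' => (mem_supp.1 hj').2 (hL j (hF hj)).2
  · intro j hj hjX
    by_contra h0
    have h1 := hlab j hj h0
    rcases (hinX' j hj).1 hjX with h' | h'
    · exact h0 (by rw [h1.1, h.lab_eq_zero j hj h'])
    · rcases Finset.mem_insert.1 (hF h') with h2 | h2
      · exact h1.2.2 h2
      · exact h1.2.1 (mem_cls.1 h2).2
  · intro a ha b hb haX hbX hab ha0 _
    have h1 := hlab a ha ha0
    have h2 := h.closed a ha b hb (hX a ha haX) (hX b hb hbX) hab (h1.1 ▸ ha0) h1.2.1
    rw [hlab0 b hb (by rw [h2]; exact h1.2.1), h2, h1.1]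
  · exact fun c hc => (h.plex c hc).mono (hcls c hc)
  · simp [hempty]
  · exact fun j hj => (hlab_le j hj).trans (by omega)
  · exact fun j hj => (htou j hj).trans (by omega)
  · intro j hj
    have := htou j hj
    simp [hempty]
    omega
  · simp [hempty]

theorem Growing.finished (h : Growing s n H viol cur inX lab tou miss)
    (hc : cls n lab cur = ∅) (hno : ∀ j < n, ¬ (inX j = 0 ∧ lab j = 0)) :
    Finished n H inX lab := by
  refine ⟨fun j hj hX h0 => hno j hj ⟨hX, h0⟩, fun u hu v hv huX hvX huv => ?_⟩
  refine (h.closed u hu v hv huX hvX huv (fun h0 => hno u hu ⟨huX, h0⟩) fun hc' => ?_).symm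
  exact Finset.notMem_empty u (hc ▸ mem_cls.2 ⟨hu, hc'⟩)

end Growing

/-! ### The program for the greedy packing. -/

section Pack

/-- Choose the next vertex `6` (flag `7`): a neighbor of the current plex, or any unlabelled vertex
for a new one. -/
def selectP : Program :=
  .seq (find 8 6 7 (andE (andE (notE (rd 3 8)) (notE (rd 4 8))) (eqE (rd 5 8) (.reg 3))))
    (.cond (.reg 7) .skip (.seq (.assign 3 (.add (.reg 3) (.const 1)))
      (find 8 6 7 (andE (notE (rd 3 8)) (notE (rd 4 8))))))

/-- Let vertex `6` join the current plex and look for a vertex `10` that misses too many others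
(flag `11`). -/
def addP : Program :=
  .seq (take 8 9 2 6 (andE (eqE (rd 4 8) (.reg 3)) (notE (adjE 6 8))) (.add (rd 6 8) (.const 1)))
  (.seq (.write 6 (.reg 6) (.reg 9))
  (.seq (.write 4 (.reg 6) (.reg 3))
  (.seq (take 8 9 2 5 (adjE 6 8) (.reg 3))
    (find 8 10 11 (andE (eqE (rd 4 8) (.reg 3)) (notE (.sub (.reg 0) (rd 6 8))))))))

/-- Move a small bad set to array `3` and dissolve the current plex. -/
def extractP : Program :=
  .seq (.assign 12 (.const 1))
  (.seq (.assign 13 (.add (.add (.reg 0) (.reg 0)) (.const 2)))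
  (.seq (.write 3 (.reg 6) (.const 1))
  (.seq (.write 3 (.reg 10) (.const 1))
  (.seq (take 8 9 12 3 (andE (eqE (rd 4 8) (.reg 3)) (adjE 6 8)) (.const 1))
  (.seq (take 8 9 0 3 (andE (eqE (rd 4 8) (.reg 3))
    (andE (notE (eqE (.reg 8) (.reg 10))) (notE (adjE 10 8)))) (.const 1))
  (.seq (take 8 9 13 3 (eqE (rd 4 8) (.reg 3)) (.const 1))
  (.seq (take 8 9 2 4 (eqE (rd 4 8) (.reg 3)) (.const 0))
  (.seq (.assign 3 (.add (.reg 3) (.const 1)))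
  (.seq (.assign 4 (.add (.reg 4) (.const 1)))
    (.cond (.sub (.reg 4) (.reg 1)) (.assign 5 (.const 0)) .skip))))))))))

/-- One step of the greedy packing. -/
def packStep : Program :=
  .seq selectP (.cond (.reg 7) (.seq addP (.cond (.reg 11) extractP .skip))
    (.assign 5 (.const 0)))

/-- Greedily pack small bad sets. -/
def packP : Program :=
  .seq (.assign 3 (.const 1)) (.seq (.assign 5 (.const 1)) (.loop (.reg 5) packStep))

variable {s k n : ℕ} {H : SimpleGraph ℕ} {σ : State}

/-- Registers `3` and `4` hold `cur` and `viol`; arrays `3` to `6` hold `inX`, `lab`, `tou` and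
`miss`. If both searches fail, every vertex outside `X` has a label and the clusters are complete.
-/
theorem selectP_spec {viol : ℕ} (hb : Base s k n H σ)
    (hg : Growing s n H viol (σ.reg 3) (σ.arr 3) (σ.arr 4) (σ.arr 5) (σ.arr 6)) :
    Tr selectP σ (300 * (n + 1)) fun τ => Frame [3, 6, 7, 8] [] σ τ ∧
      Growing s n H viol (τ.reg 3) (σ.arr 3) (σ.arr 4) (σ.arr 5) (σ.arr 6) ∧
      (τ.reg 7 = 1 ∧ τ.reg 6 < n ∧ σ.arr 3 (τ.reg 6) = 0 ∧ σ.arr 4 (τ.reg 6) = 0 ∧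
        (σ.arr 5 (τ.reg 6) = τ.reg 3 ∨ cls n (σ.arr 4) (τ.reg 3) = ∅) ∨
      τ.reg 7 = 0 ∧ Finished n H (σ.arr 3) (σ.arr 4)) := by
  refine Tr.mono (T₁ := 100 * (n + 1) + (2 + (4 + 100 * (n + 1))))
    (Tr.seq' (find_spec (n := n)
      (fun j => σ.arr 3 j = 0 ∧ σ.arr 4 j = 0 ∧ σ.arr 5 j = σ.reg 3) hb.reg_two (by decide)
      (by decide) ?_) ?_) (by omega) (fun _ h => h)
  · intro j hj τ hf hi
    simp [hi, hf.reg, hf.arr, and_assoc]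
  · rintro τ ⟨hf, h⟩
    refine Tr.cond (fun h7 => ?_) fun h7 => ?_
    · refine (Tr.skip ?_).mono (by omega) (fun _ h => h)
      have h3 : τ.reg 3 = σ.reg 3 := hf.reg 3 (by decide)
      refine ⟨hf.mono (by decide) (by decide), by rw [h3]; exact hg, Or.inl ?_⟩
      rcases h with ⟨h1, h2, h4, h5, h6⟩ | ⟨h1, -⟩
      · exact ⟨h1, h2, h4, h5, Or.inl (h6.trans h3.symm)⟩
      · exact absurd h1 h7
    · have hno := (h.resolve_left fun h => by simp [h.1] at h7).2
      refine Tr.seq (Tr.assign (e := .add (.reg 3) (.const 1)) ?_)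
      have h3 : τ.reg 3 = σ.reg 3 := hf.reg 3 (by decide)
      refine (find_spec (n := n) (fun j => σ.arr 3 j = 0 ∧ σ.arr 4 j = 0) ?_ (by decide)
        (by decide) ?_).mono (le_refl _) ?_
      · simp [hf.reg, hb.reg_two]
      · intro j hj υ hf' hi
        simp [hi, hf'.arr, hf.arr]
      · rintro υ ⟨hf', h'⟩
        have h3' : υ.reg 3 = σ.reg 3 + 1 := by simp [hf'.reg, h3]
        have hn := hg.next hno
        refine ⟨?_, by rw [h3']; exact hn.1, ?_⟩
        · refine (hf.mono (by decide) (by decide)).trans (Frame.trans ?_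
            (hf'.mono (by decide) (by decide)))
          exact Frame.setReg (Frame.refl _ _ _) (by decide)
        · rw [h3']
          rcases h' with ⟨h1, h2, h4, h5⟩ | ⟨h1, h2⟩
          · exact Or.inl ⟨h1, h2, h4, h5, Or.inr hn.2⟩
          · exact Or.inr ⟨h1, hn.1.finished hn.2 h2⟩

/-- The misses are counted before the new vertex receives its label, so a previously unlabelled
vertex is not counted as missing itself. -/
theorem addP_spec (hb : Base s k n H σ) (hx : σ.reg 6 < n) :
    Tr addP σ (320 * (n + 1)) fun τ => Frame [8, 9, 10, 11] [4, 5, 6] σ τ ∧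
      τ.arr 4 = Function.update (σ.arr 4) (σ.reg 6) (σ.reg 3) ∧
      τ.arr 5 = touAdd n H (σ.reg 3) (σ.reg 6) (σ.arr 5) ∧
      τ.arr 6 = missAdd n H (σ.reg 3) (σ.reg 6) (σ.arr 4) (σ.arr 6) ∧
      (τ.reg 11 = 1 ∧ τ.reg 10 < n ∧ τ.arr 4 (τ.reg 10) = σ.reg 3 ∧ s ≤ τ.arr 6 (τ.reg 10) ∨
      τ.reg 11 = 0 ∧ ∀ j < n, τ.arr 4 j = σ.reg 3 → τ.arr 6 j < s) := by
  classical
  refine Tr.mono (T₁ := 100 * (n + 1) + (3 + (3 + (100 * (n + 1) + 100 * (n + 1)))))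
    (Tr.seq' (take_all_spec (n := n) (fun j => σ.arr 4 j = σ.reg 3 ∧ ¬ H.Adj (σ.reg 6) j)
      (fun j => σ.arr 6 j + 1) hb.reg_two (by decide) (by decide) ?_) ?_)
    (by omega) (fun _ h => h)
  · intro j hj τ hf hi ha
    simp [hi, hf.reg, hf.arr, ha j le_rfl, hb.adj_zero hx hj]
  rintro τ₁ ⟨hf₁, hc₁, ha₁⟩
  refine Tr.seq (Tr.write (i := .reg 6) (e := .reg 9) (Tr.seq
    (Tr.write (i := .reg 6) (e := .reg 3) ?_)))
  set τ₂ := (τ₁.setArr 6 (Expr.eval τ₁ (.reg 6)) (Expr.eval τ₁ (.reg 9))).setArr 4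
    (Expr.eval (τ₁.setArr 6 (Expr.eval τ₁ (.reg 6)) (Expr.eval τ₁ (.reg 9))) (.reg 6))
    (Expr.eval (τ₁.setArr 6 (Expr.eval τ₁ (.reg 6)) (Expr.eval τ₁ (.reg 9))) (.reg 3)) with hτ₂
  have hf₂ : Frame [9, 8] [4, 6] σ τ₂ := by
    refine ⟨fun x hx => by simp [hτ₂, hf₁.reg x hx], fun a ha => ?_⟩
    simp only [List.mem_cons, List.not_mem_nil, or_false, not_or] at ha
    simp [hτ₂, ha, hf₁.arr]
  have h4 : τ₂.arr 4 = Function.update (σ.arr 4) (σ.reg 6) (σ.reg 3) := by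
    simp [hτ₂, hf₁.reg, hf₁.arr]
  have h6 : τ₂.arr 6 = missAdd n H (σ.reg 3) (σ.reg 6) (σ.arr 4) (σ.arr 6) := by
    simp only [hτ₂, setArr_arr, setArr_reg, eval_reg, hf₁.reg 6 (by decide), hc₁, ha₁, missAdd]
    simp
  clear_value τ₂
  refine Tr.seq' (take_all_spec (n := n) (fun j => H.Adj (σ.reg 6) j)
    (fun _ => σ.reg 3) (by rw [hf₂.reg 2 (by decide), hb.reg_two]) (by decide) (by decide) ?_) ?_
  · intro j hj τ hf hi ha
    simp [hi, hf.reg, hf.arr, hf₂.reg, hf₂.arr, hb.adj_zero hx hj]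
  rintro τ₃ ⟨hf₃, -, ha₃⟩
  refine (find_spec (n := n) (fun j => τ₃.arr 4 j = σ.reg 3 ∧ s ≤ τ₃.arr 6 j)
    (by rw [hf₃.reg 2 (by decide), hf₂.reg 2 (by decide), hb.reg_two]) (by decide)
      (by decide) ?_).mono le_rfl ?_
  · intro j hj τ hf hi
    have h0 : τ₃.reg 0 = s := by
      rw [hf₃.reg 0 (by decide), hf₂.reg 0 (by decide), hb.reg_zero]
    have h3 : τ₃.reg 3 = σ.reg 3 := by
      rw [hf₃.reg 3 (by decide), hf₂.reg 3 (by decide)]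
    simp [hi, hf.reg, hf.arr, h0, h3, Nat.sub_eq_zero_iff_le]
  rintro τ₄ ⟨hf₄, h⟩
  refine ⟨?_, ?_, ?_, ?_, ?_⟩
  · exact (hf₂.mono (by decide) (by decide)).trans ((hf₃.mono (by decide) (by decide)).trans
      (hf₄.mono (by decide) (by decide)))
  · rw [hf₄.arr 4 (by decide), hf₃.arr 4 (by decide), h4]
  · rw [hf₄.arr 5 (by decide), ha₃, hf₂.arr 5 (by decide)]
    rfl
  · rw [hf₄.arr 6 (by decide), hf₃.arr 6 (by decide), h6]
  · rw [hf₄.arr 4 (by decide), hf₄.arr 6 (by decide)]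
    rcases h with ⟨h1, h2, h5, h6⟩ | ⟨h1, h2⟩
    · exact Or.inl ⟨h1, h2, h5, h6⟩
    · exact Or.inr ⟨h1, fun j hj hl => Nat.lt_of_not_le fun hs => h2 j hj ⟨hl, hs⟩⟩

/-- Three selections make up `F` besides `x` and `u`: `W₁` is one neighbor of `x`, which attaches
`x`; `W₂` has up to `s` vertices missed by `u`, which preserve the violation; `W₃` has up to `2s +
2` vertices, which secure connectivity or exhaust the class. Here the class already includes `x`. -/
theorem extractP_spec (hb : Base s k n H σ) (hx : σ.reg 6 < n) (hu : σ.reg 10 < n)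
    (hxl : σ.arr 4 (σ.reg 6) = σ.reg 3) (hul : σ.arr 4 (σ.reg 10) = σ.reg 3) :
    Tr extractP σ (450 * (n + 1)) fun τ => Frame [3, 4, 5, 8, 9, 12, 13] [3, 4] σ τ ∧
      τ.reg 3 = σ.reg 3 + 1 ∧ τ.reg 4 = σ.reg 4 + 1 ∧
      τ.reg 5 = (if k < σ.reg 4 + 1 then 0 else σ.reg 5) ∧
      (∀ j < n, τ.arr 4 j = if σ.arr 4 j = σ.reg 3 then 0 else σ.arr 4 j) ∧
      ∃ F ⊆ cls n (σ.arr 4) (σ.reg 3), σ.reg 6 ∈ F ∧ σ.reg 10 ∈ F ∧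
        ((∃ p ∈ cls n (σ.arr 4) (σ.reg 3), H.Adj (σ.reg 6) p) → ∃ p ∈ F, H.Adj (σ.reg 6) p) ∧
        min s (missed H (cls n (σ.arr 4) (σ.reg 3)) (σ.reg 10)).card ≤
          (missed H F (σ.reg 10)).card ∧
        (F = cls n (σ.arr 4) (σ.reg 3) ∨ 2 * s + 2 ≤ F.card) ∧ F.card ≤ 3 * s + 5 ∧
        ∀ j < n, τ.arr 3 j ≠ 0 ↔ σ.arr 3 j ≠ 0 ∨ j ∈ F := by
  classical
  refine Tr.mono (T₁ := 2 + (6 + (3 + (3 + (100 * (n + 1) + (100 * (n + 1) + (100 * (n + 1) +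
      (100 * (n + 1) + (4 + (4 + (4 + 2)))))))))))
    (Tr.seq (Tr.assign (Tr.seq (Tr.assign (Tr.seq (Tr.write (Tr.seq (Tr.write ?_))))))))
    (by omega) (fun _ h => h)
  set τ₀ := State.setArr _ _ _ _ with hτ₀
  have hf₀ : Frame [12, 13] [3] σ τ₀ := by
    refine ⟨fun x hx => ?_, fun a ha => ?_⟩
    · simp only [List.mem_cons, List.not_mem_nil, or_false, not_or] at hx
      simp [hτ₀, hx]
    · simp only [List.mem_cons, List.not_mem_nil, or_false] at ha
      simp [hτ₀, ha]
  have h12 : τ₀.reg 12 = 1 := by simp [hτ₀]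
  have h13 : τ₀.reg 13 = 2 * s + 2 := by simp [hτ₀, hb.reg_zero]; omega
  have h3 : ∀ j, τ₀.arr 3 j = if j = σ.reg 10 ∨ j = σ.reg 6 then 1 else σ.arr 3 j := by
    intro j
    simp only [hτ₀, setArr_arr, setArr_reg, setReg_reg, setReg_arr, eval_reg, eval_const]
    simp [Function.update_apply]
    split_ifs <;> simp_all
  clear_value τ₀
  have hb₀ : Base s k n H τ₀ := hb.frame hf₀ (by decide) (by decide)
  refine Tr.seq' (take_spec (n := n) (M := 1) (fun j => σ.arr 4 j = σ.reg 3 ∧ H.Adj (σ.reg 6) j)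
    (fun _ => 1) hb₀.reg_two h12 (by decide) (by decide) ?_) ?_
  · intro j hj τ hf hi ha
    simp [hi, hf.reg, hf.arr, hf₀.reg, hf₀.arr, hb.adj_zero hx hj]
  rintro τ₁ ⟨hf₁, W₁, hW₁, hc₁, -, ha₁⟩
  have hb₁ : Base s k n H τ₁ := hb₀.frame hf₁ (by decide) (by decide)
  refine Tr.seq' (take_spec (n := n) (M := s)
    (fun j => σ.arr 4 j = σ.reg 3 ∧ j ≠ σ.reg 10 ∧ ¬ H.Adj (σ.reg 10) j)
    (fun _ => 1) hb₁.reg_two hb₁.reg_zero (by decide) (by decide) ?_) ?_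
  · intro j hj τ hf hi ha
    simp [hi, hf.reg, hf.arr, hf₁.reg, hf₁.arr, hf₀.reg, hf₀.arr, hb.adj_zero hu hj]
  rintro τ₂ ⟨hf₂, W₂, hW₂, hc₂, -, ha₂⟩
  have hb₂ : Base s k n H τ₂ := hb₁.frame hf₂ (by decide) (by decide)
  refine Tr.seq' (take_spec (n := n) (M := 2 * s + 2) (fun j => σ.arr 4 j = σ.reg 3)
    (fun _ => 1) hb₂.reg_two (by rw [hf₂.reg 13 (by decide), hf₁.reg 13 (by decide), h13])
      (by decide) (by decide) ?_) ?_
  · intro j hj τ hf hi ha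
    simp [hi, hf.reg, hf.arr, hf₂.reg, hf₂.arr, hf₁.reg, hf₁.arr, hf₀.reg, hf₀.arr]
  rintro τ₃ ⟨hf₃, W₃, hW₃, hc₃, -, ha₃⟩
  have hb₃ : Base s k n H τ₃ := hb₂.frame hf₃ (by decide) (by decide)
  refine Tr.seq' (take_all_spec (n := n) (fun j => σ.arr 4 j = σ.reg 3)
    (fun _ => 0) hb₃.reg_two (by decide) (by decide) ?_) ?_
  · intro j hj τ hf hi ha
    simp [hi, hf.reg, ha j le_rfl, hf₃.reg, hf₃.arr, hf₂.reg, hf₂.arr, hf₁.reg, hf₁.arr,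
      hf₀.reg, hf₀.arr]
  rintro τ₄ ⟨hf₄, -, ha₄⟩
  have hb₄ : Base s k n H τ₄ := hb₃.frame hf₄ (by decide) (by decide)
  have hr3 : τ₄.reg 3 = σ.reg 3 := by
    rw [hf₄.reg 3 (by decide), hf₃.reg 3 (by decide), hf₂.reg 3 (by decide),
      hf₁.reg 3 (by decide), hf₀.reg 3 (by decide)]
  have hr4 : τ₄.reg 4 = σ.reg 4 := by
    rw [hf₄.reg 4 (by decide), hf₃.reg 4 (by decide), hf₂.reg 4 (by decide),
      hf₁.reg 4 (by decide), hf₀.reg 4 (by decide)]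
  have hr5 : τ₄.reg 5 = σ.reg 5 := by
    rw [hf₄.reg 5 (by decide), hf₃.reg 5 (by decide), hf₂.reg 5 (by decide),
      hf₁.reg 5 (by decide), hf₀.reg 5 (by decide)]
  have hf : Frame [3, 4, 5, 8, 9, 12, 13] [3, 4] σ τ₄ :=
    (hf₀.mono (by decide) (by decide)).trans ((hf₁.mono (by decide) (by decide)).trans
      ((hf₂.mono (by decide) (by decide)).trans ((hf₃.mono (by decide) (by decide)).trans
        (hf₄.mono (by decide) (by decide)))))
  have harr4 : ∀ j < n, τ₄.arr 4 j = if σ.arr 4 j = σ.reg 3 then 0 else σ.arr 4 j := by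
    intro j hj
    rw [ha₄, hf₃.arr 4 (by decide), hf₂.arr 4 (by decide), hf₁.arr 4 (by decide),
      hf₀.arr 4 (by decide)]
    simp [hj]
  set L := cls n (σ.arr 4) (σ.reg 3) with hL
  set F : Finset ℕ := insert (σ.reg 6) (insert (σ.reg 10) (W₁ ∪ W₂ ∪ W₃)) with hF
  have harr3 : ∀ j < n, τ₄.arr 3 j ≠ 0 ↔ σ.arr 3 j ≠ 0 ∨ j ∈ F := by
    intro j hj
    rw [hf₄.arr 3 (by decide), ha₃]
    simp only [ha₂, ha₁, h3, hF, Finset.mem_insert, Finset.mem_union]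
    by_cases e1 : j ∈ W₁ <;> by_cases e2 : j ∈ W₂ <;> by_cases e3 : j ∈ W₃ <;>
      by_cases e4 : j = σ.reg 6 <;> by_cases e5 : j = σ.reg 10 <;> simp [*]
  have hW₁' : ∀ j ∈ W₁, j ∈ L ∧ H.Adj (σ.reg 6) j := fun j hj => by
    have := Finset.mem_filter.1 (hW₁ hj)
    exact ⟨mem_cls.2 ⟨Finset.mem_range.1 this.1, this.2.1⟩, this.2.2⟩
  have hW₂' : W₂ ⊆ missed H L (σ.reg 10) := fun j hj => by
    have := Finset.mem_filter.1 (hW₂ hj)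
    exact mem_missed.2 ⟨mem_cls.2 ⟨Finset.mem_range.1 this.1, this.2.1⟩, this.2.2⟩
  have hFL : F ⊆ L := by
    intro j hj
    simp only [hF, Finset.mem_insert, Finset.mem_union] at hj
    rcases hj with rfl | rfl | (hj | hj) | hj
    · exact mem_cls.2 ⟨hx, hxl⟩
    · exact mem_cls.2 ⟨hu, hul⟩
    · exact (hW₁' j hj).1
    · exact (mem_missed.1 (hW₂' hj)).1
    · exact hW₃ hj
  have hpost : ∃ F ⊆ L, σ.reg 6 ∈ F ∧ σ.reg 10 ∈ F ∧
        ((∃ p ∈ L, H.Adj (σ.reg 6) p) → ∃ p ∈ F, H.Adj (σ.reg 6) p) ∧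
        min s (missed H L (σ.reg 10)).card ≤ (missed H F (σ.reg 10)).card ∧
        (F = L ∨ 2 * s + 2 ≤ F.card) ∧ F.card ≤ 3 * s + 5 ∧
        ∀ j < n, τ₄.arr 3 j ≠ 0 ↔ σ.arr 3 j ≠ 0 ∨ j ∈ F := by
    refine ⟨F, hFL, by simp [hF], by simp [hF], ?_, ?_, ?_, ?_, harr3⟩
    · rintro ⟨p, hp, hxp⟩
      have hp' := mem_cls.1 hp
      have hpos : 0 < ((Finset.range n).filter
          fun j => σ.arr 4 j = σ.reg 3 ∧ H.Adj (σ.reg 6) j).card :=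
        Finset.card_pos.2 ⟨p, Finset.mem_filter.2 ⟨Finset.mem_range.2 hp'.1, hp'.2, hxp⟩⟩
      obtain ⟨q, hq⟩ : W₁.Nonempty := Finset.card_pos.1 (by omega)
      exact ⟨q, by simp [hF, hq], (hW₁' q hq).2⟩
    · have h1 : missed H L (σ.reg 10) ⊆ (Finset.range n).filter
          fun j => σ.arr 4 j = σ.reg 3 ∧ j ≠ σ.reg 10 ∧ ¬ H.Adj (σ.reg 10) j := by
        intro j hj
        have hj' := mem_missed.1 hj
        have hj'' := mem_cls.1 hj'.1
        exact Finset.mem_filter.2 ⟨Finset.mem_range.2 hj''.1, hj''.2, hj'.2⟩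
      have h2 : W₂ ⊆ missed H F (σ.reg 10) := by
        intro j hj
        exact mem_missed.2 ⟨by simp [hF, hj], (mem_missed.1 (hW₂' hj)).2⟩
      have h1' := Finset.card_le_card h1
      have h2' := Finset.card_le_card h2
      omega
    · have hLW : W₃ ⊆ L := hW₃
      have hWF : W₃ ⊆ F := fun j hj => by simp [hF, hj]
      rcases Nat.lt_or_ge L.card (2 * s + 2) with hlt | hge
      · left
        refine Finset.Subset.antisymm hFL ?_
        have : W₃ = L := Finset.eq_of_subset_of_card_le hLW (by
          rw [hc₃]; change L.card ≤ min _ L.card; omega)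
        rw [← this]; exact hWF
      · right
        have := Finset.card_le_card hWF
        have h' : W₃.card = min (2 * s + 2) L.card := hc₃
        omega
    -- The two named vertices, one neighbor, `s` missed vertices and `2s + 2` others add up to `3s +
    -- 5`.
    · have e1 := Finset.card_insert_le (σ.reg 6) (insert (σ.reg 10) (W₁ ∪ W₂ ∪ W₃))
      have e2 := Finset.card_insert_le (σ.reg 10) (W₁ ∪ W₂ ∪ W₃)
      have e3 := Finset.card_union_le (W₁ ∪ W₂) W₃
      have e4 := Finset.card_union_le W₁ W₂
      rw [hF]
      omega
  refine Tr.seq (Tr.assign (Tr.seq (Tr.assign (Tr.cond (T := 2) (fun hc => Tr.assign ?_)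
    fun hc => (Tr.skip ?_).mono (by omega) (fun _ h => h)))))
  · have hk : k < σ.reg 4 + 1 := by
      simp [hr4, hb₄.reg_one] at hc; omega
    refine ⟨Frame.setReg (Frame.setReg (Frame.setReg hf (by decide)) (by decide)) (by decide),
      by simp [hr3], by simp [hr4], by simp [hk], by simpa using harr4, by simpa using hpost⟩
  · have hk : ¬ k < σ.reg 4 + 1 := by
      simp [hr4, hb₄.reg_one] at hc; omega
    refine ⟨Frame.setReg (Frame.setReg hf (by decide)) (by decide),
      by simp [hr3], by simp [hr4], by simp [hk, hr5], by simpa using harr4, by simpa using hpost⟩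

/-- The vertices below `n` that neither are in a packed set nor have a label. -/
def unlabelled (n : ℕ) (inX lab : ℕ → ℕ) : Finset ℕ :=
  (Finset.range n).filter fun j => inX j = 0 ∧ lab j = 0

theorem card_unlabelled_le (n : ℕ) (inX lab : ℕ → ℕ) : (unlabelled n inX lab).card ≤ n :=
  (Finset.card_filter_le _ _).trans (Finset.card_range n).le

theorem card_unlabelled_update_lt {n x c : ℕ} {inX lab : ℕ → ℕ} (hx : x < n) (hxX : inX x = 0)
    (hxl : lab x = 0) (hc : c ≠ 0) :
    (unlabelled n inX (Function.update lab x c)).card < (unlabelled n inX lab).card := by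
  refine Finset.card_lt_card (Finset.ssubset_iff_of_subset ?_ |>.2 ⟨x, ?_, ?_⟩)
  · intro j hj
    simp only [unlabelled, Finset.mem_filter, Function.update_apply] at hj ⊢
    split_ifs at hj with h
    · exact absurd hj.2.2 hc
    · exact hj
  · simp [unlabelled, hx, hxX, hxl]
  · simp [unlabelled, hc]

/-- The invariant of the main loop of the greedy packing. -/
structure PackInv (s k n : ℕ) (H : SimpleGraph ℕ) (σ : State) : Prop where
  base : Base s k n H σ
  growing : Growing s n H (σ.reg 4) (σ.reg 3) (σ.arr 3) (σ.arr 4) (σ.arr 5) (σ.arr 6)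
  go_le : σ.reg 5 ≤ 1
  viol_le : σ.reg 5 = 1 → σ.reg 4 ≤ k
  of_halted : σ.reg 5 = 0 → σ.reg 4 = k + 1 ∨ σ.reg 4 ≤ k ∧ Finished n H (σ.arr 3) (σ.arr 4)

/-- The measure of the main loop of the greedy packing. -/
def packMeasure (k n : ℕ) (σ : State) : ℕ :=
  (k + 1 - σ.reg 4) * (n + 1) + (unlabelled n (σ.arr 3) (σ.arr 4)).card + σ.reg 5

/-- Labelling a vertex lowers the number of unlabelled ones. An extraction may unlabel up to `n`
vertices but raises `viol`, which is worth `n + 1` in the measure. Halting clears the flag. So there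
are `O(kn)` steps of cost `O(n)`. -/
theorem packStep_spec (hs : 1 ≤ s) (h : PackInv s k n H σ) (hgo : σ.reg 5 ≠ 0) :
    Tr packStep σ (1100 * (n + 1)) fun τ =>
      PackInv s k n H τ ∧ packMeasure k n τ < packMeasure k n σ := by
  have hgo1 : σ.reg 5 = 1 := by have := h.go_le; omega
  have hv := h.viol_le hgo1
  refine Tr.mono (T₁ := 300 * (n + 1) + (2 + (320 * (n + 1) + (2 + 450 * (n + 1)))))
    (Tr.seq' (selectP_spec h.base h.growing) ?_) (by omega) (fun _ h => h)
  rintro τ ⟨hf, hg, hsel⟩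
  have hb : Base s k n H τ := h.base.frame hf (by decide) (by decide)
  have h4 : τ.reg 4 = σ.reg 4 := hf.reg 4 (by decide)
  have h5 : τ.reg 5 = σ.reg 5 := hf.reg 5 (by decide)
  have ha : τ.arr = σ.arr := funext fun a => hf.arr a (by simp)
  refine Tr.cond (fun h7 => ?_) fun h7 => ?_
  · obtain ⟨-, hx, hxX, hxl, hxt⟩ := hsel.resolve_right fun h => h7 h.1
    rw [← ha] at hg hxX hxl hxt
    refine Tr.seq' (addP_spec hb hx) ?_
    rintro υ ⟨hf', e4, e5, e6, hbad⟩
    have hb' : Base s k n H υ := hb.frame hf' (by decide) (by decide)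
    have g3 : υ.reg 3 = τ.reg 3 := hf'.reg 3 (by decide)
    have g4 : υ.reg 4 = σ.reg 4 := (hf'.reg 4 (by decide)).trans h4
    have g5 : υ.reg 5 = σ.reg 5 := (hf'.reg 5 (by decide)).trans h5
    have g6 : υ.reg 6 = τ.reg 6 := hf'.reg 6 (by decide)
    have a3 : υ.arr 3 = τ.arr 3 := hf'.arr 3 (by decide)
    refine Tr.cond (fun h11 => ?_) fun h11 => ?_
    · obtain ⟨-, hu, hul, hum⟩ := hbad.resolve_right fun h => h11 h.1
      have hcls : cls n (υ.arr 4) (υ.reg 3) =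
          insert (τ.reg 6) (cls n (τ.arr 4) (τ.reg 3)) := by
        rw [e4, g3]; exact Growing.cls_update hx
      refine (extractP_spec hb' (by rw [g6]; exact hx) hu (by rw [e4, g6, g3]; simp)
        (by rw [hul, g3])).mono le_rfl ?_
      rintro ω ⟨hf'', k3, k4, k5, klab, F, hFL, hxF, huF, hpF, hmF, hcF, hFc, hinX⟩
      rw [hcls] at hFL hpF hmF hcF
      rw [g6] at hxF hpF
      have hb'' : Base s k n H ω := hb'.frame hf'' (by decide) (by decide)
      have k5' : ω.arr 5 = υ.arr 5 := hf''.arr 5 (by decide)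
      have k6' : ω.arr 6 = υ.arr 6 := hf''.arr 6 (by decide)
      have hgrow := hg.extract hs hx hxX hxl hxt (u := υ.reg 10)
        (by rw [← hcls]; exact mem_cls.2 ⟨hu, by rw [hul, g3]⟩)
        (by rw [← e6]; exact hum) hFL hxF huF
        (fun ⟨p, hp, hxp⟩ => hpF ⟨p, Finset.mem_insert_of_mem hp, hxp⟩) hmF hcF hFc
        (inX' := ω.arr 3) (lab' := ω.arr 4)
        (fun j hj => by rw [hinX j hj, a3]) (fun j hj => by rw [klab j hj, e4, g3])
      refine ⟨⟨hb'', ?_, ?_, ?_, ?_⟩, ?_⟩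
      · rw [k3, k4, k5', k6', e5, e6, g3, g4]
        exact hgrow
      · rw [k5, g5, g4]; split_ifs <;> omega
      · rw [k5, k4, g4]
        intro h1
        split_ifs at h1
        omega
      · rw [k5, k4, g4, g5]
        intro h0
        left
        split_ifs at h0 <;> omega
      · have h1 := card_unlabelled_le n (ω.arr 3) (ω.arr 4)
        have h2 : k + 1 - σ.reg 4 = (k + 1 - ω.reg 4) + 1 := by rw [k4, g4]; omega
        have h3 : ω.reg 5 ≤ σ.reg 5 := by rw [k5, g5]; split_ifs <;> omega
        unfold packMeasure
        rw [h2, Nat.succ_mul]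
        omega
    · obtain ⟨-, hok⟩ := hbad.resolve_left fun h => by simp [h.1] at h11
      refine (Tr.skip ?_).mono (by omega) (fun _ h => h)
      refine ⟨⟨hb', ?_, by rw [g5]; exact h.go_le, by rw [g5, g4]; exact h.viol_le,
        fun h0 => by omega⟩, ?_⟩
      · rw [g4, g3, a3, e4, e5, e6]
        refine hg.add hx hxX hxl hxt ?_
        rw [← e4, ← e6]
        exact hok
      · have := card_unlabelled_update_lt (c := τ.reg 3) hx hxX hxl hg.cur_pos
        unfold packMeasure
        rw [g4, g5, a3, e4, ← ha]
        omega
  · obtain ⟨-, hfin⟩ := hsel.resolve_left fun h => by simp [h.1] at h7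
    refine (Tr.assign (x := 5) (e := .const 0) ?_).mono (T₁ := 2) (by omega) (fun _ h => h)
    refine ⟨⟨hb.frame (Frame.setReg (R := [5]) (A := []) (Frame.refl _ _ _) (by decide))
      (by decide) (by decide), ?_, by simp, by simp, ?_⟩, ?_⟩
    · simpa [h4, ha] using hg
    · refine fun _ => Or.inr ⟨?_, ?_⟩
      · simpa [h4] using hv
      · simpa [ha] using hfin
    · simp [packMeasure, h4, ha]
      omega

theorem packP_spec (hs : 1 ≤ s) (hb : Base s k n H σ) (h4 : σ.reg 4 = 0)
    (ha : ∀ j < n, σ.arr 3 j = 0 ∧ σ.arr 4 j = 0 ∧ σ.arr 5 j = 0) :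
    Tr packP σ (1200 * ((k + 2) * (n + 1) * (n + 1))) fun τ =>
      Frame [3, 4, 5, 6, 7, 8, 9, 10, 11, 12, 13] [3, 4, 5, 6] σ τ ∧
      Packing (SmallBad s H) (τ.reg 4) (supp n (τ.arr 3)) ∧
      (∀ j < n, τ.arr 3 j ≠ 0 → τ.arr 4 j = 0) ∧ (∀ c ≠ 0, Plex s H (cls n (τ.arr 4) c)) ∧
      (τ.reg 4 = k + 1 ∨ τ.reg 4 ≤ k ∧ Finished n H (τ.arr 3) (τ.arr 4)) := by
  suffices key : Tr packP σ (2 + (2 + (((k + 1) * (n + 1) + n + 1) * (2 + 1100 * (n + 1)) + 2)))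
      fun τ => Packing (SmallBad s H) (τ.reg 4) (supp n (τ.arr 3)) ∧
        (∀ j < n, τ.arr 3 j ≠ 0 → τ.arr 4 j = 0) ∧ (∀ c ≠ 0, Plex s H (cls n (τ.arr 4) c)) ∧
        (τ.reg 4 = k + 1 ∨ τ.reg 4 ≤ k ∧ Finished n H (τ.arr 3) (τ.arr 4)) by
    refine key.frame.mono ?_ ?_
    · have : (k + 1) * (n + 1) + n + 1 = (k + 2) * (n + 1) := by ring
      rw [this]
      generalize hA : (k + 2) * (n + 1) = A
      have : 2 * 1 ≤ A := by rw [← hA]; exact Nat.mul_le_mul (by omega) (by omega)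
      nlinarith
    · rintro τ ⟨hf, hq⟩
      exact ⟨hf.mono (by decide) (by decide), hq⟩
  refine Tr.seq (Tr.assign (Tr.seq (Tr.assign ?_)))
  set τ₀ := (σ.setReg 3 _).setReg 5 _ with hτ₀
  have hf₀ : Frame [3, 5] [] σ τ₀ :=
    Frame.setReg (Frame.setReg (Frame.refl _ _ _) (by decide)) (by decide)
  have hb₀ := hb.frame hf₀ (by decide) (by decide)
  have hr3 : τ₀.reg 3 = 1 := by simp [hτ₀]
  have hr5 : τ₀.reg 5 = 1 := by simp [hτ₀]
  have hr4 : τ₀.reg 4 = 0 := by simp [hτ₀, h4]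
  have harr : τ₀.arr = σ.arr := rfl
  clear_value τ₀
  have hcls : ∀ c ≠ 0, cls n (σ.arr 4) c = ∅ := by
    intro c hc
    refine Finset.eq_empty_of_forall_notMem fun j hj => ?_
    have hj := mem_cls.1 hj
    exact hc (hj.2.symm.trans (ha j hj.1).2.1)
  have hinv : PackInv s k n H τ₀ := by
    refine ⟨hb₀, ?_, by omega, by omega, by omega⟩
    rw [hr3, hr4, harr]
    have hsupp : supp n (σ.arr 3) = ∅ := by
      refine Finset.eq_empty_of_forall_notMem fun j hj => ?_
      have hj := mem_supp.1 hj
      exact hj.2 (ha j hj.1).1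
    refine ⟨by rw [hsupp]; exact .zero, fun j hj _ => (ha j hj).2.1,
      fun u hu v _ _ _ _ h0 => absurd (ha u hu).2.1 h0, ?_, ?_, by omega, ?_, ?_, ?_, ?_⟩
    · intro c hc
      rw [hcls c hc]
      exact fun v hv => absurd hv (Finset.notMem_empty v)
    · rw [hcls 1 (by omega)]
      exact fun v hv => absurd hv (Finset.notMem_empty v)
    · exact fun j hj => by rw [(ha j hj).2.1]; omega
    · exact fun j hj => by rw [(ha j hj).2.2]; omega
    · intro j hj
      rw [(ha j hj).2.2, hcls 1 (by omega)]
      simp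
    · rw [hcls 1 (by omega)]
      exact fun v hv => absurd hv (Finset.notMem_empty v)
  refine (Tr.loop (b := .reg 5) (PackInv s k n H) (packMeasure k n) (1100 * (n + 1)) hinv fun τ hτ hgo =>
    packStep_spec hs hτ hgo).mono ?_ ?_
  · have h1 := card_unlabelled_le n (τ₀.arr 3) (τ₀.arr 4)
    have : packMeasure k n τ₀ ≤ (k + 1) * (n + 1) + n + 1 := by
      unfold packMeasure
      rw [hr4, hr5, Nat.sub_zero]
      omega
    exact Nat.add_le_add_right (Nat.mul_le_mul_right _ this) _
  · rintro τ ⟨hτ, h0⟩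
    exact ⟨hτ.growing.packing, hτ.growing.lab_eq_zero, hτ.growing.plex, hτ.of_halted h0⟩

end Pack

/-! ### Petals around the vertices of `X`, and the vertices they force. -/

section Tidying

/-- The vertices below `n` with stamp at least `t`. -/
def stamped (n : ℕ) (used : ℕ → ℕ) (t : ℕ) : Finset ℕ := (Finset.range n).filter (t ≤ used ·)

/-- The vertices below `n` at which `f` vanishes. -/
def zeros (n : ℕ) (f : ℕ → ℕ) : Finset ℕ := (Finset.range n).filter (f · = 0)

theorem mem_stamped {n : ℕ} {used : ℕ → ℕ} {t j : ℕ} : j ∈ stamped n used t ↔ j < n ∧ t ≤ used j := by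
  simp [stamped]

theorem mem_zeros {n : ℕ} {f : ℕ → ℕ} {j : ℕ} : j ∈ zeros n f ↔ j < n ∧ f j = 0 := by
  simp [zeros]

theorem Packing.imp {V : Type*} [DecidableEq V] {B B' : Finset V → Prop} {m : ℕ} {X : Finset V}
    (h : Packing B m X) (hB : ∀ F, B F → B' F) : Packing B' m X := by
  induction h with
  | zero => exact .zero
  | succ _ hF hd ih => exact .succ ih (hB _ hF) hd

/-- Every set of vertices of `A` on which the neighborhoods of `x` and `y` differ is small. -/
def Similar (s : ℕ) (H : SimpleGraph ℕ) (A : Finset ℕ) (x y : ℕ) : Prop :=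
  ∀ W ⊆ A, (∀ u ∈ W, u ≠ y ∧ (H.Adj x u ↔ ¬ H.Adj y u)) → W.card < 2 * s

theorem Similar.mono {s : ℕ} {H : SimpleGraph ℕ} {A A' : Finset ℕ} {x y : ℕ}
    (h : Similar s H A x y) (hA : A' ⊆ A) : Similar s H A' x y :=
  fun W hW => h W (hW.trans hA)

/-- The invariant of the greedy packing of petals around `x`. -/
structure PetalInv (s k n : ℕ) (H : SimpleGraph ℕ) (x : ℕ) (A : Finset ℕ) (y pc : ℕ)
    (used : ℕ → ℕ) : Prop where
  subset : stamped n used (x + 1) ⊆ A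
  packing : Packing (fun F => Bad s H (insert x F) ∧ F.card ≤ 2 * s + 1) pc
    (stamped n used (x + 1))
  pc_le : pc ≤ k + 1
  used_le : ∀ j < n, used j ≤ x + 1
  similar : pc ≤ k → ∀ y' < y, y' ∈ A \ stamped n used (x + 1) → H.Adj x y' →
    Similar s H (A \ stamped n used (x + 1)) x y'

variable {s k n x y pc : ℕ} {H : SimpleGraph ℕ} {A : Finset ℕ} {used : ℕ → ℕ}

theorem PetalInv.skip (h : PetalInv s k n H x A y pc used)
    (hy : pc ≤ k → y ∈ A \ stamped n used (x + 1) → H.Adj x y →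
      Similar s H (A \ stamped n used (x + 1)) x y) :
    PetalInv s k n H x A (y + 1) pc used := by
  refine ⟨h.subset, h.packing, h.pc_le, h.used_le, fun hpc y' hy' hA hadj => ?_⟩
  rcases Nat.lt_succ_iff_lt_or_eq.1 hy' with h' | rfl
  · exact h.similar hpc y' h' hA hadj
  · exact hy hpc hA hadj

/-- The petal is bad together with `x` by `bad_of_edge`. It uses up `y`, and the similarity found
for earlier vertices survives because the remaining set only shrinks. -/
theorem PetalInv.take (h : PetalInv s k n H x A y pc used) (hpc : pc ≤ k)
    (hyA : y ∈ A \ stamped n used (x + 1)) (hyn : y < n) (hxy : H.Adj x y) (hx : x ∉ A)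
    {W : Finset ℕ} (hWn : ∀ u ∈ W, u < n) (hW : W ⊆ A \ stamped n used (x + 1))
    (hW' : ∀ u ∈ W, u ≠ y ∧ (H.Adj x u ↔ ¬ H.Adj y u)) (hc : W.card = 2 * s)
    {used' : ℕ → ℕ} (hu : ∀ j, used' j = if j = y ∨ j ∈ W then x + 1 else used j) :
    PetalInv s k n H x A (y + 1) (pc + 1) used' := by
  have hst : stamped n used' (x + 1) = insert y W ∪ stamped n used (x + 1) := by
    ext j
    rw [Finset.mem_union, Finset.mem_insert, mem_stamped, mem_stamped, hu]
    split_ifs with hj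
    · refine ⟨fun _ => Or.inl hj, fun _ => ⟨?_, le_rfl⟩⟩
      rcases hj with rfl | hj
      · exact hyn
      · exact hWn j hj
    · exact ⟨fun h => Or.inr h, fun h => h.resolve_left hj⟩
  have hyW : y ∉ W := fun hy => (hW' y hy).1 rfl
  have hFA : insert y W ⊆ A \ stamped n used (x + 1) := Finset.insert_subset hyA hW
  refine ⟨?_, ?_, by omega, ?_, ?_⟩
  · rw [hst]
    exact Finset.union_subset (hFA.trans Finset.sdiff_subset) h.subset
  · rw [hst]
    refine h.packing.succ ⟨bad_of_edge hxy hc.ge fun u hu' => ⟨?_, hW' u hu'⟩, ?_⟩ ?_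
    · rintro rfl
      exact hx (Finset.mem_sdiff.1 (hW hu')).1
    · rw [Finset.card_insert_of_notMem hyW, hc]
    · exact Finset.disjoint_of_subset_left hFA Finset.sdiff_disjoint
  · intro j hj
    rw [hu]
    split_ifs
    · exact le_rfl
    · exact h.used_le j hj
  · intro hpc' y' hy' hA hadj
    have hsub : A \ stamped n used' (x + 1) ⊆ A \ stamped n used (x + 1) :=
      Finset.sdiff_subset_sdiff le_rfl (by rw [hst]; exact Finset.subset_union_right)
    have hne : y' ≠ y := by
      rintro rfl
      refine (Finset.mem_sdiff.1 hA).2 ?_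
      rw [hst]
      simp
    exact (h.similar hpc y' (by omega) (hsub hA) hadj).mono hsub

/-- The values of two expressions differ. -/
def neqE (a b : Expr) : Expr := .add (.sub a b) (.sub b a)

@[simp] theorem eval_neqE {a b : Expr} {σ : State} :
    (neqE a b).eval σ = 0 ↔ a.eval σ = b.eval σ := by
  simp [neqE, Expr.eval]; omega

/-- Vertex `8` is unused, and exactly one of the vertices `14`, `15` is a neighbor of it. -/
def petalE : Expr :=
  andE (andE (notE (rd 3 8)) (.sub (.reg 18) (rd 8 8)))
    (andE (neqE (.reg 8) (.reg 15)) (neqE (adjE 14 8) (adjE 15 8)))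

/-- Look for a petal around `14` through its neighbor `15`. -/
def petalP : Program :=
  .cond (andE (andE (notE (rd 3 15)) (.sub (.reg 18) (rd 8 15)))
      (andE (adjE 14 15) (notE (.sub (.reg 16) (.reg 1)))))
    (.seq (take 8 9 17 15 petalE (.const 1))
      (.cond (.sub (.reg 17) (.reg 9)) .skip
        (.seq (take 8 9 17 8 petalE (.reg 18))
        (.seq (.write 8 (.reg 15) (.reg 18)) (.assign 16 (.add (.reg 16) (.const 1)))))))
    .skip

/-- Pack petals around vertex `14`, put them into array `7`, and record in array `13` whether there
are more than `k`. -/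
def flowerP : Program :=
  .cond (rd 3 14)
    (.seq (.assign 16 (.const 0))
    (.seq (.assign 18 (.add (.reg 14) (.const 1)))
    (.seq (forN 15 2 petalP)
    (.seq (take 8 9 2 7 (notE (.sub (.reg 18) (rd 8 8))) (.const 1))
      (.write 13 (.reg 14) (.sub (.reg 16) (.reg 1)))))))
    .skip

/-- Pack petals around all vertices of array `3`. -/
def tidyP : Program :=
  .seq (.assign 17 (.add (.reg 0) (.reg 0))) (forN 14 2 flowerP)

variable {σ : State}

/-- A first pass, writing to a scratch array, only counts distinguishing vertices up to `2s`; a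
second one stamps them. A failed attempt thus uses up no vertices, and it proves that `x` and `y`
are similar. -/
theorem petalP_spec (hb : Base s k n H σ) (hx : σ.reg 14 < n) (hxX : σ.arr 3 (σ.reg 14) ≠ 0)
    (hy : σ.reg 15 < n) (h17 : σ.reg 17 = 2 * s) (h18 : σ.reg 18 = σ.reg 14 + 1)
    (hinv : PetalInv s k n H (σ.reg 14) (zeros n (σ.arr 3)) (σ.reg 15) (σ.reg 16) (σ.arr 8)) :
    Tr petalP σ (300 * (n + 1)) fun τ =>
      PetalInv s k n H (σ.reg 14) (zeros n (σ.arr 3)) (σ.reg 15 + 1) (τ.reg 16) (τ.arr 8) := by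
  classical
  set x := σ.reg 14 with hxdef
  set y := σ.reg 15 with hydef
  let P : ℕ → Prop := fun j => (σ.arr 3 j = 0 ∧ σ.arr 8 j < x + 1) ∧ j ≠ y ∧
    (H.Adj x j ↔ ¬ H.Adj y j)
  have hP : ∀ j, j < n → P j → j ∈ zeros n (σ.arr 3) \ stamped n (σ.arr 8) (x + 1) := by
    intro j hj hPj
    rw [Finset.mem_sdiff, mem_zeros, mem_stamped]
    exact ⟨⟨hj, hPj.1.1⟩, fun h => absurd hPj.1.2 (by omega)⟩
  have hadj : ∀ i j, i < n → j < n → σ.arr 0 (σ.arr 2 i + j) = if H.Adj i j then 1 else 0 :=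
    fun i j hi hj => hb.adj i hi j hj
  have hcond : Expr.eval σ (andE (andE (notE (rd 3 15)) (.sub (.reg 18) (rd 8 15)))
      (andE (adjE 14 15) (notE (.sub (.reg 16) (.reg 1))))) ≠ 0 ↔
      (y ∈ zeros n (σ.arr 3) \ stamped n (σ.arr 8) (x + 1) ∧ H.Adj x y ∧ σ.reg 16 ≤ k) := by
    rw [Finset.mem_sdiff, mem_zeros, mem_stamped]
    simp [← hxdef, ← hydef, h18, hadj x y hx hy, hb.reg_one, hy, Nat.sub_eq_zero_iff_le, and_assoc]
  refine Tr.mono (T₁ := 39 + 1 + (100 * (n + 1) + (3 + 1 + (100 * (n + 1) + (3 + 4)))))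
    (Tr.cond (fun hc => ?_) fun hc => ?_) (by omega) (fun _ h => h)
  · obtain ⟨hyA, hxy, hpc⟩ := hcond.1 hc
    have hev : ∀ τ R A, Frame R A σ τ → 3 ∉ A → 0 ∉ A → 2 ∉ A → 14 ∉ R → 15 ∉ R → 18 ∉ R →
        ∀ j < n, τ.reg 8 = j → τ.arr 8 j = σ.arr 8 j → (petalE.eval τ ≠ 0 ↔ P j) := by
      intro τ R A hf h3 h0 h2 g14 g15 g18 j hj hi h8
      have e1 : (if H.Adj x j then 1 else 0) = (if H.Adj y j then (1 : ℕ) else 0) ↔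
          ¬ (H.Adj x j ↔ ¬ H.Adj y j) := by
        by_cases e1 : H.Adj x j <;> by_cases e2 : H.Adj y j <;> simp [e1, e2]
      simp only [petalE, ne_eq, eval_andE, eval_notE, eval_rd, eval_sub, eval_reg, eval_neqE,
        eval_adjE, hi, h8, hf.arr 3 h3, hf.arr 0 h0, hf.arr 2 h2, hf.reg 14 g14,
        hf.reg 15 g15, hf.reg 18 g18, ← hxdef, ← hydef, hadj x j hx hj, hadj y j hy hj, h18, P, e1]
      simp only [not_not, Nat.sub_eq_zero_iff_le, not_le]
    refine Tr.seq' (take_spec (n := n) (M := 2 * s) P (fun _ => 1) hb.reg_two h17 (by decide)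
      (by decide) ?_) ?_
    · intro j hj τ hf hi ha
      exact ⟨hev τ _ _ hf (by decide) (by decide) (by decide) (by decide) (by decide)
        (by decide) j hj hi (by rw [hf.arr 8 (by decide)]), fun _ => rfl⟩
    rintro τ ⟨hf, W, hW, hWc, hc9, -⟩
    have hbτ := hb.frame hf (by decide) (by decide)
    have h17' : τ.reg 17 = 2 * s := (hf.reg 17 (by decide)).trans h17
    have ha8 : τ.arr 8 = σ.arr 8 := hf.arr 8 (by decide)
    have h16 : τ.reg 16 = σ.reg 16 := hf.reg 16 (by decide)
    refine Tr.cond (fun hne => ?_) fun hz => ?_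
    · refine (Tr.skip ?_).mono (by omega) (fun _ h => h)
      rw [ha8, h16]
      refine hinv.skip fun _ _ _ W' hW' hd => ?_
      have hsub : W' ⊆ (Finset.range n).filter P := by
        intro u hu
        have h1 := hW' hu
        rw [Finset.mem_sdiff, mem_zeros, mem_stamped] at h1
        exact Finset.mem_filter.2 ⟨Finset.mem_range.2 h1.1.1, ⟨h1.1.2, by
          by_contra hcon; exact h1.2 ⟨h1.1.1, by omega⟩⟩, hd u hu⟩
      have := Finset.card_le_card hsub
      simp only [eval_sub, eval_reg, h17', hc9, hWc] at hne
      omega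
    · refine Tr.seq' (take_spec (n := n) (M := 2 * s) P (fun _ => x + 1) hbτ.reg_two h17' (by decide)
        (by decide) ?_) ?_
      · intro j hj υ hf' hi ha
        refine ⟨hev υ _ _ (Frame.trans (hf.mono (R' := [9, 8]) (A' := [8, 15]) (by simp) (by simp))
          (hf'.mono (by simp) (by simp))) (by decide) (by decide) (by decide) (by decide)
          (by decide) (by decide) j hj hi (by rw [ha j le_rfl, ha8]), fun _ => ?_⟩
        simp [hf'.reg, hf.reg, h18]
      rintro υ ⟨hf', W', hW', hWc', -, ha'⟩
      refine Tr.seq (Tr.write (i := .reg 15) (e := .reg 18) (Tr.assign ?_))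
      have r16 : υ.reg 16 = σ.reg 16 := (hf'.reg 16 (by decide)).trans h16
      have r15 : υ.reg 15 = y := (hf'.reg 15 (by decide)).trans (hf.reg 15 (by decide))
      have r18 : υ.reg 18 = x + 1 :=
        ((hf'.reg 18 (by decide)).trans (hf.reg 18 (by decide))).trans h18
      have hWP : ∀ u ∈ W', u < n ∧ P u := fun u hu => by
        have := Finset.mem_filter.1 (hW' hu)
        exact ⟨Finset.mem_range.1 this.1, this.2⟩
      have hcard : W'.card = 2 * s := by
        simp only [eval_sub, eval_reg, h17', hc9, hWc] at hz
        omega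
      have hxA : x ∉ zeros n (σ.arr 3) := fun h => hxX (mem_zeros.1 h).2
      have := hinv.take hpc hyA hy hxy hxA (W := W') (fun u hu => (hWP u hu).1)
        (fun u hu => hP u (hWP u hu).1 (hWP u hu).2) (fun u hu => (hWP u hu).2.2) hcard
        (used' := Function.update (υ.arr 8) y (x + 1)) (by
          intro j
          rw [Function.update_apply, ha', ha8]
          by_cases e1 : j = y <;> by_cases e2 : j ∈ W' <;> simp [e1, e2])
      simpa [r16, r15, r18] using this
  · refine (Tr.skip ?_).mono (by omega) (fun _ h => h)
    exact hinv.skip fun h1 h2 h3 => absurd hc (hcond.2 ⟨h2, h3, h1⟩)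

/-- The effect of `flowerP` on a vertex of array `3`. -/
theorem flowerP_spec (hb : Base s k n H σ) (hx : σ.reg 14 < n) (hxX : σ.arr 3 (σ.reg 14) ≠ 0)
    (h17 : σ.reg 17 = 2 * s) (hused : ∀ j < n, σ.arr 8 j ≤ σ.reg 14) :
    Tr flowerP σ (500 * ((n + 1) * (n + 1))) fun τ =>
      (∀ j < n, τ.arr 8 j ≤ σ.reg 14 + 1) ∧
      ∃ P ⊆ zeros n (σ.arr 3), supp n (τ.arr 7) = supp n (σ.arr 7) ∪ P ∧
        P.card ≤ (k + 1) * (2 * s + 1) ∧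
        (∀ j, j ≠ σ.reg 14 → τ.arr 13 j = σ.arr 13 j) ∧
        (τ.arr 13 (σ.reg 14) ≠ 0 → ∃ m > k,
          Packing (fun F => Bad s H (insert (σ.reg 14) F)) m P) ∧
        (τ.arr 13 (σ.reg 14) = 0 → ∀ y ∈ zeros n (σ.arr 3) \ P, H.Adj (σ.reg 14) y →
          Similar s H (zeros n (σ.arr 3) \ P) (σ.reg 14) y) := by
  classical
  set x := σ.reg 14 with hxdef
  have hle : 2 + 1 + (2 + (4 + ((300 * (n + 1) + 8) * (n + 1) + (100 * (n + 1) + 5)))) ≤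
      500 * ((n + 1) * (n + 1)) := by nlinarith
  refine Tr.mono (Tr.cond (fun _ => ?_) fun hc => absurd hc hxX) hle (fun _ h => h)
  refine Tr.seq (Tr.assign (Tr.seq (Tr.assign ?_)))
  set τ₀ := (σ.setReg 16 _).setReg 18 _ with hτ₀
  have hf₀ : Frame [16, 18] [] σ τ₀ :=
    Frame.setReg (Frame.setReg (Frame.refl _ _ _) (by decide)) (by decide)
  have hb₀ : Base s k n H τ₀ := hb.frame hf₀ (by decide) (by decide)
  have h16 : τ₀.reg 16 = 0 := by simp [hτ₀]
  have h18 : τ₀.reg 18 = x + 1 := by simp [hτ₀, hxdef]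
  clear_value τ₀
  refine Tr.seq' (Tr.forN_const n
    (fun j τ => PetalInv s k n H x (zeros n (σ.arr 3)) j (τ.reg 16) (τ.arr 8)) (300 * (n + 1))
    hb₀.reg_two (by decide) (by decide) (by decide) ?_ ?_ ?_) ?_
  · intro j τ v h
    simpa using h
  -- Stamps left by earlier vertices are at most `x`. They count as unused, so no reset is needed,
  -- and petals around different vertices may overlap.
  · have he : stamped n (σ.arr 8) (x + 1) = ∅ := by
      refine Finset.eq_empty_of_forall_notMem fun j hj => ?_
      have hj := mem_stamped.1 hj
      have := hused j hj.1
      omega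
    rw [h16, hf₀.arr 8 (by decide)]
    refine ⟨by rw [he]; simp, by rw [he]; exact .zero, by omega, fun j hj => ?_, by simp⟩
    exact (hused j hj).trans (Nat.le_succ _)
  · intro j hj τ hf hji hI
    have hf' : Frame [15, 9, 8, 16, 18] [15, 8] σ τ :=
      (hf₀.mono (by decide) (by decide)).trans (hf.mono (by decide) (by decide))
    have h14 : τ.reg 14 = x := hf'.reg 14 (by decide)
    have h3 : τ.arr 3 = σ.arr 3 := hf'.arr 3 (by decide)
    refine (petalP_spec (hb.frame hf' (by decide) (by decide)) (by rw [h14]; exact hx)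
      (by rw [h14, h3]; exact hxX) (by rw [hji]; exact hj)
      ((hf'.reg 17 (by decide)).trans h17)
      (by rw [h14, hf.reg 18 (by decide), h18]) ?_).mono le_rfl ?_
    · rw [h14, h3, hji]; exact hI
    · intro υ hυ
      rwa [h14, h3, hji] at hυ
  rintro τ ⟨hf, hI⟩
  have hf' : Frame [15, 9, 8, 16, 18] [15, 8] σ τ :=
    (hf₀.mono (by decide) (by decide)).trans (hf.mono (by decide) (by decide))
  have hbτ : Base s k n H τ := hb.frame hf' (by decide) (by decide)
  have h18' : τ.reg 18 = x + 1 := (hf.reg 18 (by decide)).trans h18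
  refine Tr.seq' (take_all_spec (n := n) (fun j => x + 1 ≤ τ.arr 8 j) (fun _ => 1)
    hbτ.reg_two (by decide) (by decide) ?_) ?_
  · intro j hj υ hf'' hi ha
    simp [hi, hf''.arr, hf''.reg, h18', Nat.sub_eq_zero_iff_le]
  rintro υ ⟨hf'', -, ha7⟩
  refine Tr.write (i := .reg 14) (e := .sub (.reg 16) (.reg 1)) ?_
  have r14 : υ.reg 14 = x := (hf''.reg 14 (by decide)).trans (hf'.reg 14 (by decide))
  have r16 : υ.reg 16 = τ.reg 16 := hf''.reg 16 (by decide)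
  have r1 : υ.reg 1 = k := (hf''.reg 1 (by decide)).trans hbτ.reg_one
  have a8 : υ.arr 8 = τ.arr 8 := hf''.arr 8 (by decide)
  have a13 : υ.arr 13 = σ.arr 13 := (hf''.arr 13 (by decide)).trans (hf'.arr 13 (by decide))
  have a7 : τ.arr 7 = σ.arr 7 := hf'.arr 7 (by decide)
  refine ⟨by simpa [a8] using hI.used_le, stamped n (τ.arr 8) (x + 1), hI.subset, ?_, ?_, ?_, ?_, ?_⟩
  · ext j
    rw [Finset.mem_union, mem_supp, mem_supp, mem_stamped]
    simp only [setArr_arr, ha7, a7]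
    by_cases hj : j < n <;> by_cases ht : x + 1 ≤ τ.arr 8 j <;> simp [hj, ht]
  · refine (hI.packing.card_le fun F hF => hF.2).trans (Nat.mul_le_mul_right _ hI.pc_le)
  · intro j hj
    simp [r14, a13, hj]
  · simp only [setArr_arr, eval_reg, eval_sub, r14, r16, r1, if_true, Function.update_self]
    intro h
    exact ⟨τ.reg 16, by omega, hI.packing.imp fun F hF => hF.1⟩
  · simp only [setArr_arr, eval_reg, eval_sub, r14, r16, r1, if_true, Function.update_self]
    intro h y hy hxy
    exact hI.similar (by omega) y (mem_zeros.1 (Finset.mem_sdiff.1 hy).1).1 hy hxy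

/-- The state of the tidying after all vertices below `m` have been treated. -/
structure TidyInv (s k n : ℕ) (H : SimpleGraph ℕ) (X A : Finset ℕ) (m : ℕ)
    (T used fc : ℕ → ℕ) : Prop where
  used_le : ∀ j < n, used j ≤ m
  subset : supp n T ⊆ A
  card_le : (supp n T).card ≤ (X.filter (· < m)).card * ((k + 1) * (2 * s + 1))
  forced : ∀ x ∈ X, x < m → fc x ≠ 0 → ∃ P ⊆ supp n T, ∃ m > k,
    Packing (fun F => Bad s H (insert x F)) m P
  similar : ∀ x ∈ X, x < m → fc x = 0 → ∀ y ∈ A \ supp n T, H.Adj x y →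
    Similar s H (A \ supp n T) x y

/-- Only vertices of `X` pay `O(n²)`, the others `O(1)`, which yields the factor `|X| + 1`. Petals
found later enlarge `T` and so preserve the similarity established for earlier vertices. -/
theorem tidyP_spec (hb : Base s k n H σ) (ha : ∀ j < n, σ.arr 7 j = 0 ∧ σ.arr 8 j = 0) :
    Tr tidyP σ (600 * (((supp n (σ.arr 3)).card + 1) * ((n + 1) * (n + 1)))) fun τ =>
      Frame [8, 9, 14, 15, 16, 17, 18] [7, 8, 13, 15] σ τ ∧
      TidyInv s k n H (supp n (σ.arr 3)) (zeros n (σ.arr 3)) n (τ.arr 7) (τ.arr 8) (τ.arr 13) := by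
  classical
  set X := supp n (σ.arr 3) with hX
  suffices key : Tr tidyP σ (4 + (∑ j ∈ Finset.range n,
      (if j ∈ X then 500 * ((n + 1) * (n + 1)) else 10) + 8 * n + 6)) fun τ =>
      TidyInv s k n H X (zeros n (σ.arr 3)) n (τ.arr 7) (τ.arr 8) (τ.arr 13) by
    refine key.frame.mono ?_ ?_
    · have h1 : ∑ j ∈ Finset.range n, (if j ∈ X then 500 * ((n + 1) * (n + 1)) else 10) ≤
          X.card * (500 * ((n + 1) * (n + 1))) + n * 10 := by
        rw [Finset.sum_ite, Finset.sum_const, Finset.sum_const, smul_eq_mul, smul_eq_mul]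
        refine Nat.add_le_add (Nat.mul_le_mul_right _ (Finset.card_le_card fun j hj => ?_))
          (Nat.mul_le_mul_right _ ?_)
        · exact (Finset.mem_filter.1 hj).2
        · exact (Finset.card_filter_le _ _).trans (Finset.card_range n).le
      nlinarith [Nat.zero_le (X.card * ((n + 1) * (n + 1)))]
    · rintro τ ⟨hf, hq⟩
      exact ⟨hf.mono (by decide) (by decide), hq⟩
  refine Tr.seq (Tr.assign ?_)
  set τ₀ := σ.setReg 17 _ with hτ₀
  have hf₀ : Frame [17] [] σ τ₀ := Frame.setReg (Frame.refl _ _ _) (by decide)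
  have hb₀ : Base s k n H τ₀ := hb.frame hf₀ (by decide) (by decide)
  have h17 : τ₀.reg 17 = 2 * s := by simp [hτ₀, hb.reg_zero]; omega
  clear_value τ₀
  have harr : τ₀.arr = σ.arr := funext fun a => hf₀.arr a (by simp)
  refine (Tr.forN n
    (fun j τ => TidyInv s k n H X (zeros n (σ.arr 3)) j (τ.arr 7) (τ.arr 8) (τ.arr 13)) _
    hb₀.reg_two (by decide) (by decide) (by decide) ?_ ?_ ?_).mono le_rfl fun τ h => h.2
  · intro j τ v h
    simpa using h
  · have he : supp n (σ.arr 7) = ∅ := by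
      refine Finset.eq_empty_of_forall_notMem fun j hj => ?_
      have hj := mem_supp.1 hj
      exact hj.2 (ha j hj.1).1
    rw [harr]
    exact ⟨fun j hj => (ha j hj).2.le, by rw [he]; simp, by rw [he]; simp, by simp, by simp⟩
  · intro j hj τ hf hji hI
    have hf' : Frame [8, 9, 14, 15, 16, 17, 18] [7, 8, 13, 15] σ τ :=
      (hf₀.mono (by decide) (by decide)).trans (hf.mono (by decide) (by decide))
    have hbτ : Base s k n H τ := hb.frame hf' (by decide) (by decide)
    have h3 : τ.arr 3 = σ.arr 3 := hf'.arr 3 (by decide)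
    by_cases hjX : j ∈ X
    · rw [if_pos hjX]
      refine (flowerP_spec hbτ (by rw [hji]; exact hj)
        (by rw [hji, h3]; exact (mem_supp.1 hjX).2) ((hf.reg 17 (by decide)).trans h17)
        (by rw [hji]; exact hI.used_le)).mono le_rfl ?_
      rw [hji, h3]
      rintro υ ⟨hu, P, hPA, hsupp, hPc, hne, hforced, hsim⟩
      have hsub : supp n (τ.arr 7) ⊆ supp n (υ.arr 7) := by
        rw [hsupp]; exact Finset.subset_union_left
      have hsubP : P ⊆ supp n (υ.arr 7) := by
        rw [hsupp]; exact Finset.subset_union_right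
      have hsd : ∀ {S : Finset ℕ}, S ⊆ supp n (υ.arr 7) →
          zeros n (σ.arr 3) \ supp n (υ.arr 7) ⊆ zeros n (σ.arr 3) \ S :=
        fun h => Finset.sdiff_subset_sdiff le_rfl h
      refine ⟨hu, ?_, ?_, ?_, ?_⟩
      · rw [hsupp]; exact Finset.union_subset hI.subset hPA
      · have hfl : X.filter (· < j + 1) = insert j (X.filter (· < j)) := by
          ext l
          simp only [Finset.mem_filter, Finset.mem_insert]
          constructor
          · rintro ⟨h1, h2⟩
            rcases Nat.lt_succ_iff_lt_or_eq.1 h2 with h | h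
            · exact Or.inr ⟨h1, h⟩
            · exact Or.inl h
          · rintro (rfl | ⟨h1, h2⟩)
            · exact ⟨hjX, by omega⟩
            · exact ⟨h1, by omega⟩
        rw [hfl, Finset.card_insert_of_notMem (by simp), hsupp, Nat.succ_mul]
        exact (Finset.card_union_le _ _).trans (Nat.add_le_add hI.card_le hPc)
      · intro x hx hxj hxf
        by_cases hxj' : x = j
        · subst hxj'
          obtain ⟨m, hm, hp⟩ := hforced hxf
          exact ⟨P, hsubP, m, hm, hp⟩
        · rw [hne x hxj'] at hxf
          obtain ⟨Q, hQ, m, hm, hp⟩ := hI.forced x hx (by omega) hxf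
          exact ⟨Q, hQ.trans hsub, m, hm, hp⟩
      · intro x hx hxj hxf y hy hxy
        by_cases hxj' : x = j
        · subst hxj'
          exact (hsim hxf y (hsd hsubP hy) hxy).mono (hsd hsubP)
        · rw [hne x hxj'] at hxf
          exact (hI.similar x hx (by omega) hxf y (hsd hsub hy) hxy).mono (hsd hsub)
    · rw [if_neg hjX]
      have h0 : τ.arr 3 j = 0 := by
        rw [h3]
        by_contra hc
        exact hjX (mem_supp.2 ⟨hj, hc⟩)
      refine (Tr.cond (T := 1) (fun hc => absurd (by simpa [hji] using h0) hc)
        fun _ => Tr.skip ?_).mono (T₁ := 2 + 1 + 1) (by omega) (fun _ h => h)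
      have hlt : ∀ x ∈ X, x < j + 1 → x < j := fun x hx hxj =>
        lt_of_le_of_ne (by omega) fun e => hjX (e ▸ hx)
      refine ⟨fun l hl => (hI.used_le l hl).trans (by omega), hI.subset, ?_, ?_, ?_⟩
      · refine hI.card_le.trans (Nat.mul_le_mul_right _ (Finset.card_le_card ?_))
        intro l hl
        rw [Finset.mem_filter] at *
        exact ⟨hl.1, by omega⟩
      · exact fun x hx hxj => hI.forced x hx (hlt x hx hxj)
      · exact fun x hx hxj => hI.similar x hx (hlt x hx hxj)

end Tidying

/-! ### The program for quotas, spoiled and marked vertices, and filling up. -/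

section Keep

/-- Record in arrays `9`, `10` that vertex `20` touches the cluster of vertex `8`. -/
def touchP : Program :=
  .cond (andE (andE (notE (rd 3 8)) (notE (rd 7 8)))
      (andE (adjE 20 8) (neqE (.read 9 (rd 4 8)) (.reg 18))))
    (.seq (.write 9 (rd 4 8) (.reg 18)) (.write 10 (rd 4 8) (.add (.read 10 (rd 4 8)) (.reg 19))))
    .skip

/-- Raise the quotas of the clusters that vertex `20` touches, and put the vertices spoiled by it
into array `11`. -/
def spoilP : Program :=
  .cond (andE (rd 3 20) (notE (rd 13 20)))
    (.seq (.assign 18 (.add (.reg 20) (.const 1)))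
    (.seq (forN 8 2 touchP)
      (take 8 9 2 11 (andE (andE (notE (rd 3 8)) (notE (rd 7 8)))
        (andE (notE (adjE 20 8)) (eqE (.read 9 (rd 4 8)) (.reg 18)))) (.const 1))))
    .skip

/-- Keep the vertices in the cluster of vertex `21` that miss it, if it lies in array `7` or `11`;
in the first case, raise the quota of its cluster. -/
def markP : Program :=
  .seq (.cond (rd 7 21) (.write 10 (rd 4 21) (.add (.read 10 (rd 4 21)) (.reg 19))) .skip)
    (.cond (.add (rd 7 21) (rd 11 21))
      (take 8 9 2 12 (andE (notE (rd 3 8))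
        (andE (eqE (rd 4 8) (rd 4 21)) (notE (adjE 21 8)))) (.const 1)) .skip)

/-- Keep vertex `8` if the quota of its cluster allows it. -/
def fillP : Program :=
  .cond (andE (andE (notE (rd 3 8)) (notE (rd 12 8))) (.read 10 (rd 4 8)))
    (.seq (.write 10 (rd 4 8) (.sub (.read 10 (rd 4 8)) (.const 1))) (.write 12 (.reg 8) (.const 1)))
    .skip

/-- Put the vertices to be kept, except those of array `3`, into array `12`. -/
def keepP : Program :=
  .seq (.assign 19 (.add (.add (.reg 0) (.reg 0)) (.add (.reg 0) (.reg 0))))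
  (.seq (forN 20 2 spoilP) (.seq (forN 21 2 markP) (forN 8 2 fillP)))

variable {s k n : ℕ} {H : SimpleGraph ℕ} {σ : State}

-- Array `9` is indexed by clusters and stamped with `x + 1`. So each touched cluster has its quota
-- raised once, however many neighbors `x` has there, and the array needs no reset.
open scoped Classical in
theorem touchLoop_spec {x : ℕ} (hb : Base s k n H σ) (hx : σ.reg 20 = x) (hxn : x < n)
    (h18 : σ.reg 18 = x + 1) (h19 : σ.reg 19 = 4 * s) (hfl : ∀ c, σ.arr 9 c ≤ x) :
    Tr (forN 8 2 touchP) σ (80 * (n + 1)) fun τ => Frame [8] [9, 10] σ τ ∧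
      ∀ c, (τ.arr 9 c = x + 1 ↔ Touches H (zeros n (σ.arr 3) \ supp n (σ.arr 7)) (σ.arr 4) x c) ∧
        τ.arr 9 c ≤ x + 1 ∧ τ.arr 10 c = σ.arr 10 c +
          if Touches H (zeros n (σ.arr 3) \ supp n (σ.arr 7)) (σ.arr 4) x c then 4 * s else 0 := by
  obtain ⟨Q, hQdef⟩ : ∃ Q : ℕ → ℕ → Prop, ∀ j c, Q j c ↔ ∃ y < j,
      (σ.arr 3 y = 0 ∧ σ.arr 7 y = 0) ∧ σ.arr 4 y = c ∧ H.Adj x y := ⟨_, fun _ _ => Iff.rfl⟩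
  have hQ : ∀ c, Q n c ↔ Touches H (zeros n (σ.arr 3) \ supp n (σ.arr 7)) (σ.arr 4) x c := by
    intro c
    rw [hQdef]
    constructor
    · rintro ⟨y, hy, h1, h2⟩
      exact ⟨y, Finset.mem_sdiff.2 ⟨mem_zeros.2 ⟨hy, h1.1⟩, fun h => (mem_supp.1 h).2 h1.2⟩, h2⟩
    · rintro ⟨y, hy, h2⟩
      rw [Finset.mem_sdiff, mem_zeros, mem_supp] at hy
      exact ⟨y, hy.1.1, ⟨hy.1.2, by_contra fun h => hy.2 ⟨hy.1.1, h⟩⟩, h2⟩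
  simp only [← hQ]
  refine (Tr.forN_const n (fun j τ => ∀ c, (τ.arr 9 c = x + 1 ↔ Q j c) ∧ τ.arr 9 c ≤ x + 1 ∧
    τ.arr 10 c = σ.arr 10 c + if Q j c then 4 * s else 0) 72 hb.reg_two (by decide) (by decide)
    (by decide) (fun j τ v h => by simpa using h) ?_ ?_).mono le_rfl ?_
  · intro c
    have hQ0 : ¬ Q 0 c := fun h => let ⟨_, hy, _⟩ := (hQdef 0 c).1 h; absurd hy (by omega)
    have := hfl c
    simp only [hQ0, iff_false, if_false]
    omega
  · intro j hj τ hf hji hI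
    have hf' : Frame [8] [9, 10] σ τ := hf.mono (by decide) (by decide)
    have hQs : ∀ c, Q (j + 1) c ↔ Q j c ∨
        ((σ.arr 3 j = 0 ∧ σ.arr 7 j = 0) ∧ σ.arr 4 j = c ∧ H.Adj x j) := by
      intro c
      rw [hQdef, hQdef]
      constructor
      · rintro ⟨y, hy, h⟩
        rcases Nat.lt_succ_iff_lt_or_eq.1 hy with h' | rfl
        · exact Or.inl ⟨y, h', h⟩
        · exact Or.inr h
      · rintro (⟨y, hy, h⟩ | h)
        · exact ⟨y, by omega, h⟩
        · exact ⟨j, by omega, h⟩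
    have hc : Expr.eval τ (andE (andE (notE (rd 3 8)) (notE (rd 7 8)))
        (andE (adjE 20 8) (neqE (.read 9 (rd 4 8)) (.reg 18)))) ≠ 0 ↔
        ((σ.arr 3 j = 0 ∧ σ.arr 7 j = 0) ∧ H.Adj x j ∧ ¬ Q j (σ.arr 4 j)) := by
      have := (hI (σ.arr 4 j)).1
      simp [hji, hf'.reg, hf'.arr, hx, h18, hb.adj_zero hxn hj, this, and_assoc]
    refine (Tr.cond (T := 15) (fun h => ?_) fun h => (Tr.skip ?_).mono (by omega)
      fun _ h => h).mono (by decide) (fun _ h => h)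
    · obtain ⟨h1, h2, h3⟩ := hc.1 h
      refine (Tr.seq (Tr.write (i := rd 4 8) (e := .reg 18) (Tr.write ?_))).mono
        (T₁ := 4 + 8) (by omega) (fun _ h => h)
      intro c
      obtain ⟨i1, i2, i3⟩ := hI c
      have hl : (σ.arr 3 j = 0 ∧ σ.arr 7 j = 0) ∧ σ.arr 4 j = c ∧ H.Adj x j ↔ c = σ.arr 4 j :=
        ⟨fun h => h.2.1.symm, fun h => ⟨h1, h.symm, h2⟩⟩
      simp only [hQs, hl]
      by_cases hcl : c = σ.arr 4 j
      · subst hcl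
        simp [hji, hf'.reg, hf'.arr, h18, h19, i3, h3]
      · simp [hji, hf'.reg, hf'.arr, hcl, i1, i2, i3]
    · have hn : ∀ c, Q (j + 1) c ↔ Q j c := by
        intro c
        rw [hQs]
        refine ⟨fun h' => ?_, Or.inl⟩
        rcases h' with h' | ⟨h1, rfl, h2⟩
        · exact h'
        · by_contra hnq
          exact hc.2 ⟨h1, h2, hnq⟩ h
      simpa only [hn] using hI
  · rintro τ ⟨hf, h⟩
    exact ⟨hf.mono (by decide) (by decide), h⟩

theorem card_filter_lt_succ (Y : Finset ℕ) (P : ℕ → Prop) [DecidablePred P] (m : ℕ) :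
    (Y.filter fun x => x < m + 1 ∧ P x).card =
      (Y.filter fun x => x < m ∧ P x).card + if m ∈ Y ∧ P m then 1 else 0 := by
  split_ifs with h
  · rw [show (Y.filter fun x => x < m + 1 ∧ P x) = insert m (Y.filter fun x => x < m ∧ P x) from ?_,
      Finset.card_insert_of_notMem (by simp)]
    ext l
    simp only [Finset.mem_filter, Finset.mem_insert]
    constructor
    · rintro ⟨h1, h2, h3⟩
      rcases Nat.lt_succ_iff_lt_or_eq.1 h2 with h' | h'
      · exact Or.inr ⟨h1, h', h3⟩
      · exact Or.inl h'
    · rintro (rfl | ⟨h1, h2, h3⟩)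
      · exact ⟨h.1, by omega, h.2⟩
      · exact ⟨h1, by omega, h3⟩
  · congr 1
    ext l
    simp only [Finset.mem_filter]
    constructor
    · rintro ⟨h1, h2, h3⟩
      refine ⟨h1, lt_of_le_of_ne (by omega) ?_, h3⟩
      rintro rfl
      exact h ⟨h1, h3⟩
    · rintro ⟨h1, h2, h3⟩
      exact ⟨h1, by omega, h3⟩

open scoped Classical in
/-- The quotas and spoiled vertices caused by the vertices of `Y` below `m`. -/
structure SpoilInv (s n : ℕ) (H : SimpleGraph ℕ) (Y A : Finset ℕ) (lab : ℕ → ℕ) (m : ℕ)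
    (fl quo bad : ℕ → ℕ) : Prop where
  fl_le : ∀ c, fl c ≤ m
  quo_eq : ∀ c, quo c = 4 * s * (Y.filter fun x => x < m ∧ Touches H A lab x c).card
  bad_iff : ∀ u < n, bad u ≠ 0 ↔ u ∈ A ∧ ∃ x ∈ Y, x < m ∧ ¬ H.Adj x u ∧ Touches H A lab x (lab u)

theorem spoilP_spec {x : ℕ} {Y : Finset ℕ} (hb : Base s k n H σ) (hx : σ.reg 20 = x) (hxn : x < n)
    (h19 : σ.reg 19 = 4 * s)
    (hY : ∀ x, x ∈ Y ↔ x < n ∧ σ.arr 3 x ≠ 0 ∧ σ.arr 13 x = 0)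
    (hinv : SpoilInv s n H Y (zeros n (σ.arr 3) \ supp n (σ.arr 7)) (σ.arr 4) x
      (σ.arr 9) (σ.arr 10) (σ.arr 11)) :
    Tr spoilP σ (300 * (n + 1)) fun τ =>
      SpoilInv s n H Y (zeros n (σ.arr 3) \ supp n (σ.arr 7)) (σ.arr 4) (x + 1)
        (τ.arr 9) (τ.arr 10) (τ.arr 11) := by
  classical
  set A := zeros n (σ.arr 3) \ supp n (σ.arr 7) with hA
  have hmemA : ∀ j < n, j ∈ A ↔ σ.arr 3 j = 0 ∧ σ.arr 7 j = 0 := by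
    intro j hj
    rw [hA, Finset.mem_sdiff, mem_zeros, mem_supp]
    simp [hj]
  have hc : Expr.eval σ (andE (rd 3 20) (notE (rd 13 20))) ≠ 0 ↔ x ∈ Y := by
    rw [hY]
    simp [hx, hxn]
  refine Tr.mono (T₁ := 13 + 1 + (4 + (80 * (n + 1) + 100 * (n + 1)))) (Tr.cond (fun h => ?_)
    fun h => (Tr.skip ?_).mono (by omega) (fun _ h => h)) (by omega) (fun _ h => h)
  · have hxY := hc.1 h
    refine Tr.seq (Tr.assign ?_)
    set τ₀ := σ.setReg 18 _ with hτ₀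
    have hf₀ : Frame [18] [] σ τ₀ := Frame.setReg (Frame.refl _ _ _) (by decide)
    have hb₀ : Base s k n H τ₀ := hb.frame hf₀ (by decide) (by decide)
    have h18 : τ₀.reg 18 = x + 1 := by simp [hτ₀, hx]
    clear_value τ₀
    have harr : τ₀.arr = σ.arr := funext fun a => hf₀.arr a (by simp)
    refine Tr.seq' (touchLoop_spec hb₀ ((hf₀.reg 20 (by decide)).trans hx) hxn h18
      ((hf₀.reg 19 (by decide)).trans h19) (by rw [harr]; exact hinv.fl_le)) ?_
    rw [harr, ← hA]
    rintro τ ⟨hf, hI⟩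
    have hbτ : Base s k n H τ := hb₀.frame hf (by decide) (by decide)
    have hf' : Frame [18, 8] [9, 10] σ τ :=
      (hf₀.mono (by decide) (by decide)).trans (hf.mono (by decide) (by decide))
    refine (take_all_spec (n := n) (fun j => j ∈ A ∧ ¬ H.Adj x j ∧ Touches H A (σ.arr 4) x (σ.arr 4 j))
      (fun _ => 1) hbτ.reg_two (by decide) (by decide) ?_).mono le_rfl ?_
    · intro j hj υ hf'' hi ha
      have := (hI (σ.arr 4 j)).1
      simp [hi, hf''.reg, hf''.arr, hf'.arr, hf.reg, h18, hf₀.reg, hx, hb.adj_zero hxn hj,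
        hmemA j hj, this, and_assoc]
    · rintro υ ⟨hf'', -, ha⟩
      rw [hf''.arr 9 (by decide), hf''.arr 10 (by decide)]
      refine ⟨fun c => (hI c).2.1, fun c => ?_, fun u hu => ?_⟩
      · rw [(hI c).2.2, card_filter_lt_succ, hinv.quo_eq c]
        by_cases ht : Touches H A (σ.arr 4) x c
        · simp [ht, hxY, Nat.mul_succ]
        · simp [ht]
      · rw [ha, hf'.arr 11 (by decide)]
        have h1 := hinv.bad_iff u hu
        have h2 : (u ∈ A ∧ ∃ x' ∈ Y, x' < x + 1 ∧ ¬ H.Adj x' u ∧ Touches H A (σ.arr 4) x'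
            (σ.arr 4 u)) ↔ (u ∈ A ∧ ¬ H.Adj x u ∧ Touches H A (σ.arr 4) x (σ.arr 4 u)) ∨
            σ.arr 11 u ≠ 0 := by
          rw [h1]
          constructor
          · rintro ⟨g1, x', g2, g3, g4⟩
            rcases Nat.lt_succ_iff_lt_or_eq.1 g3 with g | rfl
            · exact Or.inr ⟨g1, x', g2, g, g4⟩
            · exact Or.inl ⟨g1, g4⟩
          · rintro (⟨g1, g2⟩ | ⟨g1, x', g2, g3, g4⟩)
            · exact ⟨g1, x, hxY, by omega, g2⟩
            · exact ⟨g1, x', g2, by omega, g4⟩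
        rw [h2]
        by_cases g : u ∈ A ∧ ¬ H.Adj x u ∧ Touches H A (σ.arr 4) x (σ.arr 4 u)
        · simp [g, hu]
        · simp only [g, and_false, if_false, false_or]
  · have hxY : x ∉ Y := fun h' => hc.2 h' h
    refine ⟨fun c => (hinv.fl_le c).trans (by omega), fun c => ?_, fun u hu => ?_⟩
    · rw [hinv.quo_eq c, card_filter_lt_succ]
      simp [hxY]
    · rw [hinv.bad_iff u hu]
      refine and_congr_right fun _ => ⟨?_, ?_⟩
      · rintro ⟨x', g2, g3, g4⟩
        exact ⟨x', g2, by omega, g4⟩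
      · rintro ⟨x', g2, g3, g4⟩
        exact ⟨x', g2, lt_of_le_of_ne (by omega) fun e => hxY (e ▸ g2), g4⟩

/-- The quotas and marked vertices caused by the vertices of `T` and the spoiled vertices below
`m`. -/
structure MarkInv (s n : ℕ) (H : SimpleGraph ℕ) (T A B : Finset ℕ) (lab : ℕ → ℕ) (m : ℕ)
    (quo₀ quo keep : ℕ → ℕ) : Prop where
  quo_eq : ∀ c, quo c = quo₀ c + 4 * s * (T.filter fun t => t < m ∧ lab t = c).card
  keep_iff : ∀ w < n, keep w ≠ 0 ↔ w ∈ A ∧ ∃ b < m, b ∈ B ∧ lab b = lab w ∧ ¬ H.Adj b w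

theorem markP_spec {b : ℕ} {B : Finset ℕ} {quo₀ : ℕ → ℕ} (hb : Base s k n H σ) (hx : σ.reg 21 = b)
    (hbn : b < n) (h19 : σ.reg 19 = 4 * s)
    (hB : ∀ j < n, j ∈ B ↔ σ.arr 7 j ≠ 0 ∨ σ.arr 11 j ≠ 0)
    (hinv : MarkInv s n H (supp n (σ.arr 7)) (zeros n (σ.arr 3)) B (σ.arr 4) b
      quo₀ (σ.arr 10) (σ.arr 12)) :
    Tr markP σ (150 * (n + 1)) fun τ =>
      MarkInv s n H (supp n (σ.arr 7)) (zeros n (σ.arr 3)) B (σ.arr 4) (b + 1)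
        quo₀ (τ.arr 10) (τ.arr 12) := by
  classical
  set T := supp n (σ.arr 7) with hT
  have hbT : b ∈ T ↔ σ.arr 7 b ≠ 0 := by simp [hT, mem_supp, hbn]
  refine Tr.mono (T₁ := (2 + 1 + 8) + (5 + 1 + 100 * (n + 1))) (Tr.seq' (Q' := fun τ =>
    Frame [] [10] σ τ ∧ ∀ c, τ.arr 10 c =
      quo₀ c + 4 * s * (T.filter fun t => t < b + 1 ∧ σ.arr 4 t = c).card)
    (Tr.cond (fun h => Tr.write ?_) fun h => (Tr.skip ?_).mono (by omega) (fun _ h => h)) ?_)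
    (by omega) (fun _ h => h)
  · have hbT' : b ∈ T := hbT.2 (by simpa [hx] using h)
    refine ⟨⟨fun _ _ => rfl, fun a ha => ?_⟩, fun c => ?_⟩
    · simp only [List.mem_cons, List.not_mem_nil, or_false] at ha
      simp [ha]
    · rw [card_filter_lt_succ T (σ.arr 4 · = c) b]
      by_cases hcl : σ.arr 4 b = c
      · subst hcl
        have := hinv.quo_eq (σ.arr 4 b)
        simp [hx, h19, hbT', Nat.mul_succ, this]
        omega
      · have := hinv.quo_eq c
        have hcl' : c ≠ σ.arr 4 b := fun e => hcl e.symm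
        simp [hx, h19, hcl, hcl', this]
  · have hbT' : b ∉ T := fun h' => hbT.1 h' (by simpa [hx] using h)
    refine ⟨Frame.refl _ _ _, fun c => ?_⟩
    rw [card_filter_lt_succ T (σ.arr 4 · = c) b, hinv.quo_eq c]
    simp [hbT']
  · rintro τ ⟨hf, hq⟩
    have hbτ : Base s k n H τ := hb.frame hf (by decide) (by decide)
    have hcond : Expr.eval τ (.add (rd 7 21) (rd 11 21)) ≠ 0 ↔ b ∈ B := by
      rw [hB b hbn]
      simp only [eval_add, eval_rd, hf.reg 21 (by decide), hf.arr 7 (by decide),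
        hf.arr 11 (by decide), hx]
      omega
    have hstep : ∀ w, (w ∈ zeros n (σ.arr 3) ∧ ∃ b' < b + 1, b' ∈ B ∧ σ.arr 4 b' = σ.arr 4 w ∧
        ¬ H.Adj b' w) ↔ (w ∈ zeros n (σ.arr 3) ∧ ∃ b' < b, b' ∈ B ∧ σ.arr 4 b' = σ.arr 4 w ∧
        ¬ H.Adj b' w) ∨ (w ∈ zeros n (σ.arr 3) ∧ b ∈ B ∧ σ.arr 4 b = σ.arr 4 w ∧ ¬ H.Adj b w) := by
      intro w
      constructor
      · rintro ⟨g1, b', g2, g3⟩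
        rcases Nat.lt_succ_iff_lt_or_eq.1 g2 with g | rfl
        · exact Or.inl ⟨g1, b', g, g3⟩
        · exact Or.inr ⟨g1, g3⟩
      · rintro (⟨g1, b', g2, g3⟩ | ⟨g1, g3⟩)
        · exact ⟨g1, b', by omega, g3⟩
        · exact ⟨g1, b, by omega, g3⟩
    refine Tr.cond (fun h => ?_) fun h => (Tr.skip ?_).mono (by omega) (fun _ h => h)
    · have hbB := hcond.1 h
      refine (take_all_spec (n := n) (fun j => σ.arr 3 j = 0 ∧ σ.arr 4 j = σ.arr 4 b ∧ ¬ H.Adj b j)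
        (fun _ => 1) hbτ.reg_two (by decide) (by decide) ?_).mono le_rfl ?_
      · intro j hj υ hf' hi ha
        simp [hi, hf'.reg, hf'.arr, hf.reg, hf.arr, hx, hb.adj_zero hbn hj]
      · rintro υ ⟨hf', -, ha⟩
        rw [hf'.arr 10 (by decide)]
        refine ⟨hq, fun w hw => ?_⟩
        have h1 := hinv.keep_iff w hw
        rw [hstep, ← h1, ha, hf.arr 12 (by decide), mem_zeros]
        by_cases g1 : σ.arr 3 w = 0 <;> by_cases g2 : σ.arr 4 b = σ.arr 4 w <;>
          by_cases g3 : H.Adj b w <;> simp [hw, hbB, g1, g2, g3, eq_comm (a := σ.arr 4 w)]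
    · have hbB : b ∉ B := fun h' => hcond.2 h' h
      refine ⟨hq, fun w hw => ?_⟩
      have h1 := hinv.keep_iff w hw
      rw [hstep, ← h1, hf.arr 12 (by decide)]
      simp [hbB]

/-- The further vertices kept below `m`, starting with the set `M` of kept vertices and the quotas
`quo₀`. -/
structure FillInv (n : ℕ) (A M : Finset ℕ) (lab : ℕ → ℕ) (m : ℕ) (quo₀ quo keep : ℕ → ℕ) :
    Prop where
  subset : M ⊆ supp n keep
  supp_subset : supp n keep ⊆ A
  of_le : ∀ u ∈ supp n keep, m ≤ u → u ∈ M
  quo_add : ∀ c, quo c + ((supp n keep \ M).filter (lab · = c)).card = quo₀ c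
  quo_zero : ∀ u < m, u ∈ A → u ∉ supp n keep → quo (lab u) = 0

/-- Array `10` holds the remaining quotas, which never grow. An unmarked cluster vertex is passed
over only if the remaining quota is `0`; hence at the end either the whole cluster is kept or its
quota is used up. -/
theorem fillLoop_spec (hb : Base s k n H σ)
    (hsub : supp n (σ.arr 12) ⊆ zeros n (σ.arr 3)) :
    Tr (forN 8 2 fillP) σ (100 * (n + 1)) fun τ =>
      FillInv n (zeros n (σ.arr 3)) (supp n (σ.arr 12)) (σ.arr 4) n (σ.arr 10)
        (τ.arr 10) (τ.arr 12) := by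
  classical
  set M := supp n (σ.arr 12) with hM
  refine (Tr.forN_const n (fun j τ => FillInv n (zeros n (σ.arr 3)) M (σ.arr 4) j (σ.arr 10)
    (τ.arr 10) (τ.arr 12)) 92 hb.reg_two (by decide) (by decide) (by decide)
    (fun j τ v h => by simpa using h) ?_ ?_).mono le_rfl fun τ h => h.2
  · exact ⟨le_rfl, hsub, fun u hu _ => hu, fun c => by simp [← hM], fun u hu => absurd hu (by omega)⟩
  · intro j hj τ hf hji hI
    have hf' : Frame [8] [10, 12] σ τ := hf.mono (by decide) (by decide)
    have hc : Expr.eval τ (andE (andE (notE (rd 3 8)) (notE (rd 12 8))) (.read 10 (rd 4 8))) ≠ 0 ↔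
        (j ∈ zeros n (σ.arr 3) ∧ j ∉ supp n (τ.arr 12) ∧ τ.arr 10 (σ.arr 4 j) ≠ 0) := by
      rw [mem_zeros, mem_supp]
      simp [hji, hf'.arr, hj, and_assoc]
    refine (Tr.cond (T := 15) (fun h => ?_) fun h => (Tr.skip ?_).mono (by omega)
      fun _ h => h).mono (by decide) (fun _ h => h)
    · obtain ⟨h1, h2, h3⟩ := hc.1 h
      refine (Tr.seq (Tr.write (i := rd 4 8) (e := .sub (.read 10 (rd 4 8)) (.const 1))
        (Tr.write (i := .reg 8) (e := .const 1) ?_))).mono (by decide) (fun _ h => h)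
      set υ := State.setArr _ _ _ _ with hυ
      have e10 : υ.arr 10 = Function.update (τ.arr 10) (σ.arr 4 j) (τ.arr 10 (σ.arr 4 j) - 1) := by
        simp [hυ, hji, hf'.arr]
      have e12 : υ.arr 12 = Function.update (τ.arr 12) j 1 := by
        simp [hυ, hji]
      clear_value υ
      have hsupp : supp n (υ.arr 12) = insert j (supp n (τ.arr 12)) := by
        ext l
        rw [Finset.mem_insert, mem_supp, mem_supp, e12, Function.update_apply]
        by_cases hl : l = j
        · simp [hl, hj]
        · simp [hl]
      have hjM : j ∉ M := fun h => h2 (hI.subset h)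
      refine ⟨?_, ?_, ?_, ?_, ?_⟩
      · rw [hsupp]; exact hI.subset.trans (Finset.subset_insert _ _)
      · rw [hsupp]; exact Finset.insert_subset h1 hI.supp_subset
      · rw [hsupp]
        intro u hu hju
        rcases Finset.mem_insert.1 hu with rfl | hu
        · omega
        · exact hI.of_le u hu (by omega)
      · intro c
        have h4 := hI.quo_add c
        rw [hsupp, Finset.insert_sdiff_of_notMem _ hjM, Finset.filter_insert, e10]
        split_ifs with hcl
        · subst hcl
          rw [Finset.card_insert_of_notMem (fun h => h2
            (Finset.mem_sdiff.1 (Finset.mem_filter.1 h).1).1), Function.update_self]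
          omega
        · rw [Function.update_of_ne (Ne.symm hcl)]
          exact h4
      · rw [hsupp, e10]
        intro u hu huA hun
        rw [Finset.mem_insert, not_or] at hun
        have h5 := hI.quo_zero u (lt_of_le_of_ne (by omega) hun.1) huA hun.2
        rw [Function.update_of_ne]
        · exact h5
        · intro e
          exact h3 (e ▸ h5)
    · refine ⟨hI.subset, hI.supp_subset, fun u hu hju => hI.of_le u hu (by omega), hI.quo_add, ?_⟩
      intro u hu huA hun
      rcases Nat.lt_succ_iff_lt_or_eq.1 hu with h' | rfl
      · exact hI.quo_zero u h' huA hun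
      · by_contra h3
        exact hc.2 ⟨huA, hun, h3⟩ h

/-- When the filling starts, array `12` holds exactly the marked vertices and array `10` the quotas.
The arrays are assumed to vanish everywhere, since some are indexed by labels and no bound on the
labels is carried along. -/
theorem keepP_spec {Y : Finset ℕ} (hb : Base s k n H σ)
    (hY : ∀ x, x ∈ Y ↔ x < n ∧ σ.arr 3 x ≠ 0 ∧ σ.arr 13 x = 0)
    (h0 : ∀ j, σ.arr 9 j = 0 ∧ σ.arr 10 j = 0 ∧ σ.arr 11 j = 0 ∧ σ.arr 12 j = 0) :
    Tr keepP σ (700 * ((n + 1) * (n + 1))) fun τ =>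
      Frame [8, 9, 18, 19, 20, 21] [9, 10, 11, 12] σ τ ∧
      FillInv n (zeros n (σ.arr 3)) (marked H Y (zeros n (σ.arr 3)) (supp n (σ.arr 7)) (σ.arr 4))
        (σ.arr 4) n (quota s H Y (zeros n (σ.arr 3)) (supp n (σ.arr 7)) (σ.arr 4))
        (τ.arr 10) (τ.arr 12) := by
  classical
  set A := zeros n (σ.arr 3) with hA
  set T := supp n (σ.arr 7) with hT
  suffices key : Tr keepP σ (8 + ((300 * (n + 1) + 8) * (n + 1) + ((150 * (n + 1) + 8) * (n + 1) +
      100 * (n + 1)))) fun τ => FillInv n A (marked H Y A T (σ.arr 4)) (σ.arr 4) n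
        (quota s H Y A T (σ.arr 4)) (τ.arr 10) (τ.arr 12) by
    refine key.frame.mono (by nlinarith) ?_
    rintro τ ⟨hf, hq⟩
    exact ⟨hf.mono (by decide) (by decide), hq⟩
  refine Tr.seq (Tr.assign ?_)
  set τ₀ := σ.setReg 19 _ with hτ₀
  have hf₀ : Frame [19] [] σ τ₀ := Frame.setReg (Frame.refl _ _ _) (by decide)
  have hb₀ : Base s k n H τ₀ := hb.frame hf₀ (by decide) (by decide)
  have h19 : τ₀.reg 19 = 4 * s := by simp [hτ₀, hb.reg_zero]; omega
  clear_value τ₀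
  refine Tr.seq' (Tr.forN_const n (fun j τ => SpoilInv s n H Y (A \ T) (σ.arr 4) j
    (τ.arr 9) (τ.arr 10) (τ.arr 11)) (300 * (n + 1)) hb₀.reg_two (by decide) (by decide)
    (by decide) (fun j τ v h => by simpa using h) ?_ ?_) ?_
  · rw [hf₀.arr 9 (by decide), hf₀.arr 10 (by decide), hf₀.arr 11 (by decide)]
    exact ⟨fun c => (h0 c).1.le, fun c => by simp [(h0 c).2.1], fun u _ => by simp [(h0 u).2.2.1]⟩
  · intro j hj τ hf hji hI
    have hf' : Frame [8, 9, 18, 19, 20] [9, 10, 11] σ τ :=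
      (hf₀.mono (by decide) (by decide)).trans (hf.mono (by decide) (by decide))
    have e3 : τ.arr 3 = σ.arr 3 := hf'.arr 3 (by decide)
    have e4 : τ.arr 4 = σ.arr 4 := hf'.arr 4 (by decide)
    have e7 : τ.arr 7 = σ.arr 7 := hf'.arr 7 (by decide)
    have e13 : τ.arr 13 = σ.arr 13 := hf'.arr 13 (by decide)
    have := spoilP_spec (Y := Y) (hb.frame hf' (by decide) (by decide)) hji hj
      ((hf.reg 19 (by decide)).trans h19) (by rw [e3, e13]; exact hY)
      (by rw [e3, e4, e7]; exact hI)
    rw [e3, e4, e7] at this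
    exact this
  rintro τ₁ ⟨hf₁, hI₁⟩
  have hf₁' : Frame [8, 9, 18, 19, 20] [9, 10, 11] σ τ₁ :=
    (hf₀.mono (by decide) (by decide)).trans (hf₁.mono (by decide) (by decide))
  have hb₁ : Base s k n H τ₁ := hb.frame hf₁' (by decide) (by decide)
  have h19₁ : τ₁.reg 19 = 4 * s := (hf₁.reg 19 (by decide)).trans h19
  set B := T ∪ supp n (τ₁.arr 11) with hB
  refine Tr.seq' (Tr.forN_const n (fun j τ => MarkInv s n H T A B (σ.arr 4) j (τ₁.arr 10)
    (τ.arr 10) (τ.arr 12)) (150 * (n + 1)) hb₁.reg_two (by decide) (by decide)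
    (by decide) (fun j τ v h => by simpa using h) ?_ ?_) ?_
  · rw [hf₁'.arr 12 (by decide)]
    exact ⟨fun c => by simp, fun w _ => by simp [(h0 w).2.2.2]⟩
  · intro j hj τ hf hji hI
    have hf' : Frame [8, 9, 18, 19, 20, 21] [9, 10, 11, 12] σ τ :=
      (hf₁'.mono (by decide) (by decide)).trans (hf.mono (by decide) (by decide))
    have e3 : τ.arr 3 = σ.arr 3 := hf'.arr 3 (by decide)
    have e4 : τ.arr 4 = σ.arr 4 := hf'.arr 4 (by decide)
    have e7 : τ.arr 7 = σ.arr 7 := hf'.arr 7 (by decide)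
    have e11 : τ.arr 11 = τ₁.arr 11 := hf.arr 11 (by decide)
    have := markP_spec (B := B) (quo₀ := τ₁.arr 10) (hb.frame hf' (by decide) (by decide)) hji hj
      ((hf.reg 19 (by decide)).trans h19₁) (by
        intro l hl
        rw [hB, hT, Finset.mem_union, mem_supp, mem_supp, e7, e11]
        simp [hl])
      (by rw [e3, e4, e7]; exact hI)
    rw [e3, e4, e7] at this
    exact this
  rintro τ₂ ⟨hf₂, hI₂⟩
  have hf₂' : Frame [8, 9, 18, 19, 20, 21] [9, 10, 11, 12] σ τ₂ :=
    (hf₁'.mono (by decide) (by decide)).trans (hf₂.mono (by decide) (by decide))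
  have hb₂ : Base s k n H τ₂ := hb.frame hf₂' (by decide) (by decide)
  have hYn : ∀ x ∈ Y, x < n := fun x hx => ((hY x).1 hx).1
  have hTn : ∀ x ∈ T, x < n := fun x hx => (mem_supp.1 hx).1
  have hmark : supp n (τ₂.arr 12) = marked H Y A T (σ.arr 4) := by
    ext w
    rw [mem_supp, mem_marked]
    have hBn : ∀ b, b < n ∧ b ∈ B ↔ b ∈ T ∨ Spoiled H Y (A \ T) (σ.arr 4) b := by
      intro b
      have h11 : b ∈ supp n (τ₁.arr 11) ↔ b < n ∧ τ₁.arr 11 b ≠ 0 := mem_supp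
      rw [hB, Finset.mem_union, h11]
      constructor
      · rintro ⟨hbn, h | h⟩
        · exact Or.inl h
        · obtain ⟨h1, x, h2, -, h3⟩ := (hI₁.bad_iff b hbn).1 h.2
          exact Or.inr ⟨h1, x, h2, h3⟩
      · rintro (h | ⟨h1, x, h2, h3⟩)
        · exact ⟨hTn b h, Or.inl h⟩
        · have hbn : b < n := (mem_zeros.1 (Finset.mem_sdiff.1 h1).1).1
          exact ⟨hbn, Or.inr ⟨hbn, (hI₁.bad_iff b hbn).2 ⟨h1, x, h2, hYn x h2, h3⟩⟩⟩
    constructor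
    · rintro ⟨hw, h⟩
      obtain ⟨h1, b, h2, h3, h4⟩ := (hI₂.keep_iff w hw).1 h
      exact ⟨h1, b, (hBn b).1 ⟨h2, h3⟩, h4⟩
    · rintro ⟨h1, b, h2, h3⟩
      have hw := (mem_zeros.1 h1).1
      obtain ⟨g1, g2⟩ := (hBn b).2 h2
      exact ⟨hw, (hI₂.keep_iff w hw).2 ⟨h1, b, g1, g2, h3⟩⟩
  have hquo : τ₂.arr 10 = quota s H Y A T (σ.arr 4) := by
    funext c
    rw [hI₂.quo_eq c, hI₁.quo_eq c, quota, ← Nat.mul_add, Nat.add_comm]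
    congr 3
    · ext t
      simp only [Finset.mem_filter]
      exact ⟨fun h => ⟨h.1, h.2.2⟩, fun h => ⟨h.1, hTn t h.1, h.2⟩⟩
    · ext t
      simp only [Finset.mem_filter]
      exact ⟨fun h => ⟨h.1, h.2.2⟩, fun h => ⟨h.1, hYn t h.1, h.2⟩⟩
  have e3 : τ₂.arr 3 = σ.arr 3 := hf₂'.arr 3 (by decide)
  have e4 : τ₂.arr 4 = σ.arr 4 := hf₂'.arr 4 (by decide)
  have := fillLoop_spec hb₂ (by
    rw [hmark, e3]
    intro w hw
    exact (mem_marked.1 hw).1)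
  rw [hmark, e3, e4, hquo] at this
  exact this

end Keep

/-! ### Reading the adjacency matrix without multiplication. -/

section Input

/-- Compute the offsets of the rows of the adjacency matrix into array `2`. -/
def rowsP : Program :=
  .seq (.assign 3 (.const 0))
    (forN 8 2 (.seq (.write 2 (.reg 8) (.reg 3)) (.assign 3 (.add (.reg 3) (.reg 2)))))

theorem mul_add_inj {m a b a' b' : ℕ} (hb : b < m) (hb' : b' < m)
    (h : a * m + b = a' * m + b') : a = a' ∧ b = b' := by
  have hm : 0 < m := by omega
  have h1 : a = a' := by
    have := congrArg (· / m) h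
    simpa [Nat.add_comm _ b, Nat.add_comm _ b', Nat.add_mul_div_right _ _ hm, Nat.div_eq_of_lt hb,
      Nat.div_eq_of_lt hb'] using this
  subst h1
  exact ⟨rfl, by omega⟩

/-- The row offsets `i * n` arise by repeated addition. From here on the graph is the image of `G`
in `ℕ`, so that vertices are array indices. -/
theorem rowsP_spec (s k : ℕ) {n : ℕ} (G : SimpleGraph (Fin n)) :
    Tr rowsP (input s k G) (20 * (n + 1)) fun τ => Frame [3, 8] [2] (input s k G) τ ∧
      Base s k n (G.map Fin.valEmbedding) τ := by
  classical
  set σ := input s k G with hσ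
  suffices key : Tr rowsP σ (2 + (7 + 8) * (n + 1)) fun τ => ∀ i < n, τ.arr 2 i = i * n by
    refine key.frame.mono (by omega) ?_
    rintro τ ⟨hf, h2⟩
    have hf' : Frame [3, 8] [2] σ τ := hf.mono (by decide) (by decide)
    refine ⟨hf', by simp [hf'.reg, hσ, input], by simp [hf'.reg, hσ, input],
      by simp [hf'.reg, hσ, input], fun i hi j hj => ?_⟩
    rw [h2 i hi, hf'.arr 0 (by decide)]
    simp only [hσ, input, true_and]
    congr 1
    rw [eq_iff_iff, SimpleGraph.map_adj]
    constructor
    · rintro ⟨a, b, h, hab⟩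
      obtain ⟨h1, h2⟩ := mul_add_inj hj b.2 h
      exact ⟨a, b, hab, h1.symm, h2.symm⟩
    · rintro ⟨a, b, hab, rfl, rfl⟩
      exact ⟨a, b, rfl, hab⟩
  refine Tr.seq (Tr.assign ?_)
  refine (Tr.forN_const n (fun j τ => τ.reg 2 = n ∧ τ.reg 3 = j * n ∧ ∀ i < j, τ.arr 2 i = i * n) 7
    (by simp [hσ, input]) (by decide) (by decide) (by decide)
    (fun j τ v h => by simpa using h) ?_ ?_).mono le_rfl fun τ h => h.2.2.2
  · exact ⟨by simp [hσ, input], by simp, fun i hi => absurd hi (by omega)⟩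
  · rintro j hj τ - hji ⟨h2, h3, hI⟩
    refine (Tr.seq (Tr.write (Tr.assign ?_))).mono (by decide) fun _ h => h
    refine ⟨by simp [h2], by simp [h2, h3, Nat.succ_mul], fun i hi => ?_⟩
    by_cases hij : i = j
    · subst hij
      simp [hji, h3]
    · simp [hji, hij, hI i (by omega)]

end Input

/-! ### Writing the adjacency matrix of the kernel. -/

section Output

/-- List the vertices of array `12` in array `14`, and count them in register `9`. -/
def listP : Program :=
  .seq (.assign 9 (.const 0)) (forN 8 2 (.cond (rd 12 8)
    (.seq (.write 14 (.reg 9) (.reg 8)) (.assign 9 (.add (.reg 9) (.const 1)))) .skip))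

/-- Write the next row of the adjacency matrix of the output. -/
def rowP : Program :=
  forN 21 9 (.seq (.write 1 (.reg 10) (.read 0 (.add (.read 2 (rd 14 20)) (rd 14 21))))
    (.assign 10 (.add (.reg 10) (.const 1))))

/-- Output the graph induced by the vertices of array `12`. -/
def outP : Program :=
  .seq listP (.seq (.assign 10 (.const 0)) (.seq (forN 20 9 rowP) (.assign 2 (.reg 9))))

variable {s k n : ℕ} {H : SimpleGraph ℕ} {σ : State}

/-- The array `lst` lists the support of `f`. -/
structure Lists (n : ℕ) (f lst : ℕ → ℕ) (m : ℕ) : Prop where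
  card_eq : m = (supp n f).card
  mem : ∀ a < m, lst a ∈ supp n f
  mono : ∀ a b, a < b → b < m → lst a < lst b

theorem listP_spec (hb : Base s k n H σ) :
    Tr listP σ (30 * (n + 1)) fun τ => Frame [8, 9] [14] σ τ ∧
      Lists n (σ.arr 12) (τ.arr 14) (τ.reg 9) := by
  suffices key : Tr listP σ (2 + (12 + 8) * (n + 1)) fun τ =>
      Lists n (σ.arr 12) (τ.arr 14) (τ.reg 9) by
    refine key.frame.mono (by omega) ?_
    rintro τ ⟨hf, h⟩
    exact ⟨hf.mono (by decide) (by decide), h⟩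
  refine Tr.seq (Tr.assign ?_)
  refine (Tr.forN_const n (fun j τ => Lists j (σ.arr 12) (τ.arr 14) (τ.reg 9)) 12
    (by simp [hb.reg_two]) (by decide) (by decide) (by decide)
    (fun j τ v h => by simpa using h) ?_ ?_).mono le_rfl fun τ h => h.2
  · refine ⟨by simp [supp], fun a ha => ?_, fun a b _ hb => ?_⟩
    · simp at ha
    · simp at hb
  · intro j hj τ hf hji hI
    have e12 : τ.arr 12 = σ.arr 12 := hf.arr 12 (by decide)
    have hsub : supp j (σ.arr 12) ⊆ supp (j + 1) (σ.arr 12) := fun l hl => by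
      rw [mem_supp] at *
      exact ⟨by omega, hl.2⟩
    refine (Tr.cond (T := 8) (fun h => (Tr.seq (Tr.write (Tr.assign ?_))).mono (by decide)
      fun _ h => h) fun h => (Tr.skip ?_).mono (by omega) fun _ h => h).mono (by decide) fun _ h => h
    · have hjk : σ.arr 12 j ≠ 0 := by simpa [hji, e12] using h
      have hins : supp (j + 1) (σ.arr 12) = insert j (supp j (σ.arr 12)) := by
        ext l
        rw [Finset.mem_insert, mem_supp, mem_supp]
        constructor
        · rintro ⟨h1, h2⟩
          by_cases hl : l = j
          · exact Or.inl hl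
          · exact Or.inr ⟨by omega, h2⟩
        · rintro (rfl | ⟨h1, h2⟩)
          · exact ⟨by omega, hjk⟩
          · exact ⟨by omega, h2⟩
      set υ := State.setReg _ _ _ with hυ
      have e9 : υ.reg 9 = τ.reg 9 + 1 := by simp [hυ]
      have e14 : υ.arr 14 = Function.update (τ.arr 14) (τ.reg 9) j := by simp [hυ, hji]
      clear_value υ
      refine ⟨?_, fun a ha => ?_, fun a b hab hb => ?_⟩
      · rw [e9, hins, Finset.card_insert_of_notMem fun h => absurd (mem_supp.1 h).1 (lt_irrefl _),
          ← hI.card_eq]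
      · rw [e14, Function.update_apply]
        split_ifs with h1
        · rw [hins]
          exact Finset.mem_insert_self _ _
        · exact hsub (hI.mem a (by omega))
      · rw [e14, Function.update_of_ne (by omega), Function.update_apply]
        split_ifs with h1
        · exact (mem_supp.1 (hI.mem a (by omega))).1
        · exact hI.mono a b hab (by omega)
    · have hjk : σ.arr 12 j = 0 := by simpa [hji, e12] using h
      have hins : supp (j + 1) (σ.arr 12) = supp j (σ.arr 12) := by
        refine le_antisymm (fun l hl => ?_) hsub
        rw [mem_supp] at *
        refine ⟨lt_of_le_of_ne (by omega) ?_, hl.2⟩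
        rintro rfl
        exact hl.2 hjk
      exact ⟨by rw [hins]; exact hI.card_eq, by rw [hins]; exact hI.mem, hI.mono⟩

/-- The first `p` entries of the matrix `val` with `m` columns have been written into `out`. -/
def Written (m : ℕ) (val : ℕ → ℕ → ℕ) (p : ℕ) (out : ℕ → ℕ) : Prop :=
  ∀ a b, b < m → a * m + b < p → out (a * m + b) = val a b

theorem Written.succ {m a b : ℕ} {val : ℕ → ℕ → ℕ} {out : ℕ → ℕ}
    (h : Written m val (a * m + b) out) (hb : b < m) :
    Written m val (a * m + b + 1) (Function.update out (a * m + b) (val a b)) := by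
  intro a' b' hb' hlt
  by_cases he : a' * m + b' = a * m + b
  · obtain ⟨rfl, rfl⟩ := mul_add_inj hb' hb he
    simp
  · rw [Function.update_of_ne he]
    exact h a' b' hb' (by omega)

/-- Register `10` runs through the positions `a * m + b` consecutively and replaces the
multiplication. -/
theorem rowP_spec {m a : ℕ} (h9 : σ.reg 9 = m) (h20 : σ.reg 20 = a) (h10 : σ.reg 10 = a * m)
    (h : Written m (fun a b => σ.arr 0 (σ.arr 2 (σ.arr 14 a) + σ.arr 14 b)) (a * m) (σ.arr 1)) :
    Tr rowP σ (30 * (m + 1)) fun τ => τ.reg 10 = (a + 1) * m ∧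
      Written m (fun a b => σ.arr 0 (σ.arr 2 (σ.arr 14 a) + σ.arr 14 b)) ((a + 1) * m)
        (τ.arr 1) := by
  set val := fun a b => σ.arr 0 (σ.arr 2 (σ.arr 14 a) + σ.arr 14 b) with hval
  refine (Tr.forN_const m (fun j τ => τ.reg 10 = a * m + j ∧ Written m val (a * m + j) (τ.arr 1)) 22
    h9 (by decide) (by decide) (by decide) (fun j τ v h => by simpa using h) ?_ ?_).mono le_rfl ?_
  · exact ⟨h10, h⟩
  · rintro j hj τ hf hji ⟨i1, i2⟩
    have hf' : Frame [21, 10] [1] σ τ := hf.mono (by decide) (by decide)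
    refine (Tr.seq (Tr.write (Tr.assign ?_))).mono (by decide) fun _ h => h
    refine ⟨by simp [i1, Nat.add_assoc], ?_⟩
    have := i2.succ hj
    simpa [hf'.reg, hf'.arr, h20, hji, i1, hval, Nat.add_assoc] using this
  · rintro τ ⟨-, h1, h2⟩
    rw [Nat.succ_mul]
    exact ⟨h1, h2⟩

/-- The list of kept vertices is increasing, hence injective, and by cardinality it exhausts them.
As an embedding `f` it presents the output as `H.comap f`. -/
theorem outP_spec (hb : Base s k n H σ) :
    Tr outP σ (100 * ((n + 1) * (n + 1))) fun τ =>
      ∃ f : Fin (supp n (σ.arr 12)).card ↪ ℕ, Finset.univ.map f = supp n (σ.arr 12) ∧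
        Outputs τ (H.comap f) k := by
  classical
  set K := supp n (σ.arr 12) with hK
  have hKn : K.card ≤ n := by
    have := Finset.card_filter_le (Finset.range n) (σ.arr 12 · ≠ 0)
    rwa [Finset.card_range] at this
  refine Tr.mono (T₁ := 30 * (n + 1) + (2 + ((30 * (K.card + 1) + 8) * (K.card + 1) + 2)))
    (Tr.seq' (listP_spec hb) ?_) (by nlinarith) fun _ h => h
  rintro τ ⟨hf, hl⟩
  have hbτ : Base s k n H τ := hb.frame hf (by decide) (by decide)
  have hm : τ.reg 9 = K.card := hl.card_eq
  rw [hm] at hl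
  set val := fun a b => τ.arr 0 (τ.arr 2 (τ.arr 14 a) + τ.arr 14 b) with hval
  refine Tr.seq (Tr.assign (Tr.seq' (Tr.forN_const K.card (fun a υ => υ.reg 10 = a * K.card ∧
    Written K.card val (a * K.card) (υ.arr 1)) (30 * (K.card + 1)) (by simp [hm]) (by decide)
    (by decide) (by decide) (fun j τ v h => by simpa using h) ?_ ?_) ?_))
  · exact ⟨by simp, fun a b _ h => absurd h (by omega)⟩
  · rintro a ha υ hf' h20 ⟨i1, i2⟩
    have hf'' : Frame [20, 21, 10] [1] τ υ := by
      refine Frame.trans (τ := τ.setReg 10 ((Expr.const 0).eval τ)) ?_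
        (hf'.mono (by decide) (by decide))
      exact Frame.setReg (Frame.refl _ _ _) (by decide)
    have hv : (fun a b => υ.arr 0 (υ.arr 2 (υ.arr 14 a) + υ.arr 14 b)) = val := by
      simp [hf''.arr, hval]
    have := rowP_spec (m := K.card) ((hf''.reg 9 (by decide)).trans hm) h20 i1 (by rw [hv]; exact i2)
    rwa [hv] at this
  · rintro υ ⟨hf', -, hw⟩
    have hf'' : Frame [20, 21, 10] [1] τ υ := by
      refine Frame.trans (τ := τ.setReg 10 ((Expr.const 0).eval τ)) ?_
        (hf'.mono (by decide) (by decide))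
      exact Frame.setReg (Frame.refl _ _ _) (by decide)
    refine Tr.assign ?_
    have hinj : Function.Injective fun i : Fin K.card => τ.arr 14 i := by
      refine StrictMono.injective fun i j hij => ?_
      exact hl.mono i j hij j.2
    refine ⟨⟨_, hinj⟩, ?_, ?_, ?_, ?_⟩
    · refine Finset.eq_of_subset_of_card_le ?_ (by simp)
      intro v hv
      obtain ⟨i, -, rfl⟩ := Finset.mem_map.1 hv
      exact hl.mem i i.2
    · simp [hf''.reg, hbτ.reg_one]
    · simp [hf''.reg, hm]
    · intro i j
      have hlt : (i : ℕ) * K.card + j < K.card * K.card := by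
        have := Nat.mul_le_mul_right K.card (Nat.succ_le_of_lt i.2)
        rw [Nat.succ_mul] at this
        have := j.2
        omega
      have h1 := hw i j j.2 hlt
      have h2 := hbτ.adj _ (mem_supp.1 (hl.mem i i.2)).1 _ (mem_supp.1 (hl.mem j j.2)).1
      simp only [setReg_arr]
      rw [h1, hval]
      simp only [h2, SimpleGraph.comap_adj, Function.Embedding.coeFn_mk]

end Output

/-! ### The complete algorithm and its bounds. -/

section Kernel

/-- The kernelization algorithm. -/
def kernelP : Program :=
  .seq rowsP (.seq packP (.seq (.cond (.sub (.reg 4) (.reg 1)) .skip (.seq tidyP keepP))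
    (.seq (take 8 9 2 12 (rd 3 8) (.const 1)) outP)))

variable {s k n : ℕ} {H : SimpleGraph ℕ}

theorem supp_subset_range (n : ℕ) (f : ℕ → ℕ) : supp n f ⊆ Finset.range n :=
  Finset.filter_subset _ _

theorem range_sdiff_supp (n : ℕ) (f : ℕ → ℕ) : Finset.range n \ supp n f = zeros n f := by
  ext j
  rw [Finset.mem_sdiff, mem_supp, mem_zeros, Finset.mem_range]
  exact ⟨fun h => ⟨h.1, by_contra fun h' => h.2 ⟨h.1, h'⟩⟩, fun h => ⟨h.1, fun h' => h'.2 h.2⟩⟩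

/-- A large packing of small bad sets is a kernel. -/
theorem kernel_of_packing {X : Finset ℕ} (hs : 1 ≤ s) (hX : X ⊆ Finset.range n)
    (h : Packing (SmallBad s H) (k + 1) X) :
    (Yes s H (Finset.range n) k ↔ Yes s H X k) ∧ X.card ≤ 1000 * (max k 1) ^ 2 * s ^ 3 := by
  -- Both sides are false: `k + 1` disjoint bad sets cannot be met by `k` vertices.
  refine ⟨⟨fun hy => absurd hy (h.not_yes (fun F hF => hF.1) hX (by omega)),
    fun hy => absurd hy (h.not_yes (fun F hF => hF.1) le_rfl (by omega))⟩, ?_⟩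
  have h1 := h.card_le fun F hF => hF.2
  have hm : 1 ≤ max k 1 := le_max_right _ _
  have hk : k ≤ max k 1 := le_max_left _ _
  generalize max k 1 = m at *
  calc X.card ≤ (k + 1) * (3 * s + 5) := h1
    _ ≤ (2 * m) * (8 * s) := Nat.mul_le_mul (by omega) (by omega)
    _ = 16 * m * s := by ring
    _ ≤ 1000 * m ^ 2 * s ^ 3 := by
      refine Nat.mul_le_mul (Nat.mul_le_mul (by omega) ?_) ?_
      · exact Nat.le_self_pow (by omega) _
      · exact Nat.le_self_pow (by omega) _

/-- With `m = max k 1`, there are at most `8ms` vertices in `X` and `48m²s²` in `T`. The terms in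
`|T| * s` dominate and give `m²s³`; those in `|X|` contribute at most `ms³`. -/
theorem kernel_of_tidy {X T Fo K : Finset ℕ} {lab : ℕ → ℕ} {U : Finset ℕ}
    (h : Tidy s k H U X T Fo lab) (hK : IsKernel s H U X T Fo lab K)
    (hX : X.card ≤ k * (3 * s + 5)) (hT : T.card ≤ X.card * ((k + 1) * (2 * s + 1))) :
    (Yes s H U k ↔ Yes s H K k) ∧ K.card ≤ 1000 * (max k 1) ^ 2 * s ^ 3 := by
  refine ⟨hK.yes_iff h, (hK.card_le_of_tidy h).trans ?_⟩
  have hs := h.one_le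
  have hm : 1 ≤ max k 1 := le_max_right _ _
  have hk : k ≤ max k 1 := le_max_left _ _
  generalize max k 1 = m at *
  have hX' : X.card ≤ 8 * (m * s) := hX.trans
    ((Nat.mul_le_mul hk (show 3 * s + 5 ≤ 8 * s by omega)).trans_eq (by ring))
  have hT' : T.card ≤ 48 * (m ^ 2 * s ^ 2) := hT.trans
    ((Nat.mul_le_mul hX' (Nat.mul_le_mul (show k + 1 ≤ 2 * m by omega)
      (show 2 * s + 1 ≤ 3 * s by omega))).trans_eq (by ring))
  have e1 : m * s ≤ m ^ 2 * s ^ 3 :=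
    Nat.mul_le_mul (Nat.le_self_pow (by omega) _) (Nat.le_self_pow (by omega) _)
  have e2 : m * s ^ 3 ≤ m ^ 2 * s ^ 3 := Nat.mul_le_mul_right _ (Nat.le_self_pow (by omega) _)
  calc X.card + (T.card * s + X.card * (10 * s * s)) + 4 * s * (T.card + X.card * (2 * s))
      ≤ 8 * (m * s) + (48 * (m ^ 2 * s ^ 2) * s + 8 * (m * s) * (10 * s * s)) +
          4 * s * (48 * (m ^ 2 * s ^ 2) + 8 * (m * s) * (2 * s)) := by gcongr
    _ = 8 * (m * s) + 240 * (m ^ 2 * s ^ 3) + 144 * (m * s ^ 3) := by ring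
    _ ≤ 1000 * m ^ 2 * s ^ 3 := by
      rw [Nat.mul_assoc]
      omega

/-- The label `0` needs care, as its class is not known to be a plex; once the packing is finished,
only vertices of `X` carry it. -/
theorem Finished.tidy (hs : 1 ≤ s) {inX lab T used fc : ℕ → ℕ} (h : Finished n H inX lab)
    (hlab : ∀ j < n, inX j ≠ 0 → lab j = 0) (hplex : ∀ c ≠ 0, Plex s H (cls n lab c))
    (ht : TidyInv s k n H (supp n inX) (zeros n inX) n T used fc) :
    Tidy s k H (Finset.range n) (supp n inX) (supp n T) ((supp n inX).filter (fc · ≠ 0)) lab := by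
  have hlt : ∀ x ∈ supp n inX, x < n := fun x hx => (mem_supp.1 hx).1
  refine ⟨hs, supp_subset_range _ _, ?_, Finset.filter_subset _ _, ?_, fun c => ?_, ?_, ?_⟩
  · rw [range_sdiff_supp]
    exact ht.subset
  · rw [range_sdiff_supp]
    intro u hu v hv huv
    rw [mem_zeros] at hu hv
    exact h.closed u hu.1 v hv.1 hu.2 hv.2 huv
  · rw [range_sdiff_supp]
    by_cases hc : c = 0
    · rw [Finset.filter_eq_empty_iff.2 fun j hj => ?_]
      · exact fun v hv => absurd hv (Finset.notMem_empty v)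
      · rw [mem_zeros] at hj
        exact hc ▸ h.lab_ne_zero j hj.1 hj.2
    · convert hplex c hc using 1
      ext j
      rw [Finset.mem_filter, mem_zeros, mem_cls]
      exact ⟨fun g => ⟨g.1.1, g.2⟩, fun g => ⟨⟨g.1, by_contra fun g' =>
        hc (g.2.symm.trans (hlab j g.1 g'))⟩, g.2⟩⟩
  · intro x hx
    rw [Finset.mem_filter] at hx
    exact ht.forced x hx.1 (hlt x hx.1) hx.2
  · rw [range_sdiff_supp]
    intro x hx
    rw [Finset.mem_sdiff, Finset.mem_filter, not_and, not_not] at hx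
    exact ht.similar x hx.1 (hlt x hx.1) (hx.2 hx.1)

theorem FillInv.isKernel {inX keep quo lab : ℕ → ℕ} {T Fo : Finset ℕ}
    (h : FillInv n (zeros n inX) (marked H (supp n inX \ Fo) (zeros n inX) T lab) lab n
      (quota s H (supp n inX \ Fo) (zeros n inX) T lab) quo keep) :
    IsKernel s H (Finset.range n) (supp n inX) T Fo lab (supp n inX ∪ supp n keep) := by
  have hd : Disjoint (supp n inX) (supp n keep) :=
    (Finset.disjoint_left.2 fun a ha hb =>
      (mem_supp.1 ha).2 (mem_zeros.1 (h.supp_subset hb)).2)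
  set M := marked H (supp n inX \ Fo) (zeros n inX) T lab with hM
  have hsd : (supp n inX ∪ supp n keep) \ (supp n inX ∪ M) = supp n keep \ M := by
    rw [← Finset.sup_eq_union, ← Finset.sup_eq_union, ← sdiff_sdiff_left, hd.sup_sdiff_cancel_left]
  refine ⟨Finset.union_subset (supp_subset_range _ _) (supp_subset_range _ _),
    Finset.subset_union_left, ?_, fun c => ?_, fun u hu => ?_⟩
  all_goals rw [range_sdiff_supp, ← hM]
  · exact h.subset.trans Finset.subset_union_right
  · rw [hsd, ← h.quo_add c]
    omega
  · rw [hsd, ← h.quo_add]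
    rw [Finset.mem_sdiff, Finset.mem_union, not_or] at hu
    have := h.quo_zero u (Finset.mem_range.1 hu.1) (by
      rw [← range_sdiff_supp, Finset.mem_sdiff]
      exact ⟨hu.1, hu.2.1⟩) hu.2.2
    omega

/-- The vertices that are kept form a kernel. -/
theorem selectKernel_spec {σ : State} (hs : 1 ≤ s) (hb : Base s k n H σ)
    (hp : Packing (SmallBad s H) (σ.reg 4) (supp n (σ.arr 3)))
    (hlab : ∀ j < n, σ.arr 3 j ≠ 0 → σ.arr 4 j = 0)
    (hplex : ∀ c ≠ 0, Plex s H (cls n (σ.arr 4) c))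
    (hor : σ.reg 4 = k + 1 ∨ σ.reg 4 ≤ k ∧ Finished n H (σ.arr 3) (σ.arr 4))
    (h0 : ∀ j, σ.arr 7 j = 0 ∧ σ.arr 8 j = 0 ∧ σ.arr 9 j = 0 ∧ σ.arr 10 j = 0 ∧ σ.arr 11 j = 0 ∧
      σ.arr 12 j = 0) :
    Tr (.cond (.sub (.reg 4) (.reg 1)) .skip (.seq tidyP keepP)) σ
      (4 + (600 * ((k * (3 * s + 5) + 1) * ((n + 1) * (n + 1))) + 700 * ((n + 1) * (n + 1))))
      fun τ => Base s k n H τ ∧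
        ((Yes s H (Finset.range n) k ↔ Yes s H (supp n (τ.arr 3) ∪ supp n (τ.arr 12)) k) ∧
          (supp n (τ.arr 3) ∪ supp n (τ.arr 12)).card ≤ 1000 * (max k 1) ^ 2 * s ^ 3) := by
  have hk : σ.reg 1 = k := hb.reg_one
  refine Tr.cond (fun h => Tr.mono (Tr.skip (Q := fun τ => Base s k n H τ ∧ _) ⟨hb, ?_⟩)
    (Nat.succ_le_of_lt (by positivity)) fun _ h => h) fun h => ?_
  -- More than `k` bad sets were packed. Array `12` is still zero, so exactly their union is kept.
  · simp only [eval_sub, eval_reg, hk] at h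
    have e : supp n (σ.arr 12) = ∅ := Finset.eq_empty_of_forall_notMem fun j hj =>
      (mem_supp.1 hj).2 (h0 j).2.2.2.2.2
    rw [e, Finset.union_empty]
    have h4 : σ.reg 4 = k + 1 := by omega
    exact kernel_of_packing hs (supp_subset_range _ _) (h4 ▸ hp)
  · simp only [eval_sub, eval_reg, hk] at h
    obtain ⟨h4, hfin⟩ : σ.reg 4 ≤ k ∧ Finished n H (σ.arr 3) (σ.arr 4) :=
      hor.resolve_left (by omega)
    have hX : (supp n (σ.arr 3)).card ≤ k * (3 * s + 5) :=
      (hp.card_le fun F hF => hF.2).trans (Nat.mul_le_mul_right _ h4)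
    refine Tr.mono (Tr.seq' (tidyP_spec hb fun j _ => ⟨(h0 j).1, (h0 j).2.1⟩) ?_)
      (Nat.add_le_add_right (Nat.mul_le_mul_left _ (Nat.mul_le_mul_right _
        (Nat.add_le_add_right hX 1))) _) fun _ h => h
    rintro τ ⟨hf, ht⟩
    have e3 : τ.arr 3 = σ.arr 3 := hf.arr 3 (by decide)
    have e4 : τ.arr 4 = σ.arr 4 := hf.arr 4 (by decide)
    have htidy := hfin.tidy hs hlab hplex ht
    set Fo := (supp n (σ.arr 3)).filter (τ.arr 13 · ≠ 0) with hFo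
    refine (keepP_spec (Y := supp n (σ.arr 3) \ Fo) (hb.frame hf (by decide) (by decide)) ?_
      fun j => ?_).mono le_rfl ?_
    · intro x
      rw [hFo, Finset.mem_sdiff, Finset.mem_filter, not_and, not_not, mem_supp, e3]
      exact ⟨fun g => ⟨g.1.1, g.1.2, g.2 g.1⟩, fun g => ⟨⟨g.1, g.2.1⟩, fun _ => g.2.2⟩⟩
    · rw [hf.arr 9 (by decide), hf.arr 10 (by decide), hf.arr 11 (by decide),
        hf.arr 12 (by decide)]
      exact (h0 j).2.2
    · rintro υ ⟨hf', hfill⟩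
      rw [e3, e4] at hfill
      rw [hf'.arr 3 (by decide), e3]
      refine ⟨(hb.frame hf (by decide) (by decide)).frame hf' (by decide) (by decide),
        kernel_of_tidy htidy hfill.isKernel hX ?_⟩
      exact ht.card_le.trans (Nat.mul_le_mul_right _ (Finset.card_filter_le _ _))

/-- The petals dominate the time, with `O(n²)` for each of the `O(ks)` vertices of `X`. The maxima
with `1` absorb the lower-order terms when `k` or `n` is `0`. -/
theorem kernelP_spec (hs : 1 ≤ s) (k : ℕ) (G : SimpleGraph (Fin n)) :
    Tr kernelP (input s k G) (100000 * max k 1 * s * (max n 1) ^ 2) fun τ =>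
      ∃ (n' : ℕ) (G' : SimpleGraph (Fin n')), Outputs τ G' k ∧
        (IsYesInstance s G k ↔ IsYesInstance s G' k) ∧
        n' ≤ 1000 * (max k 1) ^ 2 * s ^ 3 := by
  set H := G.map Fin.valEmbedding with hH
  have hG : IsYesInstance s G k ↔ Yes s H (Finset.range n) k := by
    have := isYesInstance_comap_iff (s := s) (k := k) (H := H) (Fin.valEmbedding (n := n))
    rwa [hH, SimpleGraph.comap_map_eq, Fin.map_valEmbedding_univ, Nat.Iio_eq_range] at this
  have hin : ∀ a j, a ≠ 0 → (input s k G).arr a j = 0 := fun a j ha => by simp [input, ha]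
  refine Tr.mono (T₁ := 20 * (n + 1) + (1200 * ((k + 2) * (n + 1) * (n + 1)) +
    ((4 + (600 * ((k * (3 * s + 5) + 1) * ((n + 1) * (n + 1))) + 700 * ((n + 1) * (n + 1)))) +
      (100 * (n + 1) + 100 * ((n + 1) * (n + 1)))))) (Tr.seq' (rowsP_spec s k G) ?_) ?_ fun _ h => h
  · rintro σ₁ ⟨hf₁, hb₁⟩
    have z₁ : ∀ a, a ≠ 0 → a ≠ 2 → ∀ j, σ₁.arr a j = 0 := fun a h h' j => by
      rw [hf₁.arr a (by simpa using h'), hin a j h]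
    refine Tr.seq' (packP_spec hs hb₁ ?_ fun j _ => ⟨z₁ 3 (by decide) (by decide) j,
      z₁ 4 (by decide) (by decide) j, z₁ 5 (by decide) (by decide) j⟩) ?_
    · rw [hf₁.reg 4 (by decide)]
      rfl
    rintro σ₂ ⟨hf₂, hp, hlab, hplex, hor⟩
    have z₂ : ∀ a ≥ 7, ∀ j, σ₂.arr a j = 0 := fun a h j => by
      rw [hf₂.arr a (by simp; omega), z₁ a (by omega) (by omega)]
    refine Tr.seq' (selectKernel_spec hs (hb₁.frame hf₂ (by decide) (by decide)) hp hlab hplex hor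
      fun j => ⟨z₂ 7 (by omega) j, z₂ 8 (by omega) j, z₂ 9 (by omega) j, z₂ 10 (by omega) j,
        z₂ 11 (by omega) j, z₂ 12 (by omega) j⟩) ?_
    rintro σ₃ ⟨hb₃, hyes, hcard⟩
    refine Tr.seq' (take_all_spec (n := n) (fun j => σ₃.arr 3 j ≠ 0) (fun _ => 1) hb₃.reg_two
      (by decide) (by decide) ?_) ?_
    · intro j hj τ hf hi _
      simp [hi, hf.arr]
    rintro σ₄ ⟨hf₄, -, h12⟩
    have hK : supp n (σ₄.arr 12) = supp n (σ₃.arr 3) ∪ supp n (σ₃.arr 12) := by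
      ext j
      rw [Finset.mem_union, mem_supp, mem_supp, mem_supp, h12]
      by_cases h1 : j < n <;> by_cases h2 : σ₃.arr 3 j = 0 <;> simp [h1, h2]
    refine (outP_spec (hb₃.frame hf₄ (by decide) (by decide))).mono le_rfl ?_
    rintro τ ⟨f, hf, hout⟩
    refine ⟨_, _, hout, ?_, ?_⟩
    · rw [isYesInstance_comap_iff, hf, hK, hG]
      exact hyes
    · rw [hK]
      exact hcard
  · have hm : 1 ≤ max k 1 := le_max_right _ _
    have hk : k ≤ max k 1 := le_max_left _ _
    have hN : 1 ≤ max n 1 := le_max_right _ _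
    have hn : n ≤ max n 1 := le_max_left _ _
    generalize max k 1 = m at *
    generalize max n 1 = N at *
    have hms : 1 ≤ m * s := Nat.mul_pos hm hs
    have e1 : k + 2 ≤ 3 * (m * s) := by nlinarith
    have e2 : k * (3 * s + 5) + 1 ≤ 9 * (m * s) := by
      have := Nat.mul_le_mul hk (show 3 * s + 5 ≤ 8 * s by omega)
      have e : m * (8 * s) = 8 * (m * s) := by ring
      omega
    have e3 : n + 1 ≤ 2 * N := by omega
    have e4 : (n + 1) * (n + 1) ≤ 4 * N ^ 2 := (Nat.mul_le_mul e3 e3).trans_eq (by ring)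
    have e5 : n + 1 ≤ 4 * N ^ 2 := le_trans (by nlinarith) e4
    have e6 : N ^ 2 ≤ m * s * N ^ 2 := Nat.le_mul_of_pos_left _ hms
    have e7 : 1 ≤ N ^ 2 := Nat.one_le_pow _ _ hN
    have e8 : (k + 2) * (n + 1) * (n + 1) ≤ 12 * (m * s * N ^ 2) := by
      rw [Nat.mul_assoc]
      exact (Nat.mul_le_mul e1 e4).trans_eq (by ring)
    have e9 : (k * (3 * s + 5) + 1) * ((n + 1) * (n + 1)) ≤ 36 * (m * s * N ^ 2) :=
      (Nat.mul_le_mul e2 e4).trans_eq (by ring)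
    have e10 : 100000 * m * s * N ^ 2 = 100000 * (m * s * N ^ 2) := by ring
    rw [e10]
    generalize m * s * N ^ 2 = Z at *
    omega

end Kernel

end SPlexKernel

theorem mainTheorem2 :
    ∃ (P : RAM.Program) (C : ℕ), ∀ s : ℕ, 1 ≤ s →
      ∀ (n : ℕ) (G : SimpleGraph (Fin n)) (k : ℕ),
        ∃ (t : ℕ) (σ : RAM.State) (n' : ℕ) (G' : SimpleGraph (Fin n')) (k' : ℕ),
          RAM.Run P (RAM.input s k G) t σ ∧
          RAM.Outputs σ G' k' ∧
          k' ≤ k ∧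
          (IsYesInstance s G k ↔ IsYesInstance s G' k') ∧
          n' ≤ C * (max k 1) ^ 2 * s ^ 3 ∧
          t ≤ C * max k 1 * s * (max n 1) ^ 2 := by
  -- One constant serves for time and size, although `1000` would do for the size.
  refine ⟨SPlexKernel.kernelP, 100000, fun s hs n G k => ?_⟩
  obtain ⟨t, σ, hr, ht, n', G', ho, hy, hn⟩ := SPlexKernel.kernelP_spec hs k G
  refine ⟨t, σ, n', G', k, hr, ho, le_rfl, hy, hn.trans ?_, ht⟩
  exact Nat.mul_le_mul_right _ (Nat.mul_le_mul_right _ (by omega))
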